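/- **Conventions.** A (regular) weak Hopf $C^*$-algebra (WHA) is a finite-dimensional $C^*$-algebra $B$ with a coassociative comultiplication $\Delta:B\to B\otimes B$ with counit $\varepsilon$ and a linear map $S:B\to B$ such that $\Delta$ is a (not necessarily unital) $*$-homomorphism, $\varepsilon(bc_{(1)})\varepsilon(c_{(2)}d)=\varepsilon(bcd)$, $(\Delta(1)\otimes1)(1\otimes\Delta(1))=(\Delta\otimes\mathrm{id})\Delta(1)$, $S$ is an anti-algebra and anti-coalgebra map, $m(\mathrm{id}\otimes S)\Delta(b)=\varepsilon_t(b):=(\varepsilon\otimes\mathrm{id})(\Delta(1)(b\otimes1))$, $m(S\otimes\mathrm{id})\Delta(b)=\varepsilon_s(b):=(\mathrm{id}\otimes\varepsilon)((1\otimes b)\Delta(1))$, and $S^2=\mathrm{id}$ on $\varepsilon_t(B)$. * A *right coideal* of $B$ is a unital $*$-subalgebra $I\subset B$ with $\Delta(I)\subset I\otimes B$. * A *quotient type coideal* of $B$ is a set of the form $\{b\in B:\ (\pi\otimes\mathrm{id})\Delta(b)=(\pi\otimes\mathrm{id})((1\otimes b)\Delta(1))\}$, where $\pi:B\to C$ is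 a surjective unital $*$-homomorphism onto a WHA $C$ with $\Delta_C\pi=(\pi\otimes\pi)\Delta$, $S_C\pi=\pi S$, $\varepsilon_C\pi=\varepsilon$. * A right coideal $I$ is *invariant* if $I\triangleleft B=I$, where $b\triangleleft x=S(x_{(1)})\,b\,x_{(2)}$ and $I\triangleleft B$ is the linear span of the elements $b\triangleleft x$ with $b\in I$, $x\in B$. **The Tambara–Yamagami WHA.** Let $G$ be a finite abelian group (written additively), $\chi:G\times G\to\mathbb T$ a nondegenerate symmetric bicharacter, $\tau=\pm|G|^{-1/2}$. Put $\Omega=G\sqcup\{m\}$, $\Omega_g=\Omega$ for $g\in G$ and $\Omega_m=G\sqcup\overline G$, where $\overline G$ is a second copy of $G$; let $H^x$ $(x\in\Omega)$ be the Hilbert space with orthonormal basis $\{v^x_y\}_{y\in\Omega_x}$. Let $\circ$ be the bilinear product on $\bigoplus_xH^x$ with, for $g,h,k\in G$, $$v^g_k\circ v^h_x=\delta_{x,h+k}v^{g+h}_{h+k},\quad v^g_m\circ v^h_x=\delta_{x,m}v^{g+h}_m,\quad v^m_k\circ v^g_x=\delta_{x,m}\chi(g,k)v^m_k,\quad v^m_{\overline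 k}\circ v^g_x=\delta_{x,g+k}v^m_{\overline{g+k}},$$ $$v^g_x\circ v^m_{\overline k}=\delta_{x,m}\chi(g,k)v^m_{\overline k},\quad v^g_x\circ v^m_k=\delta_{x,k}v^m_{k-g},\quad v^m_h\circ v^m_{\overline k}=v^{k-h}_k,\quad v^m_{\overline h}\circ v^m_k=\delta_{h,k}\,\tau\sum_{g\in G}\chi(g,h)^{-1}v^g_m,$$ and $v^m_h\circ v^m_k=v^m_{\overline h}\circ v^m_{\overline k}=0$. The WHA $\mathfrak G_{\mathcal{TY}}(G,\chi,\tau)$ reconstructed from the $C^*$-tensor category $\mathcal{TY}(G,\chi,\tau)$ (via Hayashi's functor) is $B=\bigoplus_{x\in\Omega}H^x\otimes\overline{H^x}$ with basis $f^x_{\alpha,\beta}=v^x_\alpha\otimes\overline{v^x_\beta}$ $(\alpha,\beta\in\Omega_x)$ and $$f^x_{\alpha,\beta}f^y_{\gamma,\delta}=(v^x_\alpha\circ v^y_\gamma)\otimes\overline{(v^x_\beta\circ v^y_\delta)}$$ (the components in $H^z\otimes\overline{H^{z'}}$, $z\ne z'$, being dropped), unit $\sum_{a,b\in\Omega}f^0_{a,b}$,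 $\Delta(f^x_{\alpha,\beta})=\sum_{\gamma\in\Omega_x}f^x_{\alpha,\gamma}\otimes f^x_{\gamma,\beta}$, $\varepsilon(f^x_{\alpha,\beta})=\delta_{\alpha,\beta}$, $$S(f^x_{\alpha,\beta})=\frac{\sigma(\alpha)}{\sigma(\beta)}f^{x^*}_{\hat\beta,\hat\alpha},\qquad (f^x_{\alpha,\beta})^*=\frac{\sigma(\beta)}{\sigma(\alpha)}f^{x^*}_{\hat\alpha,\hat\beta},$$ where $g^*=-g$, $m^*=m$; for $\alpha\in\Omega_g$: $\sigma(\alpha)=1$, $\hat h=h-g$ $(h\in G)$, $\hat m=m$; and for $\alpha\in\Omega_m$: $\hat k=\overline k$, $\hat{\overline k}=k$, $\sigma(k)=1$, $\sigma(\overline k)=\tau$. For a subgroup $L\le G$ let $L^\perp=\{g\in G:\chi(g,h)=1\ \forall h\in L\}$ and $v^0_Y=\sum_{y\in Y}v^0_y$ for $Y\subset\Omega$, and define the subspaces of $B$ $$I^L=\operatorname{span}\{v^0_Y: Y\in G/L\}\otimes\overline{H^0}\;+\;\sum_{l\in L^\perp}\mathbb Cv^l_m\otimes\overline{H^l},\qquad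 I^\Omega=\mathbb Cv^0_\Omega\otimes\overline{H^0}=\varepsilon_s(B).$$ **Corollary.** In $\mathfrak G_{\mathcal{TY}}(G,\chi,\tau)$ the set of quotient type coideals and the set of invariant coideals coincide, and they are in bijection with $\overline{\mathrm{Subgrp}(G)}:=\mathrm{Subgrp}(G)\sqcup\{\Omega\}$, the set of subgroups of $G$ with one extra element $\Omega=G\sqcup\{m\}$; a bijection is $x\mapsto I^x$. -/

import Mathlib

open scoped TensorProduct
noncomputable section
universe u v

/-- The target counital map `ε_t(b) = (ε ⊗ id)(Δ(1)(b ⊗ 1))`. -/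
def targetCounit {B : Type u} [Ring B] [Algebra ℂ B] [Coalgebra ℂ B] (b : B) : B :=
  TensorProduct.lid ℂ B
    (LinearMap.rTensor B (Coalgebra.counit (R := ℂ) (A := B))
      (Coalgebra.comul (R := ℂ) (1 : B) * (b ⊗ₜ[ℂ] (1 : B))))

/-- The source counital map `ε_s(b) = (id ⊗ ε)((1 ⊗ b)Δ(1))`. -/
def sourceCounit {B : Type u} [Ring B] [Algebra ℂ B] [Coalgebra ℂ B] (b : B) : B :=
  TensorProduct.rid ℂ B
    (LinearMap.lTensor B (Coalgebra.counit (R := ℂ) (A := B))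
      (((1 : B) ⊗ₜ[ℂ] b) * Coalgebra.comul (R := ℂ) (1 : B)))

/-- A (regular) weak Hopf C*-algebra: a finite-dimensional C*-algebra `B` (encoded as a
finite-dimensional complex `*`-algebra with a faithful `*`-representation by matrices) with a
coassociative counital comultiplication `Δ : B → B ⊗ B`, a not necessarily unital `*`-homomorphism,
satisfying `ε(b c₁) ε(c₂ d) = ε(b c d)` and `(Δ(1) ⊗ 1)(1 ⊗ Δ(1)) = (Δ ⊗ id)Δ(1)`, and with an
antipode `S`, an anti-algebra and anti-coalgebra map with `m(id ⊗ S)Δ = ε_t`, `m(S ⊗ id)Δ = ε_s`.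
Regularity means that `S²` is the identity on the target counital subalgebra `ε_t(B)`. -/
class WeakHopfCStarAlgebra (B : Type u) extends
    Ring B, StarRing B, Algebra ℂ B, StarModule ℂ B, Coalgebra ℂ B where
  finite : Module.Finite ℂ B
  exists_faithful_rep : ∃ (n : ℕ) (ρ : B →⋆ₐ[ℂ] Matrix (Fin n) (Fin n) ℂ), Function.Injective ρ
  comul_mul : ∀ b c : B,
    Coalgebra.comul (R := ℂ) (b * c) = Coalgebra.comul (R := ℂ) b * Coalgebra.comul (R := ℂ) c
  comul_star : ∀ b : B, Coalgebra.comul (R := ℂ) (Star.star b) = Star.star (Coalgebra.comul (R := ℂ) b)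
  counit_mul_mul : ∀ b c d : B,
    LinearMap.mul' ℂ ℂ (TensorProduct.map
        (Coalgebra.counit (R := ℂ) (A := B) ∘ₗ LinearMap.mulLeft ℂ b)
        (Coalgebra.counit (R := ℂ) (A := B) ∘ₗ LinearMap.mulRight ℂ d)
        (Coalgebra.comul (R := ℂ) c))
      = Coalgebra.counit (R := ℂ) (b * c * d)
  comul_one : (Coalgebra.comul (R := ℂ) (1 : B) ⊗ₜ[ℂ] (1 : B)) *
      (TensorProduct.assoc ℂ B B B).symm ((1 : B) ⊗ₜ[ℂ] Coalgebra.comul (R := ℂ) (1 : B))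
      = LinearMap.rTensor B (Coalgebra.comul (R := ℂ) (A := B)) (Coalgebra.comul (R := ℂ) (1 : B))
  antipode : B →ₗ[ℂ] B
  antipode_one : antipode 1 = 1
  antipode_mul : ∀ b c : B, antipode (b * c) = antipode c * antipode b
  counit_antipode : ∀ b : B, Coalgebra.counit (R := ℂ) (antipode b) = Coalgebra.counit (R := ℂ) b
  comul_antipode : ∀ b : B, Coalgebra.comul (R := ℂ) (antipode b) =
    TensorProduct.map antipode antipode
      (TensorProduct.comm ℂ B B (Coalgebra.comul (R := ℂ) b))
  mul_antipode : ∀ b : B, LinearMap.mul' ℂ B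
    (LinearMap.lTensor B antipode (Coalgebra.comul (R := ℂ) b)) = targetCounit b
  antipode_mul_self : ∀ b : B, LinearMap.mul' ℂ B
    (LinearMap.rTensor B antipode (Coalgebra.comul (R := ℂ) b)) = sourceCounit b
  regular : ∀ b : B, antipode (antipode (targetCounit b)) = targetCounit b

/-- A surjective morphism of weak Hopf C*-algebras, i.e. a surjective unital `*`-homomorphism
`π : B → C` with `Δ π = (π ⊗ π) Δ`, `S π = π S` and `ε π = ε`. It makes `C` a quantum
subgroupoid of `B`. -/
structure IsQuantumSubgroupoid {B : Type u} {C : Type v} [WeakHopfCStarAlgebra B] [WeakHopfCStarAlgebra C]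
    (π : B →⋆ₐ[ℂ] C) : Prop where
  surjective : Function.Surjective π
  comul_comp : ∀ b, Coalgebra.comul (R := ℂ) (π b) =
    TensorProduct.map π.toAlgHom.toLinearMap π.toAlgHom.toLinearMap (Coalgebra.comul (R := ℂ) b)
  antipode_comp : ∀ b, WeakHopfCStarAlgebra.antipode (π b) = π (WeakHopfCStarAlgebra.antipode b)
  counit_comp : ∀ b, Coalgebra.counit (R := ℂ) (π b) = Coalgebra.counit (R := ℂ) b

open WeakHopfCStarAlgebra in
/-- The right adjoint action `b ◁ x = S(x₁) b x₂`. -/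
def adj {B : Type u}  [WeakHopfCStarAlgebra B] (b x : B) : B :=
  LinearMap.mul' ℂ B (TensorProduct.map antipode (LinearMap.mulLeft ℂ b) (Coalgebra.comul (R := ℂ) x))
/-- A right coideal: a unital `*`-subalgebra `I` of `B` with `Δ(I) ⊆ I ⊗ B`. -/
structure IsRightCoideal {B : Type u} [WeakHopfCStarAlgebra B] (I : Submodule ℂ B) : Prop where
  one_mem : (1 : B) ∈ I
  mul_mem : ∀ b ∈ I, ∀ c ∈ I, b * c ∈ I
  star_mem : ∀ b ∈ I, Star.star b ∈ I
  comul_mem : ∀ b ∈ I, Coalgebra.comul (R := ℂ) b ∈ LinearMap.range (LinearMap.rTensor B I.subtype)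

/-- The fixed points of the left coaction `(π ⊗ id)Δ` of `C` on `B`, that is the set of all `b`
with `(π ⊗ id)Δ(b) = (π ⊗ id)((1 ⊗ b)Δ(1))`. -/
def quotientFixed {B : Type u} {C : Type v} [WeakHopfCStarAlgebra B] [WeakHopfCStarAlgebra C]
    (π : B →⋆ₐ[ℂ] C) : Submodule ℂ B where
  carrier := {b | LinearMap.rTensor B π.toAlgHom.toLinearMap (Coalgebra.comul (R := ℂ) b) =
    LinearMap.rTensor B π.toAlgHom.toLinearMap
      (((1 : B) ⊗ₜ[ℂ] b) * Coalgebra.comul (R := ℂ) (1 : B))}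
  add_mem' := by
    intro b c hb hc
    simp only [Set.mem_ofPred_eq] at hb hc ⊢
    rw [map_add, map_add, hb, hc, TensorProduct.tmul_add, add_mul, map_add]
  zero_mem' := by simp
  smul_mem' := by
    intro r b hb
    simp only [Set.mem_ofPred_eq] at hb ⊢
    rw [map_smul, map_smul, hb, TensorProduct.tmul_smul, smul_mul_assoc, map_smul]

/-- The quotient type coideals of `B`: the fixed point sets of all quantum subgroupoids of `B`.
(A quantum subgroupoid is a quotient of `B`, so quantifying over one universe loses nothing.) -/
def quotientTypeCoideals (B : Type u) [WeakHopfCStarAlgebra B] : Set (Submodule ℂ B) :=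
  {I | ∃ (C : Type u) (_ : WeakHopfCStarAlgebra C) (π : B →⋆ₐ[ℂ] C),
    IsQuantumSubgroupoid π ∧ I = quotientFixed π}

/-- The invariant coideals of `B`: right coideals `I` with `I ◁ B = I`, where `I ◁ B` is the linear
span of all `a ◁ x` with `a ∈ I`, `x ∈ B`. -/
def invariantCoideals (B : Type u) [WeakHopfCStarAlgebra B] : Set (Submodule ℂ B) :=
  {I | IsRightCoideal I ∧ Submodule.span ℂ {c | ∃ a ∈ I, ∃ x : B, c = adj a x} = I}


/-- The datum of a Tambara–Yamagami C*-tensor category: a nondegenerate symmetric bicharacter `χ`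
with values in the unit circle on the finite abelian group `G`, and a number `τ = ±|G|^(-1/2)`. -/
structure TYDatum (G : Type u) [AddCommGroup G] [Fintype G] where
  chi : G → G → Circle
  chi_add_left : ∀ g h k : G, chi (g + h) k = chi g k * chi h k
  chi_symm : ∀ g h : G, chi g h = chi h g
  nondegenerate : ∀ g : G, (∀ h : G, chi g h = 1) → g = 0
  tau : ℝ
  tau_eq : tau = 1 / √(Fintype.card G : ℝ) ∨ tau = -(1 / √(Fintype.card G : ℝ))

/-- The basis vectors of `⊕ₓ Hˣ`, where `x` runs over `Ω = G ⊔ {m}`: for `x = g` in `G` the vectors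
`v^g_h` (`gh g h`) and `v^g_m` (`gm g`), and for `x = m` the vectors `v^m_k` (`mg k`) and
`v^m_{k̄}` (`mbar k`), where `k̄` lies in a second copy of `G`. -/
inductive TYVec (G : Type u) : Type u
  | gh (g h : G) : TYVec G
  | gm (g : G) : TYVec G
  | mg (k : G) : TYVec G
  | mbar (k : G) : TYVec G
  deriving DecidableEq

namespace TYVec

def sumEquiv (G : Type u) : (((G × G) ⊕ G) ⊕ (G ⊕ G)) ≃ TYVec G where
  toFun
    | .inl (.inl (g, h)) => gh g h
    | .inl (.inr g) => gm g
    | .inr (.inl k) => mg k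
    | .inr (.inr k) => mbar k
  invFun
    | gh g h => .inl (.inl (g, h))
    | gm g => .inl (.inr g)
    | mg k => .inr (.inl k)
    | mbar k => .inr (.inr k)
  left_inv := by rintro ((⟨g, h⟩ | g) | (k | k)) <;> rfl
  right_inv := by rintro (⟨g, h⟩ | g | k | k) <;> rfl

instance (G : Type u) [Fintype G] : Fintype (TYVec G) := Fintype.ofEquiv _ (sumEquiv G)

theorem sum_eq {G : Type u} [Fintype G] {M : Type v} [AddCommMonoid M] (F : TYVec G → M) :
    ∑ p, F p = (∑ g, ∑ h, F (gh g h)) + (∑ g, F (gm g)) + ((∑ k, F (mg k)) + ∑ k, F (mbar k)) := by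
  rw [← (sumEquiv G).sum_comp]
  simp [Fintype.sum_sum_type, Fintype.sum_prod_type, sumEquiv]

/-- The index `x` of the space `Hˣ` in which a basis vector lies. The set `Ω = G ⊔ {m}` is
modelled by `Option G`, with `m` as `none`. -/
def grade {G : Type u} : TYVec G → Option G
  | gh g _ => some g
  | gm g => some g
  | mg _ => none
  | mbar _ => none

/-- The involution of basis vectors `v^g_h ↦ v^{-g}_{h-g}`, `v^g_m ↦ v^{-g}_m`,
`v^m_k ↔ v^m_{k̄}`. -/
def hat {G : Type u} [AddCommGroup G] : TYVec G → TYVec G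
  | gh g h => gh (-g) (h - g)
  | gm g => gm (-g)
  | mg k => mbar k
  | mbar k => mg k

end TYVec

section
variable {G : Type u} [AddCommGroup G] [Fintype G] [DecidableEq G]

/-- The product `∘` of basis vectors coming from the tensor structure of the fibre functor:
`v^g_k ∘ v^h_x = δ_{x,h+k} v^{g+h}_{h+k}`, `v^g_m ∘ v^h_x = δ_{x,m} v^{g+h}_m`,
`v^m_k ∘ v^g_x = δ_{x,m} χ(g,k) v^m_k`, `v^m_{k̄} ∘ v^g_x = δ_{x,g+k} v^m_{(g+k)‾}`,
`v^g_x ∘ v^m_{k̄} = δ_{x,m} χ(g,k) v^m_{k̄}`, `v^g_x ∘ v^m_k = δ_{x,k} v^m_{k-g}`,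
`v^m_h ∘ v^m_{k̄} = v^{k-h}_k`, `v^m_{h̄} ∘ v^m_k = δ_{h,k} τ ∑_g χ(g,h)⁻¹ v^g_m`,
all other products being zero. -/
def TYDatum.comp (D : TYDatum G) : TYVec G → TYVec G → (TYVec G →₀ ℂ)
  | .gh g k, .gh h x => if x = h + k then Finsupp.single (.gh (g + h) (h + k)) 1 else 0
  | .gm g, .gm h => Finsupp.single (.gm (g + h)) 1
  | .mg k, .gm g => Finsupp.single (.mg k) (D.chi g k : ℂ)
  | .mbar k, .gh g x => if x = g + k then Finsupp.single (.mbar (g + k)) 1 else 0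
  | .gm g, .mbar k => Finsupp.single (.mbar k) (D.chi g k : ℂ)
  | .gh g x, .mg k => if x = k then Finsupp.single (.mg (k - g)) 1 else 0
  | .mg h, .mbar k => Finsupp.single (.gh (k - h) k) 1
  | .mbar h, .mg k =>
      if h = k then ∑ g : G, Finsupp.single (.gm g) ((D.tau : ℂ) * (D.chi g h : ℂ)⁻¹) else 0
  | _, _ => 0

/-- The vector space `B = ⊕ₓ Hˣ ⊗ conj(Hˣ)`, `x ∈ Ω`: its basis is indexed by the pairs of basis
vectors in the same `Hˣ`. -/
@[nolint unusedArguments]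
def TYAlg (_D : TYDatum G) : Type u :=
  {i : TYVec G × TYVec G // i.1.grade = i.2.grade} →₀ ℂ

namespace TYAlg
open TYVec
variable (D : TYDatum G)

instance : AddCommGroup (TYAlg D) :=
  inferInstanceAs (AddCommGroup ({i : TYVec G × TYVec G // i.1.grade = i.2.grade} →₀ ℂ))
instance : Module ℂ (TYAlg D) :=
  inferInstanceAs (Module ℂ ({i : TYVec G × TYVec G // i.1.grade = i.2.grade} →₀ ℂ))

def coord : TYAlg D ≃ₗ[ℂ] ({i : TYVec G × TYVec G // i.1.grade = i.2.grade} →₀ ℂ) :=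
  LinearEquiv.refl ℂ _

instance : Module.Finite ℂ (TYAlg D) := Module.Finite.equiv (coord D).symm

/-- The basis element `f^x_{p,q} = p ⊗ conj(q)` for `p, q` in the same `Hˣ` (and zero otherwise). -/
def f (p q : TYVec G) : TYAlg D :=
  if h : p.grade = q.grade then (coord D).symm (Finsupp.single ⟨(p, q), h⟩ 1) else 0

variable {D} in
/-- The linear map with prescribed values on the basis. -/
def lift {M : Type v} [AddCommGroup M] [Module ℂ M] (T : TYVec G → TYVec G → M) :
    TYAlg D →ₗ[ℂ] M :=
  Finsupp.linearCombination ℂ (fun i : {i : TYVec G × TYVec G // i.1.grade = i.2.grade} =>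
    T i.1.1 i.1.2) ∘ₗ (coord D).toLinearMap

variable {D}
theorem f_of_ne {p q : TYVec G} (h : p.grade ≠ q.grade) : f D p q = 0 := by simp [f, h]

theorem lift_f {M : Type v} [AddCommGroup M] [Module ℂ M] (T : TYVec G → TYVec G → M)
    (p q : TYVec G) : lift (D := D) T (f D p q) = if p.grade = q.grade then T p q else 0 := by
  by_cases h : p.grade = q.grade <;> simp [f, lift, h]

theorem lift_f' {M : Type v} [AddCommGroup M] [Module ℂ M] (T : TYVec G → TYVec G → M)
    (hT : ∀ p q, p.grade ≠ q.grade → T p q = 0)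
    (p q : TYVec G) : lift (D := D) T (f D p q) = T p q := by
  rw [lift_f]; split_ifs with h
  · rfl
  · rw [hT _ _ h]

theorem hom_ext {M : Type v} [AddCommGroup M] [Module ℂ M] {S T : TYAlg D →ₗ[ℂ] M}
    (h : ∀ p q, p.grade = q.grade → S (f D p q) = T (f D p q)) : S = T := by
  have : S ∘ₗ (coord D).symm.toLinearMap = T ∘ₗ (coord D).symm.toLinearMap := by
    apply Finsupp.lhom_ext'
    rintro ⟨⟨p, q⟩, hpq⟩
    ext
    have := h p q hpq
    simpa [f, show p.grade = q.grade from hpq] using this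
  ext x
  exact LinearMap.congr_fun this (coord D x)

theorem induction {P : TYAlg D → Prop} (x : TYAlg D)
    (hf : ∀ p q, p.grade = q.grade → P (f D p q)) (h0 : P 0) (hadd : ∀ x y, P x → P y → P (x + y))
    (hsmul : ∀ (c : ℂ) x, P x → P (c • x)) : P x := by
  have : x ∈ Submodule.span ℂ {y | ∃ p q, p.grade = q.grade ∧ y = f D p q} := by
    have h1 : (⊤ : Submodule ℂ (TYAlg D)) ≤
        Submodule.span ℂ {y | ∃ p q, p.grade = q.grade ∧ y = f D p q} := by
      have : (Submodule.span ℂ {y | ∃ p q, p.grade = q.grade ∧ y = f D p q}).mkQ = 0 := by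
        apply hom_ext
        intro p q h
        simp only [Submodule.mkQ_apply, LinearMap.zero_apply, Submodule.Quotient.mk_eq_zero]
        exact Submodule.subset_span ⟨p, q, h, rfl⟩
      rw [← Submodule.ker_mkQ (Submodule.span ℂ {y | ∃ p q, p.grade = q.grade ∧ y = f D p q}), this]
      simp
    exact h1 trivial
  induction this using Submodule.span_induction with
  | mem x hx => obtain ⟨p, q, h, rfl⟩ := hx; exact hf p q h
  | zero => exact h0
  | add x y _ _ hx hy => exact hadd x y hx hy
  | smul c x _ hx => exact hsmul c x hx

variable (D) in
/-- The element `v ⊗ conj(w)` of `B`, for `v, w` in `⊕ₓ Hˣ` (components outside `B` are dropped). -/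
def outer (v w : TYVec G →₀ ℂ) : TYAlg D :=
  v.sum fun p a => w.sum fun q b => (a * (starRingEnd ℂ) b) • f D p q

variable (D) in
/-- The multiplication `(p ⊗ conj(p'))(q ⊗ conj(q')) = (p ∘ q) ⊗ conj(p' ∘ q')`. -/
def mulₗ : TYAlg D →ₗ[ℂ] TYAlg D →ₗ[ℂ] TYAlg D :=
  lift fun p p' => lift fun q q' => outer D (D.comp p q) (D.comp p' q')

instance : Mul (TYAlg D) := ⟨fun b c => mulₗ D b c⟩
/-- The unit, `(∑_{a ∈ Ω} v^0_a) ⊗ conj(∑_{b ∈ Ω} v^0_b)`. -/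
instance : One (TYAlg D) := ⟨∑ a : Option G, ∑ b : Option G,
  f D (a.elim (gm 0) (gh 0)) (b.elim (gm 0) (gh 0))⟩

theorem mul_def (b c : TYAlg D) : b * c = mulₗ D b c := rfl

def outerₗ (D : TYDatum G) : (TYVec G →₀ ℂ) →ₗ[ℂ] (TYVec G →₀ ℂ) →ₛₗ[starRingEnd ℂ] TYAlg D :=
  LinearMap.mk₂'ₛₗ (RingHom.id ℂ) (starRingEnd ℂ) (outer D)
    (by intro m n w; unfold outer
        rw [Finsupp.sum_add_index'] <;> simp [Finsupp.sum, add_mul, add_smul, Finset.sum_add_distrib])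
    (by intro c m w; unfold outer
        rw [Finsupp.sum_smul_index'] <;> simp [Finsupp.sum,  Finset.smul_sum, mul_smul])
    (by intro m n w; unfold outer
        rw [← Finsupp.sum_add]; congr 1; ext p a : 2
        rw [Finsupp.sum_add_index'] <;> simp [mul_add, add_smul])
    (by intro c m w; unfold outer
        rw [Finsupp.smul_sum]; congr 1; ext p a : 2
        rw [Finsupp.sum_smul_index', Finsupp.smul_sum] <;> simp [smul_smul]
        congr 1; ext : 2; ring_nf)

theorem outer_eq (v w : TYVec G →₀ ℂ) : outer D v w = outerₗ D v w := rfl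

theorem outer_single (p q : TYVec G) (a b : ℂ) :
    outerₗ D (Finsupp.single p a) (Finsupp.single q b) = (a * (starRingEnd ℂ) b) • f D p q := by
  simp [← outer_eq, outer]

theorem outer_sum (v w : TYVec G →₀ ℂ) :
    outerₗ D v w = ∑ r, ∑ s, (v r * (starRingEnd ℂ) (w s)) • f D r s := by
  rw [← outer_eq, outer, Finsupp.sum_fintype _ _ (by simp)]
  refine Finset.sum_congr rfl fun r _ => ?_
  rw [Finsupp.sum_fintype _ _ (by simp)]


set_option linter.unusedSectionVars false
set_option linter.unusedSimpArgs false

theorem f_mul_f (p p' q q' : TYVec G) (hp : p.grade = p'.grade) (hq : q.grade = q'.grade) :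
    f D p p' * f D q q' = outerₗ D (D.comp p q) (D.comp p' q') := by
  rw [mul_def, mulₗ, lift_f, if_pos hp, lift_f, if_pos hq, outer_eq]

abbrev RepIndex (G : Type u) := (G × Option G) ⊕ (G ⊕ G)

variable (D) in
/-- A faithful `*`-representation of `B` on the basis, by explicit matrices. -/
def repFun : TYVec G → TYVec G → Matrix (RepIndex G) (RepIndex G) ℂ
  | .gh s h, .gh _ k => Matrix.single (.inl (k - h, some (h - s))) (.inl (k - h, some h)) 1
  | .gm s, .gm _ => ∑ d, Matrix.single (.inl (d, none)) (.inl (d, none)) (D.chi s d : ℂ)⁻¹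
  | .mg h, .mg k => Matrix.single (.inl (k - h, some h)) (.inl (k - h, none)) 1
  | .mbar h, .mbar k => Matrix.single (.inl (k - h, none)) (.inl (k - h, some h)) 1
  | .gh s h, .gm _ => Matrix.single (.inr (.inl (h - s))) (.inr (.inl h)) 1
  | .gm s, .gh _ h => Matrix.single (.inr (.inr (h - s))) (.inr (.inr h)) 1
  | .mg h, .mbar k =>
      Matrix.single (.inr (.inl h)) (.inr (.inr k)) ((D.tau : ℂ) * (D.chi h k : ℂ)⁻¹)
  | .mbar h, .mg k => Matrix.single (.inr (.inr k)) (.inr (.inl h)) (D.chi h k : ℂ)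
  | _, _ => 0

variable (D) in
def repL : TYAlg D →ₗ[ℂ] Matrix (RepIndex G) (RepIndex G) ℂ := lift (repFun D)

theorem tau_sq (D : TYDatum G) : (D.tau : ℂ) * D.tau * (Fintype.card G : ℂ) = 1 := by
  have hc : (0 : ℝ) < Fintype.card G := by exact_mod_cast Fintype.card_pos
  have h : D.tau * D.tau * (Fintype.card G : ℝ) = 1 := by
    have h2 : (√(Fintype.card G : ℝ)) * √(Fintype.card G : ℝ) = Fintype.card G :=
      Real.mul_self_sqrt hc.le
    have h3 : √(Fintype.card G : ℝ) ≠ 0 := (Real.sqrt_pos.2 hc).ne'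
    rcases D.tau_eq with h | h <;> rw [h] <;> field_simp <;> nlinarith
  exact_mod_cast h

theorem tau_ne (D : TYDatum G) : (D.tau : ℂ) ≠ 0 := by
  intro h; have := tau_sq D; simp [h] at this

theorem chi_zero_left (D : TYDatum G) (k : G) : D.chi 0 k = 1 := by
  have := D.chi_add_left 0 0 k
  simpa using this

theorem chi_zero_right (D : TYDatum G) (k : G) : D.chi k 0 = 1 := by
  rw [D.chi_symm, chi_zero_left]

theorem chi_add_right (D : TYDatum G) (g h k : G) : D.chi g (h + k) = D.chi g h * D.chi g k := by
  rw [D.chi_symm, D.chi_add_left, D.chi_symm h, D.chi_symm k]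

theorem chi_neg_left (D : TYDatum G) (g k : G) : D.chi (-g) k = (D.chi g k)⁻¹ := by
  rw [eq_inv_iff_mul_eq_one, ← D.chi_add_left, neg_add_cancel, chi_zero_left]

theorem chi_neg_right (D : TYDatum G) (g k : G) : D.chi g (-k) = (D.chi g k)⁻¹ := by
  rw [D.chi_symm, chi_neg_left, D.chi_symm]

theorem chi_sub_left (D : TYDatum G) (g h k : G) : D.chi (g - h) k = D.chi g k * (D.chi h k)⁻¹ := by
  rw [sub_eq_add_neg, D.chi_add_left, chi_neg_left]

theorem chi_sub_right (D : TYDatum G) (g h k : G) :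
    D.chi g (h - k) = D.chi g h * (D.chi g k)⁻¹ := by
  rw [sub_eq_add_neg, chi_add_right, chi_neg_right]

theorem conj_chi (D : TYDatum G) (g k : G) : (starRingEnd ℂ) (D.chi g k : ℂ) = (D.chi g k : ℂ)⁻¹ := by
  rw [← Circle.coe_inv_eq_conj, Circle.coe_inv]

theorem sum_chi (D : TYDatum G) (g : G) :
    ∑ k, (D.chi g k : ℂ) = if g = 0 then (Fintype.card G : ℂ) else 0 := by
  let ψ : AddChar G ℂ :=
    { toFun := fun k => (D.chi g k : ℂ)
      map_zero_eq_one' := by simp [chi_zero_right]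
      map_add_eq_mul' := by intro a b; simp [chi_add_right] }
  have h := AddChar.sum_eq_ite ψ
  have h2 : ψ = 0 ↔ g = 0 := by
    constructor
    · intro h0
      apply D.nondegenerate
      intro k
      have : ψ k = 1 := by rw [h0]; simp
      exact Circle.ext this
    · rintro rfl
      ext k
      simp [ψ, chi_zero_left]
  simpa [h2, ψ] using h

theorem sum_chi_inv (D : TYDatum G) (g : G) :
    ∑ k, (D.chi g k : ℂ)⁻¹ = if g = 0 then (Fintype.card G : ℂ) else 0 := by
  have := sum_chi D (-g)
  simpa [chi_neg_left] using this


theorem repL_f {p q : TYVec G} (h : p.grade = q.grade) : repL D (f D p q) = repFun D p q := by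
  rw [repL, lift_f, if_pos h]

theorem single_mul_single {n : Type u} [Fintype n] [DecidableEq n] (i j k l : n) (a b : ℂ) :
    Matrix.single i j a * Matrix.single k l b = if j = k then Matrix.single i l (a * b) else 0 := by
  split_ifs with h
  · subst h; simp
  · simp [h]

theorem repL_outer_single (p q : TYVec G) (a b : ℂ) :
    repL D (outerₗ D (Finsupp.single p a) (Finsupp.single q b)) =
      if p.grade = q.grade then (a * (starRingEnd ℂ) b) • repFun D p q else 0 := by
  rw [outer_single, map_smul]
  split_ifs with h
  · rw [repL_f h]
  · rw [f_of_ne h]; simp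

theorem chi_mul_inv (D : TYDatum G) (g h : G) : (D.chi g h : ℂ) * (D.chi g h : ℂ)⁻¹ = 1 :=
  mul_inv_cancel₀ (Circle.coe_ne_zero _)

theorem chi_inv_mul (D : TYDatum G) (g h : G) : (D.chi g h : ℂ)⁻¹ * (D.chi g h : ℂ) = 1 :=
  inv_mul_cancel₀ (Circle.coe_ne_zero _)

set_option maxHeartbeats 1000000 in
theorem repL_mul_aux (p p' q q' : TYVec G) (hp : p.grade = p'.grade) (hq : q.grade = q'.grade) :
    repL D (outerₗ D (D.comp p q) (D.comp p' q')) = repFun D p p' * repFun D q q' := by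
  cases p <;> cases p' <;> simp [TYVec.grade] at hp <;> cases q <;> cases q' <;>
    simp [TYVec.grade] at hq <;> (try subst hp) <;> (try subst hq) <;>
    simp only [repFun, TYDatum.comp, single_mul_single, Finset.sum_mul, Finset.mul_sum, map_zero,
      LinearMap.zero_apply] <;>
    (try (simp; done)) <;> (try clear hp) <;> (try clear hq) <;>
    simp only [Sum.inl.injEq, Sum.inr.injEq, Prod.mk.injEq, Option.some.injEq, and_true]

  case gh.gh.gh.gh =>
    rename_i s h k t x y
    have e : t + h - (s + t) = h - s := by abel
    split_ifs with h1 h2 h3 h3 h3 h3 <;> simp [repL_outer_single, TYVec.grade, repFun, e] <;> grind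
  case gh.gh.mg.mg =>
    split_ifs with h1 h2 h3 h3 h3 h3 <;> simp [repL_outer_single, TYVec.grade, repFun] <;> grind
  case gh.gm.gh.gm =>
    rename_i s h t x
    have e : t + h - (s + t) = h - s := by abel
    split_ifs with h1 h2 h2 <;> simp [repL_outer_single, TYVec.grade, repFun, e] <;> grind
  case gh.gm.mg.mbar =>
    rename_i s h x k
    split_ifs with h1 <;> simp [repL_outer_single, TYVec.grade, repFun]
    subst h1
    congr 1
    simp only [conj_chi, chi_sub_left, Circle.coe_mul, Circle.coe_inv, mul_inv, inv_inv]
    linear_combination (D.tau : ℂ) * (D.chi h k : ℂ)⁻¹ * chi_mul_inv D s k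
  case gm.gh.gm.gh =>
    rename_i s h t x
    have e : t + h - (s + t) = h - s := by abel
    split_ifs with h1 h2 h2 <;> simp [repL_outer_single, TYVec.grade, repFun, e] <;> grind
  case gm.gh.mbar.mg =>
    rename_i s h x k
    split_ifs with h1 <;> simp [repL_outer_single, TYVec.grade, repFun]
    subst h1
    congr 1
    simp only [chi_sub_right, Circle.coe_mul, Circle.coe_inv]
    rw [D.chi_symm s x]
    linear_combination (D.chi x h : ℂ) * chi_mul_inv D x s
  case gm.gm.gm.gm =>
    simp [repL_outer_single, TYVec.grade, repFun, D.chi_add_left, mul_comm]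
  case gm.gm.mbar.mbar =>
    simp [repL_outer_single, TYVec.grade, repFun, conj_chi, chi_sub_right]
  case mg.mg.gm.gm =>
    simp [repL_outer_single, TYVec.grade, repFun, conj_chi, chi_sub_right]
  case mg.mg.mbar.mbar =>
    rename_i x y u v
    have : (u - x = v - y) ↔ (y - x = v - u) := by
      constructor <;> intro h <;> grind
    simp only [repL_outer_single, TYVec.grade, Option.some.injEq, this, repFun]
    split_ifs with h
    · simp [h]
    · rfl
  case mg.mbar.gm.gh =>
    rename_i x k t y
    split_ifs with h1 h2 h2 <;> simp [repL_outer_single, TYVec.grade, repFun] <;> try grind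
    subst h1
    congr 1
    simp only [chi_add_right, Circle.coe_mul, mul_inv]
    rw [D.chi_symm t x]
    linear_combination (D.tau : ℂ) * (D.chi x k : ℂ)⁻¹ * chi_mul_inv D x t
  case mg.mbar.mbar.mg =>
    rename_i x k y l
    split_ifs with h
    · subst h
      simp only [map_sum, repL_outer_single, TYVec.grade, Option.some.injEq, repFun,
        Finset.sum_ite_eq, Finset.mem_univ, if_true, Matrix.smul_single, smul_eq_mul]
      simp only [sub_sub_cancel]
      congr 1
      simp only [map_mul, map_inv₀, conj_chi, chi_sub_left, Circle.coe_mul, Circle.coe_inv,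
        mul_inv, inv_inv, Complex.conj_ofReal]
      ring
    · simp
  case mbar.mg.gh.gm =>
    rename_i x k t y
    split_ifs with h1 h2 h2 <;> simp [repL_outer_single, TYVec.grade, repFun] <;> try grind
    subst h1
    congr 1
    simp only [conj_chi, D.chi_add_left, Circle.coe_mul]
    linear_combination (D.chi x k : ℂ) * chi_inv_mul D t k
  case mbar.mg.mg.mbar =>
    rename_i x k y l
    split_ifs with h
    · subst h
      simp only [map_sum, LinearMap.sum_apply, repL_outer_single, TYVec.grade, Option.some.injEq,
        repFun, Finset.sum_ite_eq', Finset.mem_univ, if_true, Matrix.smul_single, smul_eq_mul]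
      simp only [sub_sub_cancel]
      congr 1
      simp only [map_one, chi_sub_left, Circle.coe_mul, Circle.coe_inv, mul_inv, inv_inv]
      rw [D.chi_symm x k, D.chi_symm x l]
      ring
    · simp
  case mbar.mbar.gh.gh =>
    split_ifs with h1 h2 h3 h3 h3 h3 <;> simp [repL_outer_single, TYVec.grade, repFun] <;> grind
  case mbar.mbar.mg.mg =>
    rename_i x y u v
    by_cases h : x = u
    swap
    · simp [h]
    by_cases h' : y = v
    swap
    · subst h; simp [h']
    subst h h'
    simp only [map_sum, LinearMap.sum_apply, repL_outer_single, TYVec.grade, Option.some.injEq,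
      repFun, Finset.sum_ite_eq', Finset.sum_ite_eq, Finset.mem_univ, if_true, and_true]
    have key : ∀ c, ∑ s, (D.tau : ℂ) * (D.chi s x : ℂ)⁻¹ *
        (starRingEnd ℂ) ((D.tau : ℂ) * (D.chi s y : ℂ)⁻¹) * (D.chi s c : ℂ)⁻¹ =
        if y - x = c then 1 else 0 := by
      intro c
      have : ∀ s, (D.tau : ℂ) * (D.chi s x : ℂ)⁻¹ *
        (starRingEnd ℂ) ((D.tau : ℂ) * (D.chi s y : ℂ)⁻¹) * (D.chi s c : ℂ)⁻¹ =
          (D.tau : ℂ) * D.tau * (D.chi (y - x - c) s : ℂ) := by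
        intro s
        rw [D.chi_symm (y - x - c) s]
        simp only [map_mul, map_inv₀, conj_chi, chi_sub_right, Circle.coe_mul, Circle.coe_inv,
          inv_inv, Complex.conj_ofReal]
        ring
      simp only [this, ← Finset.mul_sum, sum_chi, sub_eq_zero]
      split_ifs
      · exact tau_sq D
      · simp
    simp only [Finset.smul_sum, Matrix.smul_single, smul_eq_mul]
    rw [Finset.sum_comm]
    have h2 : ∀ c : G, ∑ s, Matrix.single (Sum.inl (c, none) : RepIndex G) (Sum.inl (c, none) : RepIndex G)
        ((D.tau : ℂ) * (D.chi s x : ℂ)⁻¹ *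
        (starRingEnd ℂ) ((D.tau : ℂ) * (D.chi s y : ℂ)⁻¹) * (D.chi s c : ℂ)⁻¹) =
        if y - x = c then Matrix.single (Sum.inl (c, none) : RepIndex G) (Sum.inl (c, none) : RepIndex G) 1 else 0 := by
      intro c
      have := map_sum (Matrix.singleAddMonoidHom (α := ℂ) (Sum.inl (c, none) : RepIndex G)
        (Sum.inl (c, none) : RepIndex G)) (fun s => (D.tau : ℂ) * (D.chi s x : ℂ)⁻¹ *
        (starRingEnd ℂ) ((D.tau : ℂ) * (D.chi s y : ℂ)⁻¹) * (D.chi s c : ℂ)⁻¹) Finset.univ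
      rw [key c] at this
      simp only [Matrix.singleAddMonoidHom_apply] at this
      rw [← this]
      split_ifs <;> simp
    refine (Finset.sum_congr rfl fun c _ => h2 c).trans ?_
    simp

theorem repL_mul (b c : TYAlg D) : repL D (b * c) = repL D b * repL D c := by
  have : (mulₗ D).compr₂ (repL D) =
      (LinearMap.mul ℂ (Matrix (RepIndex G) (RepIndex G) ℂ)).compl₁₂ (repL D) (repL D) := by
    apply hom_ext; intro p p' hp
    apply hom_ext; intro q q' hq
    have := repL_mul_aux (D := D) p p' q q' hp hq
    rw [← f_mul_f p p' q q' hp hq] at this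
    rw [mul_def] at this
    simpa [repL_f hp, repL_f hq] using this
  exact LinearMap.congr_fun (LinearMap.congr_fun this b) c

theorem one_def : (1 : TYAlg D) = ∑ a : Option G, ∑ b : Option G,
  f D (a.elim (gm 0) (gh 0)) (b.elim (gm 0) (gh 0)) := rfl

theorem one_grade (a : Option G) : (a.elim (gm 0) (gh 0)).grade = some (0 : G) := by
  cases a <;> rfl

theorem repL_one : repL D 1 = 1 := by
  rw [one_def]
  simp only [map_sum, repL_f ((one_grade _).trans (one_grade _).symm)]
  simp only [Fintype.sum_option, Option.elim, repFun, sub_zero, chi_zero_left, Circle.coe_one,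
    inv_one]
  rw [← Matrix.sum_single_one]
  simp only [Fintype.sum_sum_type, Fintype.sum_prod_type, Fintype.sum_option,
    Finset.sum_add_distrib]
  have : ∑ h : G, ∑ k : G, Matrix.single (Sum.inl (k - h, some h) : RepIndex G)
      (Sum.inl (k - h, some h) : RepIndex G) (1 : ℂ) =
      ∑ d : G, ∑ h : G, Matrix.single (Sum.inl (d, some h) : RepIndex G)
        (Sum.inl (d, some h) : RepIndex G) 1 := by
    conv_rhs => rw [Finset.sum_comm]
    refine Finset.sum_congr rfl fun h _ => ?_
    exact (Equiv.subRight h).sum_comp (fun d => Matrix.single (Sum.inl (d, some h) : RepIndex G)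
      (Sum.inl (d, some h) : RepIndex G) (1 : ℂ))
  rw [this]
  abel

variable (D) in
def invFun' (M : Matrix (RepIndex G) (RepIndex G) ℂ) : TYVec G → TYVec G → ℂ
  | .gh s h, .gh _ k => M (.inl (k - h, some (h - s))) (.inl (k - h, some h))
  | .gm s, .gm _ => (Fintype.card G : ℂ)⁻¹ * ∑ d, (D.chi s d : ℂ) * M (.inl (d, none)) (.inl (d, none))
  | .mg h, .mg k => M (.inl (k - h, some h)) (.inl (k - h, none))
  | .mbar h, .mbar k => M (.inl (k - h, none)) (.inl (k - h, some h))
  | .gh s h, .gm _ => M (.inr (.inl (h - s))) (.inr (.inl h))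
  | .gm s, .gh _ h => M (.inr (.inr (h - s))) (.inr (.inr h))
  | .mg h, .mbar k => ((D.tau : ℂ) * (D.chi h k : ℂ)⁻¹)⁻¹ * M (.inr (.inl h)) (.inr (.inr k))
  | .mbar h, .mg k => (D.chi h k : ℂ)⁻¹ * M (.inr (.inr k)) (.inr (.inl h))
  | _, _ => 0

theorem coord_f {p q : TYVec G} (h : p.grade = q.grade) :
    coord D (f D p q) = Finsupp.single ⟨(p, q), h⟩ 1 := by
  simp [f, h]

set_option maxHeartbeats 1000000 in
theorem coord_eq (b : TYAlg D) (p q : TYVec G) (h : p.grade = q.grade) :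
    coord D b ⟨(p, q), h⟩ = invFun' D (repL D b) p q := by
  induction b using TYAlg.induction with
  | h0 => cases p <;> cases q <;> simp [invFun']
  | hadd x y hx hy =>
    simp only [map_add, Finsupp.add_apply, hx, hy]
    cases p <;> cases q <;> simp [invFun', mul_add, Finset.sum_add_distrib]
  | hsmul c x hx =>
    simp only [map_smul, Finsupp.smul_apply, hx]
    cases p <;> cases q <;> simp [invFun', Finset.mul_sum] <;> (try refine Finset.sum_congr rfl fun _ _ => ?_) <;> ring
  | hf p' q' h' =>
    rw [coord_f h', repL_f h']
    cases p <;> cases q <;> simp [TYVec.grade] at h <;> cases p' <;> cases q' <;>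
      simp [TYVec.grade] at h' <;> (try subst h) <;> (try subst h') <;>
      simp [invFun', repFun, Matrix.single_apply, Finsupp.single_apply, Matrix.sum_apply] 
    case gh.gh.gh.gh => congr 1; grind
    case gh.gm.gh.gm => congr 1; grind
    case gm.gh.gm.gh => congr 1; grind
    case gm.gm.gm.gm =>
      rename_i s t
      have : ∀ x, (D.chi s x : ℂ) * (D.chi t x : ℂ)⁻¹ = (D.chi (s - t) x : ℂ) := by
        intro x; simp [chi_sub_left]
      simp only [this, sum_chi, sub_eq_zero]
      by_cases hst : t = s
      · simp [hst]
      · simp [hst, Ne.symm hst]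
    case mg.mg.mg.mg => congr 1; grind
    case mg.mbar.mg.mbar =>
      split_ifs with h1
      · obtain ⟨rfl, rfl⟩ := h1
        have := tau_ne D
        have := chi_mul_inv D
        field_simp
      · rfl
    case mbar.mg.mbar.mg =>
      split_ifs with h1 h2 h2
      · obtain ⟨rfl, rfl⟩ := h1
        rw [chi_inv_mul]
      · exact absurd h1.symm h2
      · exact absurd h2.symm h1
      · rfl
    case mbar.mbar.mbar.mbar => congr 1; grind

theorem repL_injective : Function.Injective (repL D) := by
  intro b c hbc
  apply (coord D).injective
  ext ⟨⟨p, q⟩, h⟩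
  rw [coord_eq, coord_eq, hbc]


instance : Ring (TYAlg D) :=
  { (inferInstance : AddCommGroup (TYAlg D)) with
    mul := (· * ·)
    one := 1
    zero_mul := fun a => by simp [mul_def]
    mul_zero := fun a => by simp [mul_def]
    left_distrib := fun a b c => by simp [mul_def]
    right_distrib := fun a b c => by simp [mul_def]
    mul_assoc := fun a b c => repL_injective (by simp only [repL_mul, mul_assoc])
    one_mul := fun a => repL_injective (by simp only [repL_mul, repL_one, one_mul])
    mul_one := fun a => repL_injective (by simp only [repL_mul, repL_one, mul_one]) }

instance : Algebra ℂ (TYAlg D) :=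
  Algebra.ofModule (fun r x y => by simp [mul_def]) (fun r x y => by simp [mul_def])

theorem mul_eq (b c : TYAlg D) : b * c = mulₗ D b c := rfl


variable (D) in
/-- Scalars entering the antipode and the involution: `τ` for `v^m_{k̄}`, and `1` otherwise. -/
def sigma : TYVec G → ℂ
  | .mbar _ => (D.tau : ℂ)
  | _ => 1

theorem tau_ne' (D : TYDatum G) : D.tau ≠ 0 := by
  have := tau_ne D
  exact_mod_cast this

theorem sigma_ne (p : TYVec G) : sigma D p ≠ 0 := by
  cases p <;> simp [sigma, tau_ne']

theorem conj_sigma (p : TYVec G) : (starRingEnd ℂ) (sigma D p) = sigma D p := by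
  cases p <;> simp [sigma]

theorem grade_hat {p q : TYVec G} (h : p.grade = q.grade) : p.hat.grade = q.hat.grade := by
  cases p <;> cases q <;> simp_all [TYVec.grade, TYVec.hat]

theorem hat_hat (p : TYVec G) : p.hat.hat = p := by
  cases p <;> simp [TYVec.hat]

theorem sigma_hat {p q : TYVec G} (h : p.grade = q.grade) :
    sigma D p * sigma D p.hat = sigma D q * sigma D q.hat := by
  cases p <;> cases q <;> simp_all [TYVec.grade, TYVec.hat, sigma]

variable (D) in
/-- The involution, `f_{p,q}* = (σ(q)/σ(p)) f_{p̂,q̂}`. -/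
def starₛₗ : TYAlg D →ₛₗ[starRingEnd ℂ] TYAlg D where
  toFun b := (coord D b).sum fun i a =>
    ((starRingEnd ℂ) a * (sigma D i.1.2 / sigma D i.1.1)) • f D i.1.1.hat i.1.2.hat
  map_add' x y := by
    rw [map_add, Finsupp.sum_add_index'] <;> simp [add_mul, add_smul]
  map_smul' c x := by
    rw [map_smul, Finsupp.sum_smul_index', Finsupp.smul_sum] <;> simp [mul_assoc, smul_smul]

instance : Star (TYAlg D) := ⟨fun b => starₛₗ D b⟩

theorem star_def (b : TYAlg D) : star b = starₛₗ D b := rfl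

theorem star_f {p q : TYVec G} (h : p.grade = q.grade) :
    star (f D p q) = (sigma D q / sigma D p) • f D p.hat q.hat := by
  show starₛₗ D (f D p q) = _
  simp [starₛₗ, coord_f h]

theorem repL_star (b : TYAlg D) : repL D (star b) = star (repL D b) := by
  induction b using TYAlg.induction with
  | h0 => simp [star_def]
  | hadd x y hx hy => simp only [star_def, map_add, star_add] at *; rw [hx, hy]
  | hsmul c x hx =>
    simp only [star_def, map_smul, star_smul, LinearMap.map_smulₛₗ] at *; rw [hx]; rfl
  | hf p q h =>
    rw [star_f h, map_smul, repL_f (grade_hat h), repL_f h, Matrix.star_eq_conjTranspose]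
    cases p <;> cases q <;> simp [TYVec.grade] at h <;> (try subst h) <;>
      simp [TYVec.hat, sigma, repFun, Matrix.conjTranspose_single, Matrix.conjTranspose_sum,
        conj_chi, chi_neg_left, tau_ne']

instance : StarRing (TYAlg D) where
  star_involutive b := repL_injective (by simp only [repL_star, star_star])
  star_mul a b := repL_injective (by simp only [repL_star, repL_mul, star_mul])
  star_add a b := by simp only [star_def, map_add]

instance : StarModule ℂ (TYAlg D) where
  star_smul c a := by simp only [star_def, LinearMap.map_smulₛₗ]; rfl

theorem exists_rep : ∃ (n : ℕ) (ρ : TYAlg D →⋆ₐ[ℂ] Matrix (Fin n) (Fin n) ℂ),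
    Function.Injective ρ := by
  let e := Fintype.equivFin (RepIndex G)
  let E := Matrix.reindexAlgEquiv ℂ ℂ e
  refine ⟨_, { toFun := fun b => E (repL D b)
               map_one' := by rw [repL_one, map_one]
               map_mul' := fun a b => by rw [repL_mul, map_mul]
               map_zero' := by simp
               map_add' := fun a b => by simp
               commutes' := fun r => by
                 rw [Algebra.algebraMap_eq_smul_one, map_smul, repL_one, map_smul, map_one,
                   Algebra.algebraMap_eq_smul_one]
               map_star' := fun b => by
                 rw [repL_star]; ext i j; simp [E, Matrix.star_apply] }, ?_⟩
  intro a b h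
  exact repL_injective (E.injective h)

variable (D) in
/-- The comultiplication `Δ(f_{p,q}) = ∑_r f_{p,r} ⊗ f_{r,q}`, the sum being over the basis vectors
`r` of the same `Hˣ`. -/
def comulFun (p q : TYVec G) : TYAlg D ⊗[ℂ] TYAlg D := ∑ r, f D p r ⊗ₜ[ℂ] f D r q

/-- The counit is `ε(f_{p,q}) = δ_{p,q}`. -/
instance : CoalgebraStruct ℂ (TYAlg D) where
  comul := lift (comulFun D)
  counit := lift fun p q => if p = q then 1 else 0

theorem comul_f (p q : TYVec G) :
    Coalgebra.comul (R := ℂ) (f D p q) = ∑ r, f D p r ⊗ₜ[ℂ] f D r q := by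
  refine lift_f' _ (fun p q h => Finset.sum_eq_zero fun r _ => ?_) p q
  by_cases h1 : p.grade = r.grade
  · rw [f_of_ne (p := r) (q := q) (fun h2 => h (h1.trans h2)), TensorProduct.tmul_zero]
  · rw [f_of_ne h1, TensorProduct.zero_tmul]

theorem counit_f (p q : TYVec G) :
    Coalgebra.counit (R := ℂ) (f D p q) = if p = q then 1 else 0 := by
  refine lift_f' _ (fun p q h => ?_) p q
  rw [if_neg]; rintro rfl; exact h rfl

instance : Coalgebra ℂ (TYAlg D) where
  coassoc := by
    apply hom_ext; intro p q h
    simp only [LinearMap.comp_apply, comul_f, map_sum, LinearMap.rTensor_tmul,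
      LinearMap.lTensor_tmul, TensorProduct.sum_tmul, TensorProduct.tmul_sum,
      LinearEquiv.coe_coe, TensorProduct.assoc_tmul]
    rw [Finset.sum_comm]
  rTensor_counit_comp_comul := by
    apply hom_ext; intro p q h
    simp [LinearMap.comp_apply, comul_f, counit_f, TensorProduct.ite_tmul]
  lTensor_counit_comp_comul := by
    apply hom_ext; intro p q h
    simp [LinearMap.comp_apply, comul_f, counit_f, TensorProduct.tmul_ite]

variable (D) in
/-- The antipode, `S(f_{p,q}) = (σ(p)/σ(q)) f_{q̂,p̂}`. -/
def antipode : TYAlg D →ₗ[ℂ] TYAlg D :=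
  lift fun p q => (sigma D p / sigma D q) • f D q.hat p.hat

theorem antipode_f {p q : TYVec G} (h : p.grade = q.grade) :
    antipode D (f D p q) = (sigma D p / sigma D q) • f D q.hat p.hat := by
  rw [antipode, lift_f, if_pos h]

theorem f_mul_f' (p p' q q' : TYVec G) :
    f D p p' * f D q q' = if p.grade = p'.grade ∧ q.grade = q'.grade then
      outerₗ D (D.comp p q) (D.comp p' q') else 0 := by
  split_ifs with h
  · exact f_mul_f _ _ _ _ h.1 h.2
  · by_cases h1 : p.grade = p'.grade
    · rw [f_of_ne (p := q) (fun h2 => h ⟨h1, h2⟩), mul_zero]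
    · rw [f_of_ne h1, zero_mul]

/-- The object `y` such that the basis vector lies in `Hom(-, y ⊗ x)`. -/
def src : TYVec G → Option G
  | .gh g h => some (h - g)
  | .gm _ => none
  | .mg k => some k
  | .mbar _ => none

/-- The object `z` such that the basis vector lies in `Hom(z, - ⊗ x)`. -/
def tgt : TYVec G → Option G
  | .gh _ h => some h
  | .gm _ => none
  | .mg _ => none
  | .mbar k => some k

theorem tgt_of_comp (p q r : TYVec G) (h : D.comp p q r ≠ 0) : tgt r = tgt q := by
  cases p <;> cases q <;> simp [TYDatum.comp] at h <;> (try split_ifs at h) <;>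
    (try simp [Finsupp.single_apply] at h) <;> cases r <;> simp_all [tgt]

theorem comp_hat (p q r : TYVec G) : (starRingEnd ℂ) (D.comp q.hat p.hat r.hat) = D.comp p q r := by
  cases p <;> cases q <;> cases r <;> simp [TYDatum.comp, TYVec.hat] <;>
    (try split_ifs) <;> simp [Finsupp.single_apply, conj_chi, chi_neg_left]
  all_goals first
    | grind
    | (split_ifs <;> simp_all [conj_chi])

theorem sigma_comp {p q r p' q' r' : TYVec G} (hp : p.grade = p'.grade) (hq : q.grade = q'.grade)
    (h : D.comp p q r ≠ 0) (h' : D.comp p' q' r' ≠ 0) :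
    sigma D p * sigma D q / sigma D r = sigma D p' * sigma D q' / sigma D r' := by
  have key : ∀ p q r, D.comp p q r ≠ 0 → sigma D p * sigma D q / sigma D r =
      if p.grade = none ∧ q.grade = none then (D.tau : ℂ) else 1 := by
    intro p q r h
    have ht := tau_ne D
    cases p <;> cases q <;> simp [TYDatum.comp] at h <;> (try split_ifs at h) <;>
      (try simp [Finsupp.single_apply] at h) <;> cases r <;>
      simp_all [sigma, TYVec.grade]
  rw [key _ _ _ h, key _ _ _ h', hp, hq]

theorem counit_outer (v w : TYVec G →₀ ℂ) : Coalgebra.counit (R := ℂ) (outerₗ D v w) =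
    ∑ r, v r * (starRingEnd ℂ) (w r) := by
  rw [outer_sum]
  simp [counit_f]

variable (D) in
/-- The coefficients of the product `∘`. -/
def cc : TYVec G → TYVec G → TYVec G → ℂ
  | .gh g k, .gh h x, .gh a b => if x = h + k then (if a = g + h then (if b = x then 1 else 0) else 0) else 0
  | .gm g, .gm h, .gm a => if a = g + h then 1 else 0
  | .mg k, .gm g, .mg a => if a = k then (D.chi g k : ℂ) else 0
  | .mbar k, .gh g x, .mbar a => if x = g + k then (if a = x then 1 else 0) else 0
  | .gm g, .mbar k, .mbar a => if a = k then (D.chi g k : ℂ) else 0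
  | .gh g x, .mg k, .mg a => if x = k then (if a = k - g then 1 else 0) else 0
  | .mg h, .mbar k, .gh a b => if a = k - h then (if b = k then 1 else 0) else 0
  | .mbar h, .mg k, .gm g => if h = k then (D.tau : ℂ) * (D.chi g h : ℂ)⁻¹ else 0
  | _, _, _ => 0

theorem comp_apply (p q r : TYVec G) : D.comp p q r = cc D p q r := by
  cases p <;> cases q <;> cases r <;> simp only [TYDatum.comp, cc] <;> (try split_ifs) <;>
    simp [Finsupp.single_apply] <;> grind

set_option maxHeartbeats 1000000 in
theorem comp_inner (p p' q q' : TYVec G) (hp : p.grade = p'.grade) (hq : q.grade = q'.grade) :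
    ∑ r, D.comp p q r * (starRingEnd ℂ) (D.comp p' q' r) =
      if p = p' ∧ q = q' ∧ tgt p = src q then 1 else 0 := by
  simp only [comp_apply]
  cases p <;> cases p' <;> simp [TYVec.grade] at hp <;> cases q <;> cases q' <;>
    simp [TYVec.grade] at hq <;> (try subst hp) <;> (try subst hq) <;>
    simp [sum_eq, cc, src, tgt, conj_chi, chi_mul_inv]
  case mbar.mbar.mg.mg =>
    rename_i a b c d
    by_cases h1 : a = c
    swap
    · simp [h1]
    by_cases h2 : b = d
    swap
    · subst h1; simp only [if_true, if_neg h2, map_zero, mul_zero, Finset.sum_const_zero]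
      rw [if_neg (fun h => h2 (h.1.symm.trans h.2.1))]
    subst h1 h2
    have : ∀ s, (D.tau : ℂ) * (D.chi s a : ℂ)⁻¹ *
        (starRingEnd ℂ) ((D.tau : ℂ) * (D.chi s b : ℂ)⁻¹) =
          (D.tau : ℂ) * D.tau * (D.chi (b - a) s : ℂ) := by
      intro s
      rw [D.chi_symm (b - a) s]
      simp only [map_mul, map_inv₀, conj_chi, chi_sub_right, Circle.coe_mul, Circle.coe_inv,
        inv_inv, Complex.conj_ofReal]
      ring
    simp only [if_true, this, ← Finset.mul_sum, sum_chi, sub_eq_zero]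
    by_cases h : a = b
    · simp [h, tau_sq]
    · simp [h, Ne.symm h]
  all_goals
    simp only [apply_ite (starRingEnd ℂ), map_one, map_zero, conj_chi, mul_ite, chi_mul_inv,
      mul_zero]
    try split_ifs
  all_goals first
    | grind
    | simp_all [chi_mul_inv]

theorem counit_mul_f (p p' q q' : TYVec G) :
    Coalgebra.counit (R := ℂ) (f D p p' * f D q q') =
      if p = p' ∧ q = q' ∧ tgt p = src q then 1 else 0 := by
  rw [f_mul_f']
  split_ifs with h h1 h1
  · rw [counit_outer, comp_inner _ _ _ _ h.1 h.2, if_pos h1]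
  · rw [counit_outer, comp_inner _ _ _ _ h.1 h.2, if_neg h1]
  · obtain ⟨rfl, rfl, h2⟩ := h1
    simp at h
  · simp

/-- Whether the simple object `z` occurs in `x ⊗ y`. -/
def adm : Option G → Option G → Option G → Prop
  | some g, some h, some k => k = g + h
  | some _, none, none => True
  | none, some _, none => True
  | none, none, some _ => True
  | _, _, _ => False

instance (x y z : Option G) : Decidable (adm x y z) := by
  unfold adm; split <;> infer_instance

theorem adm_of_comp (p q r : TYVec G) (h : D.comp p q r ≠ 0) :
    adm p.grade q.grade r.grade := by
  cases p <;> cases q <;> simp [TYDatum.comp] at h <;> (try split_ifs at h) <;>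
    (try simp [Finsupp.single_apply] at h) <;> cases r <;> simp_all [adm, TYVec.grade]



theorem sum_grade_some {M : Type v} [AddCommMonoid M] (g : G) (F : TYVec G → M) :
    ∑ u, (if some g = u.grade then F u else 0) = (∑ h, F (gh g h)) + F (gm g) := by
  simp [sum_eq, TYVec.grade, Finset.sum_ite_irrel]

theorem sum_grade_none {M : Type v} [AddCommMonoid M] (F : TYVec G → M) :
    ∑ u, (if none = u.grade then F u else 0) = (∑ k, F (mg k)) + ∑ k, F (mbar k) := by
  simp [sum_eq, TYVec.grade]

theorem coiso (x y : Option G) (t t' : TYVec G) :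
    ∑ u : TYVec G, ∑ w : TYVec G, (if x = u.grade ∧ y = w.grade then
      (starRingEnd ℂ) (D.comp u w t) * D.comp u w t' else 0) =
      if t = t' ∧ adm x y t.grade then 1 else 0 := by
  simp only [comp_apply, ite_and, Finset.sum_ite_irrel, Finset.sum_const_zero]
  cases x <;> cases y <;> simp only [sum_grade_some, sum_grade_none] <;> cases t <;> cases t' <;>
    simp only [cc, TYVec.grade, adm] <;> simp [conj_chi, chi_inv_mul]
  case none.none.gh.gh =>
    rename_i a b c d
    have e : ∀ g x y : G, (g = y - x) = (x = y - g) := by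
      intro g x y; apply propext; constructor <;> intro h <;> grind
    rw [Finset.sum_comm]
    simp only [e, Finset.sum_ite_eq', Finset.mem_univ, if_true, Finset.sum_ite_eq, sub_sub_cancel]
    simp only [apply_ite (starRingEnd ℂ), map_one, map_zero]
    split_ifs <;> grind
  case none.none.gm.gm =>
    rename_i a b
    have : ∀ s, (D.tau : ℂ) * (D.chi a s : ℂ) * ((D.tau : ℂ) * (D.chi b s : ℂ)⁻¹) =
          (D.tau : ℂ) * D.tau * (D.chi (a - b) s : ℂ) := by
      intro s
      simp only [chi_sub_left, Circle.coe_mul, Circle.coe_inv]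
      ring
    simp only [this, ← Finset.mul_sum, sum_chi, sub_eq_zero]
    by_cases h : a = b
    · simp [h, tau_sq]
    · simp [h]
  case none.some.mg.mg => split_ifs with h <;> simp [h, conj_chi, chi_inv_mul]
  case some.none.mbar.mbar => split_ifs with h <;> simp [h, conj_chi, chi_inv_mul]
  case none.some.mbar.mbar =>
    have e : ∀ g x y : G, (g = y + x) = (x = g - y) := by
      intro g x y; apply propext; constructor <;> intro h <;> grind
    simp only [e, Finset.sum_ite_eq', Finset.mem_univ, if_true, Finset.sum_ite_eq]
    split_ifs <;> grind
  case some.none.mg.mg =>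
    have e : ∀ g x y : G, (g = x - y) = (x = g + y) := by
      intro g x y; apply propext; constructor <;> intro h <;> grind
    simp only [e, Finset.sum_ite_eq', Finset.mem_univ, if_true, Finset.sum_ite_eq]
    split_ifs <;> grind
  case some.some.gh.gh =>
    have e : ∀ g x y : G, (g = y + x) = (x = g - y) := by
      intro g x y; apply propext; constructor <;> intro h <;> grind
    simp only [apply_ite (starRingEnd ℂ), map_one, map_zero]
    simp only [e _ _ (_ : G), Finset.sum_ite_eq', Finset.mem_univ, if_true, Finset.sum_ite_eq]
    split_ifs <;> grind
  case some.some.gm.gm => split_ifs <;> grind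


theorem comul_outer (v w : TYVec G →₀ ℂ) : Coalgebra.comul (R := ℂ) (outerₗ D v w) =
    ∑ r, ∑ s, ∑ t, (v r * (starRingEnd ℂ) (w s)) • (f D r t ⊗ₜ[ℂ] f D t s) := by
  rw [outer_sum]
  simp only [map_sum, map_smul, comul_f, Finset.smul_sum]

theorem comul_mul_f (p p' q q' : TYVec G) (hp : p.grade = p'.grade) (hq : q.grade = q'.grade) :
    Coalgebra.comul (R := ℂ) (f D p p' * f D q q') =
      Coalgebra.comul (R := ℂ) (f D p p') * Coalgebra.comul (R := ℂ) (f D q q') := by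
  rw [f_mul_f _ _ _ _ hp hq, comul_outer]
  simp only [comul_f, Finset.sum_mul_sum, Algebra.TensorProduct.tmul_mul_tmul, f_mul_f']
  have h1 : ∀ u w : TYVec G,
      (if p.grade = u.grade ∧ q.grade = w.grade then outerₗ D (D.comp p q) (D.comp u w) else 0) ⊗ₜ[ℂ]
      (if u.grade = p'.grade ∧ w.grade = q'.grade then outerₗ D (D.comp u w) (D.comp p' q') else 0)
      = ∑ r, ∑ s, ∑ t, ∑ t', (D.comp p q r * (starRingEnd ℂ) (D.comp p' q' s) *
          (if p.grade = u.grade ∧ q.grade = w.grade then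
          (starRingEnd ℂ) (D.comp u w t) * D.comp u w t' else 0)) • (f D r t ⊗ₜ[ℂ] f D t' s) := by
    intro u w
    by_cases h : p.grade = u.grade ∧ q.grade = w.grade
    · have h' : u.grade = p'.grade ∧ w.grade = q'.grade := ⟨h.1.symm.trans hp, h.2.symm.trans hq⟩
      simp only [if_pos h, if_pos h', outer_sum, TensorProduct.sum_tmul]
      simp only [TensorProduct.tmul_sum, TensorProduct.smul_tmul_smul]
      refine Finset.sum_congr rfl fun r _ => ?_
      conv_rhs => rw [Finset.sum_comm]
      refine Finset.sum_congr rfl fun t _ => ?_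
      conv_rhs => rw [Finset.sum_comm]
      refine Finset.sum_congr rfl fun t' _ => ?_
      refine Finset.sum_congr rfl fun s _ => ?_
      congr 1
      ring
    · simp [h]
  simp only [h1]
  have h2 : ∀ r s t t' : TYVec G, ∑ u : TYVec G, ∑ w : TYVec G,
      (D.comp p q r * (starRingEnd ℂ) (D.comp p' q' s) *
          (if p.grade = u.grade ∧ q.grade = w.grade then
          (starRingEnd ℂ) (D.comp u w t) * D.comp u w t' else 0)) • (f D r t ⊗ₜ[ℂ] f D t' s) =
      if t = t' then (D.comp p q r * (starRingEnd ℂ) (D.comp p' q' s)) • (f D r t ⊗ₜ[ℂ] f D t' s)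
        else 0 := by
    intro r s t t'
    simp only [← Finset.sum_smul, ← Finset.mul_sum, coiso]
    by_cases h3 : r.grade = t.grade
    swap
    · simp [f_of_ne h3]
    by_cases h4 : D.comp p q r = 0
    · simp [h4]
    have := adm_of_comp p q r h4
    rw [h3] at this
    by_cases h5 : t = t' <;> simp [h5, this]
    subst h5
    simp [this]
  have h3 : ∀ F : TYVec G → TYVec G → TYVec G → TYVec G → TYVec G → TYVec G → TYAlg D ⊗[ℂ] TYAlg D,
      ∑ u, ∑ w, ∑ r, ∑ s, ∑ t, ∑ t', F u w r s t t' = ∑ r, ∑ s, ∑ t, ∑ t', ∑ u, ∑ w, F u w r s t t' := by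
    intro F
    simp only [← Fintype.sum_prod_type']
    refine Fintype.sum_equiv ⟨fun x => (x.2.2.1, x.2.2.2.1, x.2.2.2.2.1, x.2.2.2.2.2, x.1, x.2.1),
      fun x => (x.2.2.2.2.1, x.2.2.2.2.2, x.1, x.2.1, x.2.2.1, x.2.2.2.1), fun _ => rfl, fun _ => rfl⟩ _ _ ?_
    intro x; rfl
  rw [h3]
  simp only [h2, Finset.sum_ite_eq, Finset.mem_univ, if_true]

theorem comul_mul (b c : TYAlg D) : Coalgebra.comul (R := ℂ) (b * c) =
    Coalgebra.comul (R := ℂ) b * Coalgebra.comul (R := ℂ) c := by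
  have : (mulₗ D).compr₂ (Coalgebra.comul (R := ℂ)) =
      (LinearMap.mul ℂ (TYAlg D ⊗[ℂ] TYAlg D)).compl₁₂ (Coalgebra.comul (R := ℂ))
        (Coalgebra.comul (R := ℂ)) := by
    apply hom_ext; intro p p' hp
    apply hom_ext; intro q q' hq
    have := comul_mul_f (D := D) p p' q q' hp hq
    rw [mul_def] at this
    simpa using this
  exact LinearMap.congr_fun (LinearMap.congr_fun this b) c

def hatEquiv : TYVec G ≃ TYVec G := ⟨hat, hat, hat_hat, hat_hat⟩

theorem grade_hat_iff {p q : TYVec G} : p.hat.grade = q.hat.grade ↔ p.grade = q.grade :=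
  ⟨fun h => by simpa [hat_hat] using grade_hat h, grade_hat⟩

theorem star_f' (p q : TYVec G) :
    star (f D p q) = (sigma D q / sigma D p) • f D p.hat q.hat := by
  by_cases h : p.grade = q.grade
  · exact star_f h
  · rw [f_of_ne h, f_of_ne (mt grade_hat_iff.1 h)]; simp

theorem antipode_f' (p q : TYVec G) :
    antipode D (f D p q) = (sigma D p / sigma D q) • f D q.hat p.hat := by
  by_cases h : p.grade = q.grade
  · exact antipode_f h
  · rw [f_of_ne h, f_of_ne (fun h' => h (grade_hat_iff.1 h').symm)]; simp

theorem comul_star (b : TYAlg D) : Coalgebra.comul (R := ℂ) (star b) =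
    star (Coalgebra.comul (R := ℂ) b) := by
  induction b using TYAlg.induction with
  | h0 => simp
  | hadd x y hx hy => simp only [star_add, map_add, hx, hy]
  | hsmul c x hx => simp only [star_smul, map_smul, hx]
  | hf p q h =>
    rw [star_f', map_smul, comul_f, comul_f, star_sum, Finset.smul_sum]
    rw [← hatEquiv.sum_comp]
    refine Finset.sum_congr rfl fun t _ => ?_
    simp only [TensorProduct.star_tmul, star_f', TensorProduct.smul_tmul_smul]
    congr 1
    have := sigma_ne (D := D) t
    field_simp

theorem comul_antipode (b : TYAlg D) : Coalgebra.comul (R := ℂ) (antipode D b) =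
    TensorProduct.map (antipode D) (antipode D)
      (TensorProduct.comm ℂ _ _ (Coalgebra.comul (R := ℂ) b)) := by
  revert b
  refine LinearMap.congr_fun (f := Coalgebra.comul (R := ℂ) ∘ₗ antipode D)
    (g := TensorProduct.map (antipode D) (antipode D) ∘ₗ
      (TensorProduct.comm ℂ (TYAlg D) (TYAlg D)).toLinearMap ∘ₗ Coalgebra.comul (R := ℂ)) (hom_ext ?_)
  intro p q h
  simp only [LinearMap.comp_apply, antipode_f', map_smul, comul_f, map_sum, Finset.smul_sum,
    LinearEquiv.coe_coe, TensorProduct.comm_tmul, TensorProduct.map_tmul]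
  rw [← hatEquiv.sum_comp]
  refine Finset.sum_congr rfl fun t _ => ?_
  simp only [TensorProduct.smul_tmul_smul]
  congr 1
  have := sigma_ne (D := D) t
  field_simp

theorem counit_antipode (b : TYAlg D) : Coalgebra.counit (R := ℂ) (antipode D b) =
    Coalgebra.counit (R := ℂ) b := by
  revert b
  refine LinearMap.congr_fun (f := Coalgebra.counit (R := ℂ) ∘ₗ antipode D)
    (g := Coalgebra.counit (R := ℂ)) (hom_ext ?_)
  intro p q h
  simp only [LinearMap.comp_apply, antipode_f', map_smul, counit_f]
  by_cases h : p = q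
  · subst h; simp [sigma_ne]
  · have h2 : ¬ q.hat = p.hat := fun h' => h (hatEquiv.injective h').symm
    simp [h, h2]

theorem sum_hat {M : Type v} [AddCommMonoid M] (F : TYVec G → TYVec G → M) :
    ∑ a, ∑ b, F a b = ∑ r : TYVec G, ∑ s : TYVec G, F s.hat r.hat := by
  rw [Finset.sum_comm, ← hatEquiv.sum_comp (fun b => ∑ a, F a b)]
  refine Finset.sum_congr rfl fun r _ => ?_
  exact (hatEquiv.sum_comp (fun a => F a (hatEquiv r))).symm

theorem antipode_mul_f (p p' q q' : TYVec G) (hp : p.grade = p'.grade) (hq : q.grade = q'.grade) :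
    antipode D (f D p p' * f D q q') = antipode D (f D q q') * antipode D (f D p p') := by
  rw [f_mul_f _ _ _ _ hp hq, antipode_f', antipode_f', smul_mul_smul_comm,
    f_mul_f _ _ _ _ (grade_hat hq).symm (grade_hat hp).symm, outer_sum, outer_sum,
    sum_hat (fun a b => ((D.comp q'.hat p'.hat a) * (starRingEnd ℂ) (D.comp q.hat p.hat b)) •
      f D a b)]
  simp only [map_sum, map_smul, antipode_f', Finset.smul_sum, smul_smul]
  refine Finset.sum_congr rfl fun r _ => ?_
  refine Finset.sum_congr rfl fun s _ => ?_
  rw [comp_hat p q r, ← comp_hat p' q' s, Complex.conj_conj]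
  by_cases h1 : D.comp p q r = 0
  · simp [h1]
  by_cases h2 : D.comp p' q' s = 0
  · rw [← comp_hat p' q' s] at h2
    simp only [map_eq_zero] at h2
    simp [h2]
  have := sigma_comp hp hq h1 h2
  congr 1
  have h3 := sigma_ne (D := D) r
  have h4 := sigma_ne (D := D) s
  have h5 := sigma_ne (D := D) p'
  have h6 := sigma_ne (D := D) q'
  field_simp at this ⊢
  linear_combination (-(D.comp q'.hat p'.hat s.hat)) * this

theorem antipode_mul (b c : TYAlg D) : antipode D (b * c) = antipode D c * antipode D b := by
  have : (mulₗ D).compr₂ (antipode D) =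
      (LinearMap.mul ℂ (TYAlg D)).flip.compl₁₂ (antipode D) (antipode D) := by
    apply hom_ext; intro p p' hp
    apply hom_ext; intro q q' hq
    have := antipode_mul_f (D := D) p p' q q' hp hq
    rw [mul_def] at this
    simpa using this
  exact LinearMap.congr_fun (LinearMap.congr_fun this b) c

theorem counit_mul_mul (b c d : TYAlg D) :
    LinearMap.mul' ℂ ℂ (TensorProduct.map
        (Coalgebra.counit (R := ℂ) (A := TYAlg D) ∘ₗ LinearMap.mulLeft ℂ b)
        (Coalgebra.counit (R := ℂ) (A := TYAlg D) ∘ₗ LinearMap.mulRight ℂ d)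
        (Coalgebra.comul (R := ℂ) c))
      = Coalgebra.counit (R := ℂ) (b * c * d) := by
  set ψ : TYAlg D →ₗ[ℂ] TYAlg D →ₗ[ℂ] ℂ := (mulₗ D).compr₂ (Coalgebra.counit (R := ℂ)) with hψ
  have hψ' : ∀ x y, ψ x y = Coalgebra.counit (R := ℂ) (x * y) := fun x y => rfl
  change LinearMap.mul' ℂ ℂ (TensorProduct.map (ψ b) (ψ.flip d) (Coalgebra.comul (R := ℂ) c)) = _
  induction b using TYAlg.induction with
  | h0 => simp
  | hadd x y hx hy =>
    simp only [add_mul, map_add, ← hx, ← hy, TensorProduct.map_add_left, LinearMap.add_apply]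
  | hsmul r x hx =>
    simp only [smul_mul_assoc, map_smul, ← hx, TensorProduct.map_smul_left, LinearMap.smul_apply]
  | hf p p' hp =>
    induction d using TYAlg.induction with
    | h0 => simp
    | hadd x y hx hy =>
      simp only [mul_add, map_add, ← hx, ← hy, TensorProduct.map_add_right, LinearMap.add_apply]
    | hsmul r x hx =>
      simp only [mul_smul_comm, map_smul, ← hx, TensorProduct.map_smul_right, LinearMap.smul_apply]
    | hf s s' hs =>
      induction c using TYAlg.induction with
      | h0 => simp
      | hadd x y hx hy => simp only [mul_add, add_mul, map_add, ← hx, ← hy]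
      | hsmul r x hx => simp only [mul_smul_comm, smul_mul_assoc, map_smul, ← hx]
      | hf q q' hq =>
        simp only [comul_f, map_sum, TensorProduct.map_tmul, LinearMap.mul'_apply,
          LinearMap.flip_apply, hψ', counit_mul_f]
        rw [f_mul_f _ _ _ _ hp hq, outer_sum]
        simp only [Finset.sum_mul, smul_mul_assoc, map_sum, map_smul, counit_mul_f]
        have h1 : ∀ r r', (D.comp p q r * (starRingEnd ℂ) (D.comp p' q' r')) •
            (if r = r' ∧ s = s' ∧ tgt r = src s then (1 : ℂ) else 0) =
            if r = r' then ((if s = s' ∧ tgt q = src s then (1 : ℂ) else 0) *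
              (D.comp p q r * (starRingEnd ℂ) (D.comp p' q' r'))) else 0 := by
          intro r r'
          by_cases h0 : D.comp p q r = 0
          · simp [h0]
          rw [tgt_of_comp _ _ _ h0]
          by_cases h2 : r = r' <;> simp [h2]
        simp only [h1, Finset.sum_ite_eq, Finset.mem_univ, if_true, ← Finset.mul_sum]
        rw [comp_inner _ _ _ _ hp hq]
        by_cases ha : p = p' <;> by_cases hb : s = s' <;> simp [ha, hb]
        by_cases hc : q = q'
        · subst hc
          rw [Finset.sum_eq_single q] <;> simp +contextual [eq_comm]
          split_ifs <;> rfl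
        · rw [Finset.sum_eq_zero]
          · simp [hc]
          · intro x _
            split_ifs with h3 h4 <;> simp_all


/-- The basis vectors `v^0_a`, `a ∈ Ω`. -/
def unitVec (a : Option G) : TYVec G := a.elim (gm 0) (gh 0)

theorem unitVec_injective : Function.Injective (unitVec (G := G)) := by
  intro a b h
  cases a <;> cases b <;> simp_all [unitVec]

theorem grade_unitVec (a : Option G) : (unitVec a).grade = some (0 : G) := one_grade a

theorem tgt_unitVec (a : Option G) : tgt (unitVec a) = a := by cases a <;> rfl
theorem src_unitVec (a : Option G) : src (unitVec a) = a := by cases a <;> simp [src, unitVec]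
theorem hat_unitVec (a : Option G) : (unitVec a).hat = unitVec a := by
  cases a <;> simp [hat, unitVec]
theorem sigma_unitVec (a : Option G) : sigma D (unitVec a) = 1 := by
  cases a <;> simp [sigma, unitVec]

theorem one_eq : (1 : TYAlg D) = ∑ a, ∑ b, f D (unitVec a) (unitVec b) := rfl

theorem exists_unitVec {p : TYVec G} (h : p.grade = some (0 : G)) : ∃ a, p = unitVec a := by
  cases p with
  | gh g k => simp [TYVec.grade] at h; subst h; exact ⟨some k, rfl⟩
  | gm g => simp [TYVec.grade] at h; subst h; exact ⟨none, rfl⟩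
  | mg k => simp [TYVec.grade] at h
  | mbar k => simp [TYVec.grade] at h

theorem sum_unitVec {M : Type v} [AddCommMonoid M] (F : TYVec G → M)
    (hF : ∀ p, p.grade ≠ some 0 → F p = 0) : ∑ p, F p = ∑ a, F (unitVec a) := by
  classical
  rw [← Finset.sum_image (g := unitVec) (f := F) (s := Finset.univ) (fun _ _ _ _ h => unitVec_injective h)]
  symm
  apply Finset.sum_subset (Finset.subset_univ _)
  intro p _ hp
  apply hF
  intro h
  obtain ⟨a, rfl⟩ := exists_unitVec h
  exact hp (by simp)

theorem comul_one_eq : Coalgebra.comul (R := ℂ) (1 : TYAlg D) =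
    ∑ a, ∑ b, ∑ c, f D (unitVec a) (unitVec c) ⊗ₜ[ℂ] f D (unitVec c) (unitVec b) := by
  rw [one_eq]
  simp only [map_sum, comul_f]
  refine Finset.sum_congr rfl fun a _ => Finset.sum_congr rfl fun b _ => ?_
  apply sum_unitVec
  intro p hp
  rw [f_of_ne (p := unitVec a) (q := p) (by rw [grade_unitVec]; exact hp.symm), TensorProduct.zero_tmul]

theorem comp_unitVec (a b : Option G) : D.comp (unitVec a) (unitVec b) =
    if a = b then Finsupp.single (unitVec a) 1 else 0 := by
  cases a <;> cases b <;> simp [unitVec, TYDatum.comp, eq_comm]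

theorem unit_mul_unit (a b c d : Option G) :
    f D (unitVec a) (unitVec b) * f D (unitVec c) (unitVec d) =
      if a = c ∧ b = d then f D (unitVec a) (unitVec b) else 0 := by
  rw [f_mul_f _ _ _ _ ((grade_unitVec _).trans (grade_unitVec _).symm)
    ((grade_unitVec _).trans (grade_unitVec _).symm), comp_unitVec, comp_unitVec]
  by_cases h1 : a = c <;> by_cases h2 : b = d <;> simp [h1, h2, outer_single]

theorem gen_comul_one {A ι : Type u} [Ring A] [Algebra ℂ A] [Fintype ι] [DecidableEq ι] (E : ι → ι → A)
    (hE : ∀ a b c d, E a b * E c d = if a = c ∧ b = d then E a b else 0) :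
    ((∑ a, ∑ b, ∑ c, E a c ⊗ₜ[ℂ] E c b) ⊗ₜ[ℂ] (1 : A)) *
      (TensorProduct.assoc ℂ A A A).symm ((1 : A) ⊗ₜ[ℂ] ∑ a, ∑ b, ∑ c, E a c ⊗ₜ[ℂ] E c b) =
      ∑ a, ∑ b, ∑ c, ∑ d, (E a d ⊗ₜ[ℂ] E d c) ⊗ₜ[ℂ] E c b := by
  have hm : ∀ x y : (A ⊗[ℂ] A) ⊗[ℂ] A, x * y = LinearMap.mul ℂ ((A ⊗[ℂ] A) ⊗[ℂ] A) x y :=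
    fun x y => rfl
  simp only [TensorProduct.sum_tmul, TensorProduct.tmul_sum, map_sum, TensorProduct.assoc_symm_tmul,
    hm, LinearMap.sum_apply]
  simp only [LinearMap.mul_apply', Algebra.TensorProduct.tmul_mul_tmul, one_mul, mul_one, hE,
    TensorProduct.ite_tmul, TensorProduct.tmul_ite, TensorProduct.tmul_zero,
    TensorProduct.zero_tmul, ite_and, Finset.sum_ite_irrel, Finset.sum_const_zero,
    Finset.sum_ite_eq, Finset.sum_ite_eq', Finset.mem_univ, if_true]
  have e1 : ∀ F : ι → ι → ι → ι → (A ⊗[ℂ] A) ⊗[ℂ] A,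
      ∑ d, ∑ b, ∑ c, ∑ a, F a b c d = ∑ a, ∑ b, ∑ c, ∑ d, F a b c d := by
    intro F
    trans ∑ a, ∑ d, ∑ b, ∑ c, F a b c d
    · rw [Finset.sum_comm (γ := ι) (f := fun a d => ∑ b, ∑ c, F a b c d)]
      refine Finset.sum_congr rfl fun d _ => ?_
      rw [Finset.sum_comm (f := fun a b => ∑ c, F a b c d)]
      exact Finset.sum_congr rfl fun b _ => Finset.sum_comm
    · refine Finset.sum_congr rfl fun a _ => ?_
      rw [Finset.sum_comm]
      exact Finset.sum_congr rfl fun b _ => Finset.sum_comm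
  exact e1 fun a b c d => (E a d ⊗ₜ[ℂ] E d c) ⊗ₜ[ℂ] E c b

theorem comul_one' : (Coalgebra.comul (R := ℂ) (1 : TYAlg D) ⊗ₜ[ℂ] (1 : TYAlg D)) *
      (TensorProduct.assoc ℂ _ _ _).symm ((1 : TYAlg D) ⊗ₜ[ℂ] Coalgebra.comul (R := ℂ) (1 : TYAlg D))
      = LinearMap.rTensor (TYAlg D) (Coalgebra.comul (R := ℂ) (A := TYAlg D))
        (Coalgebra.comul (R := ℂ) (1 : TYAlg D)) := by
  have h : ∀ a b : Option G, Coalgebra.comul (R := ℂ) (f D (unitVec a) (unitVec b)) =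
      ∑ c, f D (unitVec a) (unitVec c) ⊗ₜ[ℂ] f D (unitVec c) (unitVec b) := by
    intro a b
    rw [comul_f]
    apply sum_unitVec
    intro p hp
    rw [f_of_ne (p := unitVec a) (q := p) (by rw [grade_unitVec]; exact hp.symm),
      TensorProduct.zero_tmul]
  rw [comul_one_eq]
  refine (gen_comul_one (fun a b => f D (unitVec a) (unitVec b)) unit_mul_unit).trans ?_
  simp only [map_sum, LinearMap.rTensor_tmul, h, TensorProduct.sum_tmul]

theorem targetCounit_f {p q : TYVec G} : targetCounit (f D p q) =
    if p = q then ∑ b, f D (unitVec (src p)) (unitVec b) else 0 := by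
  unfold targetCounit
  rw [comul_one_eq]
  simp only [Finset.sum_mul, Algebra.TensorProduct.tmul_mul_tmul, map_sum, LinearMap.rTensor_tmul,
    counit_mul_f, mul_one, TensorProduct.lid_tmul, unitVec_injective.eq_iff, tgt_unitVec]
  by_cases h : p = q
  · subst h
    simp only [ite_smul, ite_and, one_smul, zero_smul, if_true, Finset.sum_ite_irrel, Finset.sum_const_zero,
      Finset.sum_ite_eq, Finset.sum_ite_eq', Finset.mem_univ]
  · simp [h]

theorem sourceCounit_f {p q : TYVec G} : sourceCounit (f D p q) =
    if p = q then ∑ a, f D (unitVec a) (unitVec (tgt p)) else 0 := by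
  unfold sourceCounit
  rw [comul_one_eq]
  simp only [Finset.mul_sum, Algebra.TensorProduct.tmul_mul_tmul, map_sum, LinearMap.lTensor_tmul,
    counit_mul_f, one_mul, TensorProduct.rid_tmul, unitVec_injective.eq_iff, src_unitVec]
  by_cases h : p = q
  · subst h
    simp only [ite_smul, ite_and, one_smul, zero_smul, if_true, Finset.sum_ite_irrel, Finset.sum_const_zero,
      Finset.sum_ite_eq, Finset.sum_ite_eq', Finset.mem_univ]
  · simp [h]

variable (G) in
/-- The vector `∑_{a ∈ Ω} v^0_a`. -/
def unitSum : TYVec G →₀ ℂ := ∑ b : Option G, Finsupp.single (unitVec b) 1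

theorem comp_mbar_mg (x : G) : D.comp (mbar x) (mg x) =
    ∑ s : G, Finsupp.single (gm s) ((D.tau : ℂ) * (D.chi s x : ℂ)⁻¹) := by
  simp only [TYDatum.comp, if_true]

theorem sum_comp_mbar_mg : ∑ x : G, D.comp (mbar x) (mg x) =
    Finsupp.single (gm 0) ((D.tau : ℂ)⁻¹) := by
  have ht := tau_ne D
  simp only [comp_mbar_mg]
  rw [Finset.sum_comm]
  simp only [← Finsupp.single_finsetSum, ← Finset.mul_sum, sum_chi_inv]
  rw [Finset.sum_eq_single 0]
  · rw [if_pos rfl]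
    congr 1
    have := tau_sq D
    field_simp
    linear_combination this
  · intro s _ hs
    rw [if_neg hs, mul_zero, Finsupp.single_zero]
  · simp

theorem sum_sigma_comp (x : Option G) :
    ∑ t : TYVec G, (if x = t.grade then sigma D t • D.comp t t.hat else 0) = unitSum G := by
  cases x with
  | some g =>
    rw [sum_grade_some]
    have : ∀ h : G, sigma D (gh g h) • D.comp (gh g h) (gh g h).hat =
        Finsupp.single (gh 0 (Equiv.subRight g h)) 1 := by
      intro h
      simp [sigma, hat, TYDatum.comp, sub_eq_neg_add]
    rw [Finset.sum_congr rfl fun h _ => this h,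
      (Equiv.subRight g).sum_comp (fun h => Finsupp.single (gh 0 h) (1 : ℂ))]
    simp [sigma, hat, TYDatum.comp, unitSum, Fintype.sum_option, unitVec, add_comm]
  | none =>
    rw [sum_grade_none]
    simp only [sigma, hat, unitSum, Fintype.sum_option, unitVec, ← Finset.smul_sum, sum_comp_mbar_mg]
    simp [TYDatum.comp, tau_ne', add_comm]

variable (D) in
/-- A normalisation scalar: `1` on `G` and `τ⁻¹` on `m`. -/
def kap : Option G → ℂ
  | some _ => 1
  | none => (D.tau : ℂ)⁻¹

theorem sum_sigma_inv_comp (x : Option G) :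
    ∑ t : TYVec G, (if x = t.grade then (sigma D t)⁻¹ • D.comp t.hat t else 0) =
      kap D x • unitSum G := by
  cases x with
  | some g =>
    rw [sum_grade_some]
    simp [sigma, hat, TYDatum.comp, unitSum, Fintype.sum_option, unitVec, kap, add_comm]
  | none =>
    rw [sum_grade_none]
    simp only [sigma, hat, unitSum, Fintype.sum_option, unitVec, ← Finset.smul_sum, sum_comp_mbar_mg]
    simp [TYDatum.comp, kap, Finset.smul_sum]

theorem outer_unitSum_right' (v : TYVec G →₀ ℂ) : outerₗ D v (unitSum G) =
    ∑ a, v (unitVec a) • outerₗ D (Finsupp.single (unitVec a) 1) (unitSum G) := by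
  have h1 : ∀ a, v (unitVec a) • outerₗ D (Finsupp.single (unitVec a) 1) (unitSum G) =
      (fun p => outerₗ D (Finsupp.single p (v p)) (unitSum G)) (unitVec a) := by
    intro a
    show _ = outerₗ D (Finsupp.single _ _) _
    rw [← LinearMap.smul_apply, ← map_smul, Finsupp.smul_single, smul_eq_mul, mul_one]
  simp only [h1]
  rw [← sum_unitVec (fun p => outerₗ D (Finsupp.single p (v p)) (unitSum G))]
  · rw [← LinearMap.sum_apply, ← map_sum, Finsupp.univ_sum_single]
  · intro p hp
    simp only [unitSum, map_sum, outer_single]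
    refine Finset.sum_eq_zero fun b _ => ?_
    rw [f_of_ne (by rw [grade_unitVec]; exact hp), smul_zero]

theorem outer_unitSum_left' (v : TYVec G →₀ ℂ) : outerₗ D (unitSum G) v =
    ∑ a, (starRingEnd ℂ) (v (unitVec a)) • outerₗ D (unitSum G) (Finsupp.single (unitVec a) 1) := by
  have h1 : ∀ a, (starRingEnd ℂ) (v (unitVec a)) •
      outerₗ D (unitSum G) (Finsupp.single (unitVec a) 1) =
      (fun p => outerₗ D (unitSum G) (Finsupp.single p (v p))) (unitVec a) := by
    intro a
    show _ = outerₗ D _ (Finsupp.single _ _)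
    rw [← LinearMap.map_smulₛₗ, Finsupp.smul_single, smul_eq_mul, mul_one]
  simp only [h1]
  rw [← sum_unitVec (fun p => outerₗ D (unitSum G) (Finsupp.single p (v p)))]
  · rw [← map_sum, Finsupp.univ_sum_single]
  · intro p hp
    simp only [unitSum, map_sum, LinearMap.sum_apply, outer_single]
    refine Finset.sum_eq_zero fun b _ => ?_
    rw [f_of_ne (by rw [grade_unitVec]; exact hp.symm), smul_zero]

theorem comp_hat_unit {p q : TYVec G} (h : p.grade = q.grade) (a : Option G) :
    D.comp p q.hat (unitVec a) = if p = q ∧ a = src p then sigma D q else 0 := by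
  rw [comp_apply]
  cases p <;> cases q <;> simp [TYVec.grade] at h <;> (try subst h) <;> cases a <;>
    simp [cc, hat, unitVec, src, sigma, chi_zero_left]
  all_goals grind

theorem hat_comp_unit {p q : TYVec G} (h : p.grade = q.grade) (a : Option G) :
    sigma D p * kap D p.grade * D.comp p.hat q (unitVec a) =
      if p = q ∧ a = tgt p then 1 else 0 := by
  rw [comp_apply]
  cases p <;> cases q <;> simp [TYVec.grade] at h <;> (try subst h) <;> cases a <;>
    simp [cc, hat, unitVec, tgt, sigma, chi_zero_left, kap, TYVec.grade, tau_ne']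
  all_goals grind

theorem mul_antipode_f {p q : TYVec G} (h : p.grade = q.grade) :
    LinearMap.mul' ℂ (TYAlg D) (LinearMap.lTensor _ (antipode D)
      (Coalgebra.comul (R := ℂ) (f D p q))) =
      if p = q then ∑ b, f D (unitVec (src p)) (unitVec b) else 0 := by
  have e : ∀ t : TYVec G, f D p t * antipode D (f D t q) = (sigma D q)⁻¹ •
      outerₗ D (D.comp p q.hat) (if p.grade = t.grade then sigma D t • D.comp t t.hat else 0) := by
    intro t
    by_cases ht : p.grade = t.grade
    · rw [if_pos ht, antipode_f (ht.symm.trans h), mul_smul_comm,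
        f_mul_f _ _ _ _ ht (grade_hat (h.symm.trans ht)), LinearMap.map_smulₛₗ, conj_sigma, smul_smul]
      congr 1; ring
    · rw [f_of_ne ht, zero_mul, if_neg ht, map_zero, smul_zero]
  rw [comul_f]
  simp only [map_sum, LinearMap.lTensor_tmul, LinearMap.mul'_apply, e]
  rw [← Finset.smul_sum, ← map_sum, sum_sigma_comp, outer_unitSum_right']
  simp only [comp_hat_unit h]
  have hs := sigma_ne (D := D) q
  by_cases hpq : p = q
  · simp only [hpq, true_and, if_true, ite_smul, zero_smul, Finset.sum_ite_eq', Finset.mem_univ,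
      smul_smul, inv_mul_cancel₀ hs, one_smul]
    simp [unitSum, outer_single]
  · simp [hpq]

theorem antipode_mul_self_f {p q : TYVec G} (h : p.grade = q.grade) :
    LinearMap.mul' ℂ (TYAlg D) (LinearMap.rTensor _ (antipode D)
      (Coalgebra.comul (R := ℂ) (f D p q))) =
      if p = q then ∑ a, f D (unitVec a) (unitVec (tgt p)) else 0 := by
  have e : ∀ t : TYVec G, antipode D (f D p t) * f D t q = sigma D p •
      outerₗ D (if p.grade = t.grade then (sigma D t)⁻¹ • D.comp t.hat t else 0)
        (D.comp p.hat q) := by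
    intro t
    by_cases ht : p.grade = t.grade
    · rw [if_pos ht, antipode_f ht, smul_mul_assoc,
        f_mul_f _ _ _ _ (grade_hat ht.symm) (ht.symm.trans h), map_smul, LinearMap.smul_apply,
        smul_smul]
      congr 1
    · rw [f_of_ne ht, map_zero, zero_mul, if_neg ht, map_zero, LinearMap.zero_apply, smul_zero]
  rw [comul_f]
  simp only [map_sum, LinearMap.rTensor_tmul, LinearMap.mul'_apply, e]
  rw [← Finset.smul_sum, ← LinearMap.sum_apply, ← map_sum, sum_sigma_inv_comp, map_smul,
    LinearMap.smul_apply, outer_unitSum_left', smul_smul, Finset.smul_sum]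
  have h3 : (starRingEnd ℂ) (sigma D p * kap D p.grade) = sigma D p * kap D p.grade := by
    rw [map_mul, conj_sigma]
    congr 1
    cases p.grade <;> simp [kap]
  have h2 : ∀ a, (sigma D p * kap D p.grade) * (starRingEnd ℂ) (D.comp p.hat q (unitVec a)) =
      if p = q ∧ a = tgt p then 1 else 0 := by
    intro a
    rw [← h3, ← map_mul, hat_comp_unit h]
    split_ifs <;> simp
  simp only [smul_smul, h2]
  by_cases hpq : p = q
  · simp only [hpq, true_and, if_true, ite_smul, zero_smul, Finset.sum_ite_eq', Finset.mem_univ,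
      one_smul]
    simp [unitSum, outer_single]
  · simp [hpq]

theorem targetCounit_add (x y : TYAlg D) :
    targetCounit (x + y) = targetCounit x + targetCounit y := by
  simp only [targetCounit, TensorProduct.add_tmul, mul_add, map_add]
theorem targetCounit_smul (c : ℂ) (x : TYAlg D) :
    targetCounit (c • x) = c • targetCounit x := by
  simp only [targetCounit, ← TensorProduct.smul_tmul', mul_smul_comm, map_smul]
theorem targetCounit_zero : targetCounit (0 : TYAlg D) = 0 := by
  simp [targetCounit]
theorem sourceCounit_add (x y : TYAlg D) :
    sourceCounit (x + y) = sourceCounit x + sourceCounit y := by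
  simp only [sourceCounit, TensorProduct.tmul_add, add_mul, map_add]
theorem sourceCounit_smul (c : ℂ) (x : TYAlg D) :
    sourceCounit (c • x) = c • sourceCounit x := by
  simp only [sourceCounit, TensorProduct.tmul_smul, smul_mul_assoc, map_smul]
theorem sourceCounit_zero : sourceCounit (0 : TYAlg D) = 0 := by
  simp [sourceCounit]

theorem antipode_unit (a b : Option G) :
    antipode D (f D (unitVec a) (unitVec b)) = f D (unitVec b) (unitVec a) := by
  rw [antipode_f ((grade_unitVec _).trans (grade_unitVec _).symm), sigma_unitVec, sigma_unitVec,
    hat_unitVec, hat_unitVec, div_one, one_smul]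

theorem antipode_one' : antipode D 1 = 1 := by
  rw [one_eq]
  simp only [map_sum, antipode_unit]
  rw [Finset.sum_comm]

/-- The weak Hopf C*-algebra of the Tambara–Yamagami category with datum `D`. -/
instance : WeakHopfCStarAlgebra (TYAlg D) where
  finite := inferInstance
  exists_faithful_rep := exists_rep
  comul_mul := comul_mul
  comul_star := comul_star
  counit_mul_mul := counit_mul_mul
  comul_one := comul_one'
  antipode := antipode D
  antipode_one := antipode_one'
  antipode_mul := antipode_mul
  counit_antipode := counit_antipode
  comul_antipode := comul_antipode
  mul_antipode b := by
    induction b using TYAlg.induction with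
    | h0 => simp only [map_zero, targetCounit_zero]
    | hadd x y hx hy => simp only [map_add, targetCounit_add, hx, hy]
    | hsmul c x hx => simp only [map_smul, targetCounit_smul, hx]
    | hf p q h => rw [mul_antipode_f h, targetCounit_f]
  antipode_mul_self b := by
    induction b using TYAlg.induction with
    | h0 => simp only [map_zero, sourceCounit_zero]
    | hadd x y hx hy => simp only [map_add, sourceCounit_add, hx, hy]
    | hsmul c x hx => simp only [map_smul, sourceCounit_smul, hx]
    | hf p q h => rw [antipode_mul_self_f h, sourceCounit_f]
  regular b := by
    induction b using TYAlg.induction with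
    | h0 => simp only [map_zero, targetCounit_zero]
    | hadd x y hx hy => simp only [map_add, targetCounit_add, hx, hy]
    | hsmul c x hx => simp only [map_smul, targetCounit_smul, hx]
    | hf p q h =>
      rw [targetCounit_f]
      split_ifs
      · simp only [map_sum, antipode_unit]
      · simp only [map_zero]

variable (D) in
/-- The orthogonal `L^⊥` of a subgroup `L` with respect to `χ`. -/
def orthogonal (L : AddSubgroup G) : Set G := {l | ∀ h ∈ L, D.chi l h = 1}

variable (D) in
open Classical in
/-- The coideals `I^x` for `x` a subgroup of `G` or `x = Ω` (which is modelled by `none`).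
`I^Ω` is the source counital subalgebra, spanned by the elements
`(∑_{a ∈ Ω} v^0_a) ⊗ conj(v^0_b)` with `b ∈ Ω`. For a subgroup `L`, `I^L` is spanned by
the elements `v^0_Y ⊗ conj(v^0_b)`, where `Y` is a coset of `L`, `v^0_Y` is the sum of the
`v^0_y` with `y ∈ Y` and `b ∈ Ω`, and by the elements
`v^l_m ⊗ conj(q)`, where `l ∈ L^⊥` and `q` is a basis vector of `H^l`. -/
def coideal : Option (AddSubgroup G) → Submodule ℂ (TYAlg D)
  | none => Submodule.span ℂ (Set.range fun b : Option G => ∑ a, f D (unitVec a) (unitVec b))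
  | some L => Submodule.span ℂ
      ({c | ∃ (g : G) (b : Option G),
          c = ∑ h ∈ Finset.univ.filter (fun h : G => h ∈ L), f D (gh 0 (g + h)) (unitVec b)} ∪
        {c | ∃ l ∈ orthogonal D L, ∃ q : TYVec G, q.grade = some l ∧ c = f D (gm l) q})

end TYAlg
end

end

/-! The core is a classification of the invariant coideals; the quotient type coideals are then
matched with it. Write Ω = G ⊔ {m}. The comultiplication only touches the second index of v ⊗
conj(w), so a right coideal is stable under moving that index inside one H^x (`comul_mem_iff`).

Classification (`exists_eq_coideal`). Acting by 1 under ◁ is the compression b ↦ ∑ t_c b t_c by the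
minimal projections t_c of the target counital subalgebra. As ◁ is an action, I ◁ B = I forces I to
be fixed by this compression, that is, to involve only first indices p with `src p = tgt p`. These
are the v^0_a and the v^g_m, so nothing of H^m survives. Hence I is governed by the set of g ≠ 0
with v^g_m ⊗ conj(H^g) in I and by the unital algebra A of functions φ on Ω with φ ⊗ conj(v^0_c) in
I. The adjoint action links the two: f^h_{h,h} translates φ (`adj_funElt_translate`), one element of
degree m turns φ into its Fourier transform on the v^g_m (`adj_funElt_dual`), and another turns
v^g_m into the character χ(g,·) extended by 0 to m (`adj_gm`). A unital algebra of functions on a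
finite set contains the indicators of the classes it does not separate. If the indicator of m lies
in A, the classes are {m} and the cosets of a subgroup L; the characters force g ∈ L^⊥, and the
Fourier transform of the indicator of L produces all of L^⊥, so I = I^L. Otherwise m is glued to
some element of G, by translation to all of G, so A is the constants, no g ≠ 0 occurs, and I = I^Ω.

Quotient type implies invariant (`quotientFixed_mem_invariantCoideals`). Because επ = ε, the fixed
point equation, cut down by target projections, again gives support on `src p = tgt p`. This yields
stability under * and I ◁ 1 = I; stability under ◁ comes from S(x₁)x₂ = ε_s(x).

Each I^x is of quotient type. The matrix representation `repL` has a block on Ω for every d ∈ G,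
built from translation by d. Convolution adds the labels d, the counit lives on the block 0, the
antipode negates d; so the blocks with d ∈ L form a quantum subgroupoid. Its fixed points form an
invariant coideal, hence some I^x by the classification; containing I^L and failing one test element
leave only x = L. For x = Ω the identity map works. Distinct x give distinct I^x by comparing
coefficients (`coideal_injective`). -/

section
universe u v

/-! ### Weak Hopf structures on images of surjective homomorphisms. -/

namespace WeakHopfCStarAlgebra

variable {B : Type u} [WeakHopfCStarAlgebra B] {A : Type v} [Ring A] [Algebra ℂ A]

/-- The coalgebra structure induced on the image of a surjective linear map whose kernel is a
coideal. -/
@[reducible]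
noncomputable def quotientCoalgebra (π : B →ₗ[ℂ] A) (hπ : Function.Surjective π)
    (hΔ : ∀ b, π b = 0 → TensorProduct.map π π (Coalgebra.comul (R := ℂ) b) = 0)
    (hε : ∀ b, π b = 0 → Coalgebra.counit (R := ℂ) b = 0) : Coalgebra ℂ A :=
  let s : A →ₗ[ℂ] B := (π.exists_rightInverse_of_surjective (LinearMap.range_eq_top.2 hπ)).choose
  have hs : ∀ a, π (s a) = a := LinearMap.congr_fun
    (π.exists_rightInverse_of_surjective (LinearMap.range_eq_top.2 hπ)).choose_spec
  -- The section moves b only by an element of the kernel, which the coideal hypotheses make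
  -- invisible. So `s` disappears from every computation below.
  have hc : ∀ b, TensorProduct.map π π (Coalgebra.comul (R := ℂ) (s (π b))) =
      TensorProduct.map π π (Coalgebra.comul (R := ℂ) b) := by
    intro b
    rw [← sub_eq_zero, ← map_sub, ← map_sub]
    exact hΔ _ (by rw [map_sub, hs, sub_self])
  have he : ∀ b, Coalgebra.counit (R := ℂ) (s (π b)) = Coalgebra.counit (R := ℂ) b := by
    intro b
    rw [← sub_eq_zero, ← map_sub]
    exact hε _ (by rw [map_sub, hs, sub_self])
  { comul := TensorProduct.map π π ∘ₗ Coalgebra.comul ∘ₗ s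
    counit := Coalgebra.counit ∘ₗ s
    coassoc := by
      have h1 : (TensorProduct.map π π ∘ₗ Coalgebra.comul ∘ₗ s) ∘ₗ π =
          TensorProduct.map π π ∘ₗ Coalgebra.comul := LinearMap.ext hc
      -- By surjectivity the identity may be tested after composing with π, where it is the image
      -- under π ⊗ π ⊗ π of coassociativity in B.
      rw [← LinearMap.cancel_right hπ]
      have h2 : ∀ t : B ⊗[ℂ] B, TensorProduct.assoc ℂ A A A
          (LinearMap.rTensor A (TensorProduct.map π π ∘ₗ Coalgebra.comul ∘ₗ s)
            (TensorProduct.map π π t)) =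
          TensorProduct.map π (TensorProduct.map π π) (TensorProduct.assoc ℂ B B B
            (LinearMap.rTensor B Coalgebra.comul t)) := by
        intro t
        induction t with
        | zero => simp only [map_zero]
        | add x y hx hy => simp only [map_add, hx, hy]
        | tmul x y =>
          simp only [TensorProduct.map_tmul, LinearMap.rTensor_tmul, LinearMap.comp_apply, hc]
          generalize Coalgebra.comul (R := ℂ) x = t
          induction t with
          | zero => simp only [map_zero, TensorProduct.zero_tmul]
          | add x y hx hy => simp only [map_add, TensorProduct.add_tmul, hx, hy]
          | tmul x' y' => simp
      have h3 : ∀ t : B ⊗[ℂ] B,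
          LinearMap.lTensor A (TensorProduct.map π π ∘ₗ Coalgebra.comul ∘ₗ s)
            (TensorProduct.map π π t) =
          TensorProduct.map π (TensorProduct.map π π) (LinearMap.lTensor B Coalgebra.comul t) := by
        intro t
        induction t with
        | zero => simp only [map_zero]
        | add x y hx hy => simp only [map_add, hx, hy]
        | tmul x y =>
          simp only [TensorProduct.map_tmul, LinearMap.lTensor_tmul, LinearMap.comp_apply, hc]
      ext b
      simp only [LinearMap.comp_apply, hc, LinearEquiv.coe_coe] at h2 h3 ⊢
      rw [h2, h3]
      congr 1
      exact Coalgebra.coassoc_apply b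
    rTensor_counit_comp_comul := by
      rw [← LinearMap.cancel_right hπ]
      ext b
      simp only [LinearMap.comp_apply, hc]
      have h2 : ∀ t : B ⊗[ℂ] B, LinearMap.rTensor A (Coalgebra.counit ∘ₗ s)
            (TensorProduct.map π π t) =
          LinearMap.lTensor ℂ π (LinearMap.rTensor B Coalgebra.counit t) := by
        intro t
        induction t with
        | zero => simp only [map_zero]
        | add x y hx hy => simp only [map_add, hx, hy]
        | tmul x y => simp [he]
      rw [h2, Coalgebra.rTensor_counit_comul]
      rfl
    lTensor_counit_comp_comul := by
      rw [← LinearMap.cancel_right hπ]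
      ext b
      simp only [LinearMap.comp_apply, hc]
      have h2 : ∀ t : B ⊗[ℂ] B, LinearMap.lTensor A (Coalgebra.counit ∘ₗ s)
            (TensorProduct.map π π t) =
          LinearMap.rTensor ℂ π (LinearMap.lTensor B Coalgebra.counit t) := by
        intro t
        induction t with
        | zero => simp only [map_zero]
        | add x y hx hy => simp only [map_add, hx, hy]
        | tmul x y => simp [he]
      rw [h2, Coalgebra.lTensor_counit_comul]
      rfl }

/-- The structure was defined through an arbitrary linear section; this and the companion for the
counit show that the choice is immaterial and that π is a coalgebra map. -/
theorem quotientCoalgebra_comul (π : B →ₗ[ℂ] A) (hπ : Function.Surjective π)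
    (hΔ : ∀ b, π b = 0 → TensorProduct.map π π (Coalgebra.comul (R := ℂ) b) = 0)
    (hε : ∀ b, π b = 0 → Coalgebra.counit (R := ℂ) b = 0) (b : B) :
    (quotientCoalgebra π hπ hΔ hε).comul (π b) =
      TensorProduct.map π π (Coalgebra.comul (R := ℂ) b) := by
  rw [← sub_eq_zero]
  have hs := LinearMap.congr_fun
    (π.exists_rightInverse_of_surjective (LinearMap.range_eq_top.2 hπ)).choose_spec (π b)
  refine Eq.trans ?_ (hΔ ((π.exists_rightInverse_of_surjective
    (LinearMap.range_eq_top.2 hπ)).choose (π b) - b) (by rw [map_sub, sub_eq_zero]; exact hs))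
  rw [map_sub, map_sub]
  rfl

theorem quotientCoalgebra_counit (π : B →ₗ[ℂ] A) (hπ : Function.Surjective π)
    (hΔ : ∀ b, π b = 0 → TensorProduct.map π π (Coalgebra.comul (R := ℂ) b) = 0)
    (hε : ∀ b, π b = 0 → Coalgebra.counit (R := ℂ) b = 0) (b : B) :
    (quotientCoalgebra π hπ hΔ hε).counit (π b) = Coalgebra.counit (R := ℂ) b := by
  rw [← sub_eq_zero]
  have hs := LinearMap.congr_fun
    (π.exists_rightInverse_of_surjective (LinearMap.range_eq_top.2 hπ)).choose_spec (π b)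
  refine Eq.trans ?_ (hε ((π.exists_rightInverse_of_surjective
    (LinearMap.range_eq_top.2 hπ)).choose (π b) - b) (by rw [map_sub, sub_eq_zero]; exact hs))
  rw [map_sub]
  rfl

theorem tensor_map_mul (π : B →ₐ[ℂ] A) (x y : B ⊗[ℂ] B) :
    TensorProduct.map π.toLinearMap π.toLinearMap (x * y) =
      TensorProduct.map π.toLinearMap π.toLinearMap x *
        TensorProduct.map π.toLinearMap π.toLinearMap y :=
  map_mul (Algebra.TensorProduct.map π π) x y

variable [Coalgebra ℂ A] (π : B →ₐ[ℂ] A)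

/-- The counital map is assembled from the product, Δ(1) and ε alone, all of which π respects. With
its source analogue this carries the antipode axioms over to the image. -/
theorem targetCounit_map
    (hΔ : ∀ b, Coalgebra.comul (R := ℂ) (π b) =
      TensorProduct.map π.toLinearMap π.toLinearMap (Coalgebra.comul (R := ℂ) b))
    (hε : ∀ b, Coalgebra.counit (R := ℂ) (π b) = Coalgebra.counit (R := ℂ) b) (b : B) :
    targetCounit (π b) = π (targetCounit b) := by
  have h : (π b) ⊗ₜ[ℂ] (1 : A) = TensorProduct.map π.toLinearMap π.toLinearMap (b ⊗ₜ 1) := by simp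
  rw [targetCounit, targetCounit, h, ← map_one π, hΔ, ← tensor_map_mul]
  generalize Coalgebra.comul (R := ℂ) (1 : B) * (b ⊗ₜ[ℂ] (1 : B)) = t
  induction t with
  | zero => simp only [map_zero]
  | add x y hx hy => simp only [map_add, hx, hy]
  | tmul x y => simp [hε]

theorem sourceCounit_map
    (hΔ : ∀ b, Coalgebra.comul (R := ℂ) (π b) =
      TensorProduct.map π.toLinearMap π.toLinearMap (Coalgebra.comul (R := ℂ) b))
    (hε : ∀ b, Coalgebra.counit (R := ℂ) (π b) = Coalgebra.counit (R := ℂ) b) (b : B) :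
    sourceCounit (π b) = π (sourceCounit b) := by
  have h : (1 : A) ⊗ₜ[ℂ] (π b) = TensorProduct.map π.toLinearMap π.toLinearMap (1 ⊗ₜ b) := by simp
  rw [sourceCounit, sourceCounit, h, ← map_one π, hΔ, ← tensor_map_mul]
  generalize ((1 : B) ⊗ₜ[ℂ] b) * Coalgebra.comul (R := ℂ) (1 : B) = t
  induction t with
  | zero => simp only [map_zero]
  | add x y hx hy => simp only [map_add, hx, hy]
  | tmul x y => simp [hε]

end WeakHopfCStarAlgebra

open WeakHopfCStarAlgebra in
/-- A surjective `*`-homomorphism from a weak Hopf C*-algebra that intertwines the comultiplication,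
counit and antipode with given maps makes its codomain a weak Hopf C*-algebra. -/
@[reducible]
def WeakHopfCStarAlgebra.ofSurjective {B : Type u} [WeakHopfCStarAlgebra B]
    {A : Type v} [Ring A] [StarRing A] [Algebra ℂ A] [StarModule ℂ A] [Coalgebra ℂ A]
    (π : B →⋆ₐ[ℂ] A) (hπ : Function.Surjective π)
    (hrep : ∃ (n : ℕ) (ρ : A →⋆ₐ[ℂ] Matrix (Fin n) (Fin n) ℂ), Function.Injective ρ)
    (hΔ : ∀ b, Coalgebra.comul (R := ℂ) (π b) =
      TensorProduct.map π.toAlgHom.toLinearMap π.toAlgHom.toLinearMap (Coalgebra.comul (R := ℂ) b))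
    (hε : ∀ b, Coalgebra.counit (R := ℂ) (π b) = Coalgebra.counit (R := ℂ) b)
    (S : A →ₗ[ℂ] A) (hS : ∀ b, S (π b) = π (antipode b)) : WeakHopfCStarAlgebra A where
  finite :=
    haveI := WeakHopfCStarAlgebra.finite (B := B)
    Module.Finite.of_surjective π.toAlgHom.toLinearMap hπ
  exists_faithful_rep := hrep
  -- Every axiom is handled alike: lift the arguments through π, move π outside, and use the axiom
  -- of B; tensors are compared on pure tensors.
  comul_mul := by
    intro b c
    obtain ⟨b, rfl⟩ := hπ b
    obtain ⟨c, rfl⟩ := hπ c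
    rw [← map_mul, hΔ, hΔ, hΔ, comul_mul, tensor_map_mul]
  comul_star := by
    intro b
    obtain ⟨b, rfl⟩ := hπ b
    rw [← map_star, hΔ, hΔ, comul_star]
    generalize Coalgebra.comul (R := ℂ) b = t
    induction t with
    | zero => simp only [map_zero, star_zero]
    | add x y hx hy => simp only [map_add, star_add, hx, hy]
    | tmul x y => simp [TensorProduct.star_tmul, map_star]
  counit_mul_mul := by
    intro b c d
    obtain ⟨b, rfl⟩ := hπ b
    obtain ⟨c, rfl⟩ := hπ c
    obtain ⟨d, rfl⟩ := hπ d
    rw [← map_mul, ← map_mul, hΔ, hε, ← counit_mul_mul]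
    generalize Coalgebra.comul (R := ℂ) c = t
    induction t with
    | zero => simp only [map_zero]
    | add x y hx hy => simp only [map_add, hx, hy]
    | tmul x y => simp [← map_mul, hε]
  comul_one := by
    have h1 : (TensorProduct.assoc ℂ A A A).symm
        ((1 : A) ⊗ₜ[ℂ] TensorProduct.map π.toAlgHom.toLinearMap π.toAlgHom.toLinearMap
          (Coalgebra.comul (R := ℂ) (1 : B))) =
        Algebra.TensorProduct.map (Algebra.TensorProduct.map π.toAlgHom π.toAlgHom) π.toAlgHom
          ((TensorProduct.assoc ℂ B B B).symm ((1 : B) ⊗ₜ[ℂ] Coalgebra.comul (R := ℂ) (1 : B))) := by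
      generalize Coalgebra.comul (R := ℂ) (1 : B) = t
      induction t with
      | zero => simp only [map_zero, TensorProduct.tmul_zero]
      | add x y hx hy => simp only [map_add, TensorProduct.tmul_add, hx, hy]
      | tmul x y => simp
    have h2 : (TensorProduct.map π.toAlgHom.toLinearMap π.toAlgHom.toLinearMap
          (Coalgebra.comul (R := ℂ) (1 : B))) ⊗ₜ[ℂ] (1 : A) =
        Algebra.TensorProduct.map (Algebra.TensorProduct.map π.toAlgHom π.toAlgHom) π.toAlgHom
          ((Coalgebra.comul (R := ℂ) (1 : B)) ⊗ₜ[ℂ] (1 : B)) := by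
      rw [Algebra.TensorProduct.map_tmul, map_one π.toAlgHom]
      rfl
    rw [← map_one π, hΔ, map_one π, h1, h2, ← map_mul, comul_one]
    generalize Coalgebra.comul (R := ℂ) (1 : B) = t
    induction t with
    | zero => simp only [map_zero]
    | add x y hx hy => simp only [map_add, hx, hy]
    | tmul x y =>
      simp only [LinearMap.rTensor_tmul, TensorProduct.map_tmul, Algebra.TensorProduct.map_tmul]
      erw [hΔ]
      rfl
  antipode := S
  antipode_one := by rw [← map_one π, hS, antipode_one]
  antipode_mul := by
    intro b c
    obtain ⟨b, rfl⟩ := hπ b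
    obtain ⟨c, rfl⟩ := hπ c
    rw [← map_mul, hS, hS, hS, antipode_mul, map_mul]
  counit_antipode := by
    intro b
    obtain ⟨b, rfl⟩ := hπ b
    rw [hS, hε, hε, counit_antipode]
  comul_antipode := by
    intro b
    obtain ⟨b, rfl⟩ := hπ b
    rw [hS, hΔ, hΔ, comul_antipode]
    generalize Coalgebra.comul (R := ℂ) b = t
    induction t with
    | zero => simp only [map_zero]
    | add x y hx hy => simp only [map_add, hx, hy]
    | tmul x y => simp [hS]
  mul_antipode := by
    intro b
    obtain ⟨b, rfl⟩ := hπ b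
    have := targetCounit_map π.toAlgHom hΔ hε b
    erw [this]
    rw [hΔ, ← mul_antipode]
    generalize Coalgebra.comul (R := ℂ) b = t
    induction t with
    | zero => simp only [map_zero]
    | add x y hx hy => simp only [map_add, hx, hy]
    | tmul x y => simp [hS]
  antipode_mul_self := by
    intro b
    obtain ⟨b, rfl⟩ := hπ b
    have := sourceCounit_map π.toAlgHom hΔ hε b
    erw [this]
    rw [hΔ, ← antipode_mul_self]
    generalize Coalgebra.comul (R := ℂ) b = t
    induction t with
    | zero => simp only [map_zero]
    | add x y hx hy => simp only [map_add, hx, hy]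
    | tmul x y => simp [hS]
  regular := by
    intro b
    obtain ⟨b, rfl⟩ := hπ b
    have := targetCounit_map π.toAlgHom hΔ hε b
    erw [this]
    erw [hS, hS, regular]
    rfl

open WeakHopfCStarAlgebra in
/-- The image of a matrix representation of a weak Hopf C*-algebra `B` whose kernel is a coideal
invariant under the antipode is a quantum subgroupoid of `B`. -/
theorem exists_isQuantumSubgroupoid {B : Type u} [WeakHopfCStarAlgebra B] {n : Type u} [Fintype n]
    [DecidableEq n] (ρ : B →⋆ₐ[ℂ] Matrix n n ℂ)
    (hΔ : ∀ b, ρ b = 0 → TensorProduct.map ρ.toAlgHom.toLinearMap ρ.toAlgHom.toLinearMap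
      (Coalgebra.comul (R := ℂ) b) = 0)
    (hε : ∀ b, ρ b = 0 → Coalgebra.counit (R := ℂ) b = 0)
    (hS : ∀ b, ρ b = 0 → ρ (antipode b) = 0) :
    ∃ (C : Type u) (_ : WeakHopfCStarAlgebra C) (π : B →⋆ₐ[ℂ] C) (ι : C →ₗ[ℂ] Matrix n n ℂ),
      IsQuantumSubgroupoid π ∧ Function.Injective ι ∧ ∀ b, ι (π b) = ρ b := by
  -- Taking the range inside matrices, rather than an abstract quotient, supplies the faithful
  -- *-representation required of C.
  let π : B →⋆ₐ[ℂ] ρ.range := ρ.rangeRestrict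
  have hπ : Function.Surjective π := by
    rintro ⟨_, b, rfl⟩
    exact ⟨b, rfl⟩
  have hι : Function.Injective ρ.range.subtype.toAlgHom.toLinearMap := Subtype.val_injective
  have h0 : ∀ b, π b = 0 ↔ ρ b = 0 := fun b => Subtype.ext_iff
  -- Over a field, tensor products of injections are injective, so the vanishing of (π ⊗ π)Δ(b) can
  -- be tested with matrices.
  have hmap : Function.Injective (TensorProduct.map ρ.range.subtype.toAlgHom.toLinearMap
      ρ.range.subtype.toAlgHom.toLinearMap) := by
    rw [← LinearMap.rTensor_comp_lTensor]
    exact (Module.Flat.rTensor_preserves_injective_linearMap _ hι).comp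
      (Module.Flat.lTensor_preserves_injective_linearMap _ hι)
  have hΔ' : ∀ b, π.toAlgHom.toLinearMap b = 0 →
      TensorProduct.map π.toAlgHom.toLinearMap π.toAlgHom.toLinearMap
        (Coalgebra.comul (R := ℂ) b) = 0 := by
    intro b hb
    apply hmap
    rw [map_zero, ← hΔ b ((h0 b).1 hb), ← LinearMap.comp_apply, ← TensorProduct.map_comp]
    rfl
  have hε' : ∀ b, π.toAlgHom.toLinearMap b = 0 → Coalgebra.counit (R := ℂ) b = 0 :=
    fun b hb => hε b ((h0 b).1 hb)
  let _ : Coalgebra ℂ ρ.range := quotientCoalgebra π.toAlgHom.toLinearMap hπ hΔ' hε'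
  obtain ⟨s, hs⟩ := π.toAlgHom.toLinearMap.exists_rightInverse_of_surjective
    (LinearMap.range_eq_top.2 hπ)
  have hs' : ∀ a, π (s a) = a := LinearMap.congr_fun hs
  have hS' : ∀ b, (π.toAlgHom.toLinearMap ∘ₗ antipode ∘ₗ s) (π b) = π (antipode b) := by
    intro b
    have := (h0 _).2 (hS (s (π b) - b) ((h0 _).1 (by rw [map_sub, hs', sub_self])))
    rw [map_sub, map_sub, sub_eq_zero] at this
    exact this
  have hrep : ∃ (k : ℕ) (σ : ρ.range →⋆ₐ[ℂ] Matrix (Fin k) (Fin k) ℂ), Function.Injective σ := by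
    let E := Matrix.reindexAlgEquiv ℂ ℂ (Fintype.equivFin n)
    refine ⟨Fintype.card n, StarAlgHom.comp { E.toAlgHom with
      map_star' := fun M => by ext i j; simp [E, Matrix.star_apply] } ρ.range.subtype, ?_⟩
    exact E.injective.comp Subtype.val_injective
  let _ : WeakHopfCStarAlgebra ρ.range := WeakHopfCStarAlgebra.ofSurjective π hπ hrep
    (quotientCoalgebra_comul π.toAlgHom.toLinearMap hπ hΔ' hε')
    (quotientCoalgebra_counit π.toAlgHom.toLinearMap hπ hΔ' hε') _ hS'
  exact ⟨ρ.range, inferInstance, π, ρ.range.subtype.toAlgHom.toLinearMap,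
    ⟨hπ, quotientCoalgebra_comul π.toAlgHom.toLinearMap hπ hΔ' hε', hS',
      quotientCoalgebra_counit π.toAlgHom.toLinearMap hπ hΔ' hε'⟩, hι, fun _ => rfl⟩

end

/-! ### Coordinates and slices of the comultiplication. -/

noncomputable section
universe u v

namespace TYAlg
open TYVec

variable {G : Type u} [AddCommGroup G] [Fintype G] [DecidableEq G] {D : TYDatum G}

/-- The coordinate functional dual to `f p q`. -/
def coeff (p q : TYVec G) : TYAlg D →ₗ[ℂ] ℂ := lift fun p' q' => if p' = p ∧ q' = q then 1 else 0

/-- The map `v ⊗ conj(w) ↦ conj(w_q) v ⊗ conj(r)`, a slice of the comultiplication. -/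
def slice (q r : TYVec G) : TYAlg D →ₗ[ℂ] TYAlg D :=
  lift fun p q' => if q' = q then f D p r else 0

theorem coeff_f {p q : TYVec G} (h : p.grade = q.grade) (p' q' : TYVec G) :
    coeff p' q' (f D p q) = if p = p' ∧ q = q' then 1 else 0 := by
  rw [coeff, lift_f, if_pos h]

theorem slice_f {p q' : TYVec G} (h : p.grade = q'.grade) (q r : TYVec G) :
    slice q r (f D p q') = if q' = q then f D p r else 0 := by
  rw [slice, lift_f, if_pos h]

theorem eq_sum_coeff (b : TYAlg D) : b = ∑ p, ∑ q, coeff p q b • f D p q := by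
  have : LinearMap.id (R := ℂ) (M := TYAlg D) =
      ∑ p, ∑ q, (coeff p q : TYAlg D →ₗ[ℂ] ℂ).smulRight (f D p q) := by
    apply hom_ext
    intro p q h
    simp [LinearMap.sum_apply, coeff_f h, ite_and]
  simpa [LinearMap.sum_apply] using LinearMap.congr_fun this b

theorem slice_eq (q r : TYVec G) (b : TYAlg D) :
    slice q r b = ∑ p, coeff p q b • f D p r := by
  have : (slice q r : TYAlg D →ₗ[ℂ] TYAlg D) =
      ∑ p, (coeff p q : TYAlg D →ₗ[ℂ] ℂ).smulRight (f D p r) := by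
    apply hom_ext
    intro p q' h
    simp only [slice_f h, LinearMap.sum_apply, LinearMap.smulRight_apply, coeff_f h, ite_and,
      ite_smul, one_smul, zero_smul, Finset.sum_ite_eq, Finset.mem_univ, if_true]
  simpa [LinearMap.sum_apply] using LinearMap.congr_fun this b

theorem coeff_of_ne {p q : TYVec G} (h : p.grade ≠ q.grade) (b : TYAlg D) : coeff p q b = 0 := by
  have : (coeff p q : TYAlg D →ₗ[ℂ] ℂ) = 0 := by
    apply hom_ext
    intro p' q' h'
    rw [coeff_f h', if_neg]
    · rfl
    · rintro ⟨rfl, rfl⟩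
      exact h h'
  rw [this]
  rfl

/-- A slice extracts the column q and relabels it r. Equality of grades is needed because `f D p r`
is 0 by convention when the grades differ. -/
theorem coeff_slice {q r : TYVec G} (hqr : q.grade = r.grade) (p q' : TYVec G) (b : TYAlg D) :
    coeff p q' (slice q r b) = if q' = r then coeff p q b else 0 := by
  rw [slice_eq q r]
  by_cases h : p.grade = q'.grade
  · have : ∀ p', coeff p' q b * coeff p q' (f D p' r) =
        if p' = p then if q' = r then coeff p q b else 0 else 0 := by
      intro p'
      by_cases h' : p'.grade = r.grade
      · rw [coeff_f h']
        by_cases h1 : p' = p <;> by_cases h2 : q' = r <;> simp [h1, h2, eq_comm]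
        simp [Ne.symm h2]
      · rw [coeff_of_ne (hqr ▸ h'), zero_mul]
        by_cases h1 : p' = p
        · subst h1
          by_cases h2 : q' = r
          · exact absurd (h2 ▸ h) h'
          · simp [h2]
        · simp [h1]
    simp only [map_sum, map_smul, smul_eq_mul, this, Finset.sum_ite_eq', Finset.mem_univ, if_true]
  · rw [coeff_of_ne h]
    split_ifs with h2
    · subst h2
      rw [coeff_of_ne (hqr ▸ h)]
    · rfl

theorem slice_slice {q r r' : TYVec G} (hqr : q.grade = r.grade) (b : TYAlg D) :
    slice r r' (slice q r b) = slice q r' b := by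
  rw [slice_eq r r', slice_eq q r']
  simp only [coeff_slice hqr, if_true]

theorem slice_slice_of_ne {q r r' q' : TYVec G} (hqr : q.grade = r.grade)
    (h : q' ≠ r) (b : TYAlg D) : slice q' r' (slice q r b) = 0 := by
  rw [slice_eq q' r']
  simp [coeff_slice hqr, h]

theorem eq_sum_slice (b : TYAlg D) : b = ∑ q, slice q q b := by
  simp only [slice_eq]
  rw [Finset.sum_comm]
  exact eq_sum_coeff b

/-- Expanding the second leg in the basis leaves slices in the first leg; conditions on Δ(b) thereby
become conditions on single slices. -/
theorem comul_eq (b : TYAlg D) :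
    Coalgebra.comul (R := ℂ) b = ∑ r, ∑ q, slice q r b ⊗ₜ[ℂ] f D r q := by
  induction b using TYAlg.induction with
  | h0 => simp
  | hadd x y hx hy => simp only [map_add, hx, hy, TensorProduct.add_tmul, Finset.sum_add_distrib]
  | hsmul c x hx =>
    simp only [map_smul, hx, ← TensorProduct.smul_tmul', Finset.smul_sum]
  | hf p q h =>
    rw [comul_f]
    refine Finset.sum_congr rfl fun r _ => ?_
    simp [slice_f h, TensorProduct.ite_tmul]

theorem slice_comul (q r : TYVec G) (hqr : q.grade = r.grade) (b : TYAlg D) :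
    TensorProduct.rid ℂ _ (LinearMap.lTensor _ (coeff r q) (Coalgebra.comul (R := ℂ) b)) =
      slice q r b := by
  rw [comul_eq]
  simp only [map_sum, LinearMap.lTensor_tmul, TensorProduct.rid_tmul]
  have : ∀ r' q', coeff r q (f D r' q') • slice q' r' b =
      if r' = r then if q' = q then slice q r b else 0 else 0 := by
    intro r' q'
    by_cases h : r'.grade = q'.grade
    · rw [coeff_f h]
      by_cases h1 : r' = r <;> by_cases h2 : q' = q <;> simp [h1, h2]
    · rw [f_of_ne h, map_zero, zero_smul]
      by_cases h1 : r' = r <;> by_cases h2 : q' = q <;> simp [h1, h2]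
      subst h1 h2
      exact absurd hqr.symm h
  simp only [this, Finset.sum_ite_irrel, Finset.sum_const_zero, Finset.sum_ite_eq', Finset.mem_univ, if_true]

/-- A subspace is a subcomodule for the comultiplication iff it is stable under all slices. -/
theorem comul_mem_iff (I : Submodule ℂ (TYAlg D)) :
    (∀ b ∈ I, Coalgebra.comul (R := ℂ) b ∈ LinearMap.range (LinearMap.rTensor (TYAlg D) I.subtype)) ↔
      ∀ b ∈ I, ∀ q r : TYVec G, q.grade = r.grade → slice q r b ∈ I := by
  constructor
  · intro h b hb q r hqr
    rw [← slice_comul q r hqr]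
    obtain ⟨t, ht⟩ := h b hb
    rw [← ht]
    clear ht
    induction t with
    | zero => simp
    | add x y hx hy => simpa only [map_add] using I.add_mem hx hy
    | tmul x y =>
      simp only [LinearMap.rTensor_tmul, LinearMap.lTensor_tmul, TensorProduct.rid_tmul]
      exact I.smul_mem _ x.2
  · intro h b hb
    rw [comul_eq]
    refine Submodule.sum_mem _ fun r _ => Submodule.sum_mem _ fun q _ => ?_
    by_cases hqr : q.grade = r.grade
    · exact ⟨(⟨_, h b hb q r hqr⟩ : I) ⊗ₜ f D r q, by simp⟩
    · rw [f_of_ne (Ne.symm hqr), TensorProduct.tmul_zero]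
      exact Submodule.zero_mem _

/-! ### The counital subalgebras and Δ(1). -/

variable (D) in
/-- The minimal projection `v^0_c ⊗ conj(v^0_Ω)` of the target counital subalgebra. -/
def targetUnit (c : Option G) : TYAlg D := ∑ d, f D (unitVec c) (unitVec d)

variable (D) in
/-- The minimal projection `v^0_Ω ⊗ conj(v^0_c)` of the source counital subalgebra. -/
def sourceUnit (c : Option G) : TYAlg D := ∑ a, f D (unitVec a) (unitVec c)

/-- The common middle index c separates the sum into a source and a target projection.
Multiplication by Δ(1) is thus cutting down by projections. -/
theorem comul_one_units : Coalgebra.comul (R := ℂ) (1 : TYAlg D) =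
    ∑ c, sourceUnit D c ⊗ₜ[ℂ] targetUnit D c := by
  rw [comul_one_eq]
  simp only [sourceUnit, targetUnit, TensorProduct.sum_tmul, TensorProduct.tmul_sum]
  rw [Finset.sum_congr rfl fun a _ => Finset.sum_comm, Finset.sum_comm]
  exact Finset.sum_congr rfl fun _ _ => Finset.sum_comm

theorem comp_unitVec_left (a : Option G) (p : TYVec G) :
    D.comp (unitVec a) p = if src p = a then Finsupp.single p 1 else 0 := by
  cases a <;> cases p <;> simp [unitVec, TYDatum.comp, src, chi_zero_left, sub_eq_iff_eq_add]
  all_goals grind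

theorem comp_unitVec_right (a : Option G) (p : TYVec G) :
    D.comp p (unitVec a) = if tgt p = a then Finsupp.single p 1 else 0 := by
  cases a <;> cases p <;> simp [unitVec, TYDatum.comp, tgt, chi_zero_left]
  all_goals grind

theorem unit_mul_f (a c : Option G) (p q : TYVec G) :
    f D (unitVec a) (unitVec c) * f D p q = if src p = a ∧ src q = c then f D p q else 0 := by
  by_cases h : p.grade = q.grade
  · rw [f_mul_f _ _ _ _ ((grade_unitVec _).trans (grade_unitVec _).symm) h, comp_unitVec_left,
      comp_unitVec_left]
    by_cases h1 : src p = a <;> by_cases h2 : src q = c <;> simp [h1, h2, outer_single]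
  · simp [f_of_ne h]

theorem f_mul_unit (a c : Option G) (p q : TYVec G) :
    f D p q * f D (unitVec a) (unitVec c) = if tgt p = a ∧ tgt q = c then f D p q else 0 := by
  by_cases h : p.grade = q.grade
  · rw [f_mul_f _ _ _ _ h ((grade_unitVec _).trans (grade_unitVec _).symm), comp_unitVec_right,
      comp_unitVec_right]
    by_cases h1 : tgt p = a <;> by_cases h2 : tgt q = c <;> simp [h1, h2, outer_single]
  · simp [f_of_ne h]

/-- The sum over the second index of `targetUnit` imposes no condition on q, so only the left end of
p is tested; multiplication from the right tests `tgt p` instead. -/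
theorem targetUnit_mul_f (c : Option G) (p q : TYVec G) :
    targetUnit D c * f D p q = if src p = c then f D p q else 0 := by
  simp [-Fintype.sum_option, targetUnit, Finset.sum_mul, unit_mul_f, ite_and]

theorem f_mul_targetUnit (c : Option G) (p q : TYVec G) :
    f D p q * targetUnit D c = if tgt p = c then f D p q else 0 := by
  simp [-Fintype.sum_option, targetUnit, Finset.mul_sum, f_mul_unit, ite_and]

/-- Both products are the single basis element v^0_c ⊗ conj(v^0_a): the two counital subalgebras
commute. -/
theorem sourceUnit_mul_targetUnit (a c : Option G) :
    sourceUnit D a * targetUnit D c = targetUnit D c * sourceUnit D a := by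
  simp [-Fintype.sum_option, sourceUnit, Finset.mul_sum, Finset.sum_mul, f_mul_targetUnit, targetUnit_mul_f,
    tgt_unitVec, src_unitVec]

theorem targetUnit_mul_targetUnit (a c : Option G) :
    targetUnit D a * targetUnit D c = if a = c then targetUnit D a else 0 := by
  conv_lhs => rw [targetUnit]
  simp only [Finset.sum_mul, f_mul_targetUnit, tgt_unitVec]
  split_ifs <;> simp [targetUnit]

theorem slice_one {c d : Option G} :
    slice (unitVec c) (unitVec d) (1 : TYAlg D) = sourceUnit D d := by
  rw [one_eq]
  simp only [map_sum, slice_f ((grade_unitVec _).trans (grade_unitVec _).symm),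
    unitVec_injective.eq_iff, Finset.sum_ite_eq', Finset.mem_univ, if_true]
  rfl

theorem mul_comul_one (b : TYAlg D) :
    ((1 : TYAlg D) ⊗ₜ[ℂ] b) * Coalgebra.comul (R := ℂ) (1 : TYAlg D) =
      ∑ p, ∑ q, (coeff p q b • sourceUnit D (tgt p)) ⊗ₜ[ℂ] f D p q := by
  conv_lhs => rw [eq_sum_coeff b]
  simp only [comul_one_units, TensorProduct.tmul_sum, Finset.sum_mul, Finset.mul_sum,
    Algebra.TensorProduct.tmul_mul_tmul, one_mul, smul_mul_assoc, f_mul_targetUnit]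
  simp [-Fintype.sum_option, TensorProduct.tmul_ite, TensorProduct.smul_tmul, Finset.sum_comm (s := (Finset.univ : Finset (Option G)))]

/-- Applying a dual coordinate functional to the second leg isolates one coefficient, the basis
elements being linearly independent. -/
theorem sum_tmul_f_injective {M : Type v} [AddCommGroup M] [Module ℂ M] (x y : TYVec G → TYVec G → M)
    (h : ∑ p, ∑ q, x p q ⊗ₜ[ℂ] f D p q = ∑ p, ∑ q, y p q ⊗ₜ[ℂ] f D p q) (p q : TYVec G)
    (hpq : p.grade = q.grade) : x p q = y p q := by
  have key : ∀ z : TYVec G → TYVec G → M, TensorProduct.rid ℂ _ (LinearMap.lTensor _ (coeff p q)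
      (∑ p, ∑ q, z p q ⊗ₜ[ℂ] f D p q)) = z p q := by
    intro z
    simp only [map_sum, LinearMap.lTensor_tmul, TensorProduct.rid_tmul]
    have : ∀ p' q', coeff p q (f D p' q') • z p' q' =
        if p' = p then if q' = q then z p q else 0 else 0 := by
      intro p' q'
      by_cases h : p'.grade = q'.grade
      · rw [coeff_f h]
        by_cases h1 : p' = p <;> by_cases h2 : q' = q <;> simp [h1, h2]
      · rw [f_of_ne h, map_zero, zero_smul]
        by_cases h1 : p' = p <;> by_cases h2 : q' = q <;> simp [h1, h2]
        subst h1 h2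
        exact absurd hpq h
    simp only [this, Finset.sum_ite_irrel, Finset.sum_const_zero, Finset.sum_ite_eq', Finset.mem_univ, if_true]
  rw [← key x, h, key y]

end TYAlg
end

/-! ### Fixed points of quantum subgroupoids and the adjoint action. -/

noncomputable section
universe u v

theorem mem_quotientFixed {B : Type u} {C : Type v} [WeakHopfCStarAlgebra B]
    [WeakHopfCStarAlgebra C] {π : B →⋆ₐ[ℂ] C} {b : B} : b ∈ quotientFixed π ↔
    LinearMap.rTensor B π.toAlgHom.toLinearMap (Coalgebra.comul (R := ℂ) b) =
      LinearMap.rTensor B π.toAlgHom.toLinearMap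
        (((1 : B) ⊗ₜ[ℂ] b) * Coalgebra.comul (R := ℂ) (1 : B)) := Iff.rfl

theorem rTensor_algHom_mul {B : Type u} {C : Type v} [Ring B] [Algebra ℂ B] [Ring C] [Algebra ℂ C]
    (π : B →ₐ[ℂ] C) (x y : B ⊗[ℂ] B) : LinearMap.rTensor B π.toLinearMap (x * y) =
      LinearMap.rTensor B π.toLinearMap x * LinearMap.rTensor B π.toLinearMap y :=
  map_mul (Algebra.TensorProduct.map π (AlgHom.id ℂ B)) x y

theorem rTensor_starAlgHom_star {B : Type u} {C : Type v} [WeakHopfCStarAlgebra B]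
    [WeakHopfCStarAlgebra C] (π : B →⋆ₐ[ℂ] C) (t : B ⊗[ℂ] B) :
    LinearMap.rTensor B π.toAlgHom.toLinearMap (star t) =
      star (LinearMap.rTensor B π.toAlgHom.toLinearMap t) := by
  induction t with
  | zero => simp only [map_zero, star_zero]
  | add x y hx hy => simp only [map_add, star_add, hx, hy]
  | tmul x y => simp [TensorProduct.star_tmul, map_star]

theorem one_mem_quotientFixed {B : Type u} {C : Type v} [WeakHopfCStarAlgebra B]
    [WeakHopfCStarAlgebra C] (π : B →⋆ₐ[ℂ] C) : 1 ∈ quotientFixed π := by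
  rw [mem_quotientFixed, ← Algebra.TensorProduct.one_def, one_mul]

/-- Multiplying by a comultiplication absorbs the projection in the definition of the fixed
points. -/
theorem rTensor_comul_mul_of_mem_quotientFixed {B : Type u} {C : Type v} [WeakHopfCStarAlgebra B]
    [WeakHopfCStarAlgebra C] {π : B →⋆ₐ[ℂ] C} {b : B} (hb : b ∈ quotientFixed π) (c : B) :
    LinearMap.rTensor B π.toAlgHom.toLinearMap (Coalgebra.comul (R := ℂ) (b * c)) =
      LinearMap.rTensor B π.toAlgHom.toLinearMap
        (((1 : B) ⊗ₜ[ℂ] b) * Coalgebra.comul (R := ℂ) c) := by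
  rw [WeakHopfCStarAlgebra.comul_mul, rTensor_algHom_mul, mem_quotientFixed.1 hb,
    ← rTensor_algHom_mul, mul_assoc, ← WeakHopfCStarAlgebra.comul_mul, one_mul]

theorem mul_mem_quotientFixed {B : Type u} {C : Type v} [WeakHopfCStarAlgebra B]
    [WeakHopfCStarAlgebra C] {π : B →⋆ₐ[ℂ] C} {b c : B} (hb : b ∈ quotientFixed π)
    (hc : c ∈ quotientFixed π) : b * c ∈ quotientFixed π := by
  rw [mem_quotientFixed, rTensor_comul_mul_of_mem_quotientFixed hb, rTensor_algHom_mul,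
    mem_quotientFixed.1 hc, ← rTensor_algHom_mul, ← mul_assoc,
    Algebra.TensorProduct.tmul_mul_tmul, one_mul]

/-- The adjoint action is a right action. -/
theorem adj_adj {B : Type u} [WeakHopfCStarAlgebra B] (b x y : B) :
    adj (adj b x) y = adj b (x * y) := by
  have key : ∀ s t : B ⊗[ℂ] B,
      LinearMap.mul' ℂ B (TensorProduct.map WeakHopfCStarAlgebra.antipode
        (LinearMap.mulLeft ℂ (LinearMap.mul' ℂ B (TensorProduct.map WeakHopfCStarAlgebra.antipode
          (LinearMap.mulLeft ℂ b) s))) t) =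
      LinearMap.mul' ℂ B (TensorProduct.map WeakHopfCStarAlgebra.antipode
        (LinearMap.mulLeft ℂ b) (s * t)) := by
    intro s t
    induction t with
    | zero => simp only [mul_zero, map_zero]
    | add x y hx hy => simp only [mul_add, map_add, hx, hy]
    | tmul x y =>
      induction s with
      | zero => simp
      | add s s' hs hs' =>
        simp only [TensorProduct.map_tmul, LinearMap.mul'_apply, LinearMap.mulLeft_apply, map_add,
          add_mul, mul_add] at hs hs' ⊢
        rw [hs, hs']
      | tmul u w => simp [WeakHopfCStarAlgebra.antipode_mul, mul_assoc]
  rw [adj, adj, adj, WeakHopfCStarAlgebra.comul_mul]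
  exact key _ _

namespace TYAlg
open TYVec

variable {G : Type u} [AddCommGroup G] [Fintype G] [DecidableEq G] {D : TYDatum G}

theorem adj_f (b : TYAlg D) (p q : TYVec G) :
    adj b (f D p q) = ∑ r, antipode D (f D p r) * (b * f D r q) := by
  rw [adj, comul_f]
  simp only [map_sum, TensorProduct.map_tmul, LinearMap.mul'_apply, LinearMap.mulLeft_apply]
  rfl

/-- The antipode exchanges the two indices of a degree 0 basis element, so both legs of Δ(1) become
the same target projection. Acting by 1 is therefore not the identity but the compression onto the
commutant of the target counital subalgebra; this is the content of demanding I ◁ B = I instead of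
mere stability. -/
theorem adj_one (b : TYAlg D) : adj b 1 = ∑ c, targetUnit D c * b * targetUnit D c := by
  rw [adj, comul_one_eq]
  simp only [map_sum, TensorProduct.map_tmul, LinearMap.mul'_apply, LinearMap.mulLeft_apply,
    targetUnit, Finset.sum_mul, Finset.mul_sum]
  have : ∀ a c, WeakHopfCStarAlgebra.antipode (f D (unitVec a) (unitVec c)) =
    f D (unitVec c) (unitVec a) := antipode_unit
  simp only [this, ← mul_assoc]
  rw [Finset.sum_congr rfl fun a _ => Finset.sum_comm, Finset.sum_comm]
  refine Finset.sum_congr rfl fun _ _ => ?_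
  rw [Finset.sum_comm]

theorem adj_one_eq_sum (b : TYAlg D) :
    adj b 1 = ∑ p, ∑ q, if src p = tgt p then coeff p q b • f D p q else 0 := by
  rw [adj_one]
  conv_lhs => rw [eq_sum_coeff b]
  simp only [Finset.sum_mul, Finset.mul_sum, mul_smul_comm, smul_mul_assoc, targetUnit_mul_f]
  rw [Finset.sum_comm]
  refine Finset.sum_congr rfl fun p _ => ?_
  rw [Finset.sum_comm]
  refine Finset.sum_congr rfl fun q _ => ?_
  simp [-Fintype.sum_option, f_mul_targetUnit, ite_mul, eq_comm]

theorem coeff_adj_one {p q : TYVec G} (h : src p ≠ tgt p) (b : TYAlg D) :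
    coeff p q (adj b 1) = 0 := by
  rw [adj_one_eq_sum]
  simp only [map_sum]
  refine Finset.sum_eq_zero fun p' _ => Finset.sum_eq_zero fun q' _ => ?_
  split_ifs with h'
  · by_cases hg : p'.grade = q'.grade
    · rw [map_smul, coeff_f hg, if_neg, smul_zero]
      rintro ⟨rfl, rfl⟩
      exact h h'
    · rw [f_of_ne hg, smul_zero, map_zero]
  · rw [map_zero]

theorem adj_one_of_coeff {b : TYAlg D} (h : ∀ p q, src p ≠ tgt p → coeff p q b = 0) :
    adj b 1 = b := by
  rw [adj_one_eq_sum]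
  conv_rhs => rw [eq_sum_coeff b]
  refine Finset.sum_congr rfl fun p _ => Finset.sum_congr rfl fun q _ => ?_
  split_ifs with h'
  · rfl
  · rw [h p q h', zero_smul]

theorem targetUnit_mul_of_coeff {b : TYAlg D} (h : ∀ p q, src p ≠ tgt p → coeff p q b = 0)
    (c : Option G) : targetUnit D c * b = b * targetUnit D c := by
  rw [eq_sum_coeff b]
  simp only [Finset.sum_mul, Finset.mul_sum, mul_smul_comm, smul_mul_assoc, targetUnit_mul_f,
    f_mul_targetUnit]
  refine Finset.sum_congr rfl fun p _ => Finset.sum_congr rfl fun q _ => ?_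
  by_cases h' : src p = tgt p
  · rw [h']
  · rw [h p q h', zero_smul, zero_smul]

/-! ### Quotient type coideals are invariant. -/

section
variable {C : Type v} [WeakHopfCStarAlgebra C] {π : TYAlg D →⋆ₐ[ℂ] C}

/-- Comparing the coefficients of `f D p q` in the second leg turns the fixed point equation into
one equation in C for each pair (p, q). -/
theorem mem_quotientFixed_iff {b : TYAlg D} : b ∈ quotientFixed π ↔
    ∀ p q : TYVec G, p.grade = q.grade →
      π (slice q p b) = coeff p q b • π (sourceUnit D (tgt p)) := by
  rw [mem_quotientFixed, comul_eq, mul_comul_one]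
  simp only [map_sum, LinearMap.rTensor_tmul, map_smul]
  constructor
  · intro h p q hpq
    exact sum_tmul_f_injective _ _ h p q hpq
  · intro h
    refine Finset.sum_congr rfl fun p _ => Finset.sum_congr rfl fun q _ => ?_
    by_cases hpq : p.grade = q.grade
    · exact congrArg (· ⊗ₜ[ℂ] f D p q) (h p q hpq)
    · rw [f_of_ne hpq, TensorProduct.tmul_zero, TensorProduct.tmul_zero]

/-- Even when π has a large kernel, the preservation of the counit by π retains enough information
to read this coefficient off. -/
theorem coeff_of_mem_quotientFixed (hπ : IsQuantumSubgroupoid π) {b : TYAlg D}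
    (hb : b ∈ quotientFixed π) (p q : TYVec G) (hp : src p ≠ tgt p) : coeff p q b = 0 := by
  by_cases hpq : p.grade = q.grade
  swap
  · exact coeff_of_ne hpq b
  -- The source projection on the right-hand side commutes with target projections, and those for
  -- `src p` and `tgt p` are orthogonal, so that side vanishes.
  have h := congrArg (fun x => π (targetUnit D (src p)) * x * π (targetUnit D (tgt p)))
    (mem_quotientFixed_iff.1 hb p q hpq)
  simp only [mul_smul_comm, smul_mul_assoc, ← map_mul] at h
  rw [mul_assoc (targetUnit D (src p)) (sourceUnit D (tgt p)), sourceUnit_mul_targetUnit,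
    ← mul_assoc, targetUnit_mul_targetUnit, if_neg hp, zero_mul, map_zero, smul_zero] at h
  -- In the compressed slice, whose second index is p, the counit keeps only the first index p,
  -- leaving `coeff p q b`.
  have h2 := congrArg (Coalgebra.counit (R := ℂ)) h
  rw [hπ.counit_comp, slice_eq q p, map_zero] at h2
  rw [← h2]
  simp only [Finset.sum_mul, Finset.mul_sum, mul_smul_comm, smul_mul_assoc, targetUnit_mul_f,
    map_sum, map_smul]
  rw [Finset.sum_eq_single p]
  · simp [f_mul_targetUnit, counit_f]
  · intro p' _ hp'
    by_cases h1 : src p' = src p <;> by_cases h2 : tgt p' = tgt p <;>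
      simp [h1, h2, f_mul_targetUnit, counit_f, hp']
  · simp

/-- A slice of a slice is a slice or zero, so the equations for `slice q r b` are among those for b
or trivial. -/
theorem slice_mem_quotientFixed {b : TYAlg D} (hb : b ∈ quotientFixed π) (q r : TYVec G)
    (hqr : q.grade = r.grade) : slice q r b ∈ quotientFixed π := by
  rw [mem_quotientFixed_iff] at hb ⊢
  intro p q' hpq
  rw [coeff_slice hqr]
  by_cases h : q' = r
  · subst h
    rw [if_pos rfl, slice_slice hqr, hb p q (hpq.trans hqr.symm)]
  · rw [if_neg h, slice_slice_of_ne hqr h, map_zero, zero_smul]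

theorem star_mem_quotientFixed (hπ : IsQuantumSubgroupoid π) {b : TYAlg D}
    (hb : b ∈ quotientFixed π) : star b ∈ quotientFixed π := by
  -- The adjoint of the defining equation has Δ(1) on the wrong side. By the support condition b
  -- commutes with the target projections, which allows swapping.
  have h1 : Coalgebra.comul (R := ℂ) (1 : TYAlg D) * ((1 : TYAlg D) ⊗ₜ[ℂ] b) =
      ((1 : TYAlg D) ⊗ₜ[ℂ] b) * Coalgebra.comul (R := ℂ) (1 : TYAlg D) := by
    rw [comul_one_units]
    simp only [Finset.sum_mul, Finset.mul_sum, Algebra.TensorProduct.tmul_mul_tmul, one_mul, mul_one,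
      targetUnit_mul_of_coeff (coeff_of_mem_quotientFixed hπ hb)]
  have h2 : star (Coalgebra.comul (R := ℂ) (1 : TYAlg D)) = Coalgebra.comul (R := ℂ) 1 := by
    rw [← comul_star, star_one]
  have h3 : star ((1 : TYAlg D) ⊗ₜ[ℂ] b) = (1 : TYAlg D) ⊗ₜ[ℂ] star b := by
    rw [TensorProduct.star_tmul, star_one]
  have h4 : Coalgebra.comul (R := ℂ) (star b) = star (Coalgebra.comul (R := ℂ) b) := comul_star b
  have h5 := congrArg star (mem_quotientFixed.1 hb)
  rw [← h1, ← rTensor_starAlgHom_star, ← rTensor_starAlgHom_star, star_mul, h2, h3] at h5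
  rw [mem_quotientFixed, h4]
  exact h5

theorem adj_mem_quotientFixed {b : TYAlg D} (hb : b ∈ quotientFixed π) (x : TYAlg D) :
    adj b x ∈ quotientFixed π := by
  induction x using TYAlg.induction with
  | h0 => rw [adj, map_zero, map_zero, map_zero]; exact Submodule.zero_mem _
  | hadd x y hx hy => rw [adj, map_add, map_add, map_add]; exact Submodule.add_mem _ hx hy
  | hsmul c x hx => rw [adj, map_smul, map_smul, map_smul]; exact Submodule.smul_mem _ c hx
  | hf p q h =>
    have hS : ∀ r, Coalgebra.comul (R := ℂ) (antipode D (f D p r)) =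
        ∑ s, antipode D (f D s r) ⊗ₜ[ℂ] antipode D (f D p s) := by
      intro r
      rw [comul_antipode, comul_f]
      simp
    have hsum : ∀ s t : TYVec G, s.grade = t.grade →
        ∑ r, antipode D (f D s r) * f D r t = if s = t then sourceUnit D (tgt s) else 0 := by
      intro s t hst
      have := antipode_mul_self_f (D := D) hst
      rw [comul_f] at this
      simpa [sourceUnit] using this
    rw [mem_quotientFixed, adj_f]
    -- Under π in the first leg, Δ(b x) may be replaced by (1 ⊗ b)Δ(x). The first leg then no longer
    -- contains b, and collects into S(x₁)x₂.
    have h1 : LinearMap.rTensor (TYAlg D) π.toAlgHom.toLinearMap (Coalgebra.comul (R := ℂ)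
        (∑ r, antipode D (f D p r) * (b * f D r q))) =
        LinearMap.rTensor (TYAlg D) π.toAlgHom.toLinearMap
          (∑ s, ∑ t, (∑ r, antipode D (f D s r) * f D r t) ⊗ₜ[ℂ]
            (antipode D (f D p s) * (b * f D t q))) := by
      have : ∀ r, LinearMap.rTensor (TYAlg D) π.toAlgHom.toLinearMap (Coalgebra.comul (R := ℂ)
          (antipode D (f D p r) * (b * f D r q))) =
          LinearMap.rTensor (TYAlg D) π.toAlgHom.toLinearMap
            (Coalgebra.comul (R := ℂ) (antipode D (f D p r)) *
              (((1 : TYAlg D) ⊗ₜ[ℂ] b) * Coalgebra.comul (R := ℂ) (f D r q))) := by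
        intro r
        have := rTensor_comul_mul_of_mem_quotientFixed hb (f D r q)
        rw [rTensor_algHom_mul, ← this, ← rTensor_algHom_mul, ← comul_mul]
      rw [map_sum, map_sum]
      simp only [this]
      rw [← map_sum]
      congr 1
      simp only [hS, comul_f, Finset.sum_mul, Finset.mul_sum, Algebra.TensorProduct.tmul_mul_tmul,
        one_mul, TensorProduct.sum_tmul]
      rw [Finset.sum_comm]
      refine (Finset.sum_congr rfl fun s _ => Finset.sum_comm).trans ?_
      rw [Finset.sum_comm]
    rw [h1]
    congr 1
    have h2 : ∀ s t : TYVec G, (∑ r, antipode D (f D s r) * f D r t) ⊗ₜ[ℂ]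
        (antipode D (f D p s) * (b * f D t q)) =
        if s = t then sourceUnit D (tgt s) ⊗ₜ[ℂ] (antipode D (f D p s) * (b * f D t q)) else 0 := by
      intro s t
      by_cases hst : s.grade = t.grade
      · rw [hsum s t hst]
        split_ifs
        · rfl
        · rw [TensorProduct.zero_tmul]
      -- For mismatched grades one of the two basis elements in the second leg is 0 by convention.
      · rw [if_neg (fun e => hst (congrArg _ e))]
        by_cases hps : p.grade = s.grade
        · rw [f_of_ne (p := t) (fun e => hst (hps.symm.trans (h.trans e.symm))), mul_zero, mul_zero,
            TensorProduct.tmul_zero]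
        · rw [f_of_ne hps, map_zero, zero_mul, TensorProduct.tmul_zero]
    simp only [h2, Finset.sum_ite_eq, Finset.mem_univ, if_true]
    rw [comul_one_units, TensorProduct.tmul_sum, Finset.sum_mul]
    refine Finset.sum_congr rfl fun s _ => ?_
    simp only [Finset.mul_sum, Algebra.TensorProduct.tmul_mul_tmul, one_mul, mul_assoc,
      f_mul_targetUnit]
    rw [Finset.sum_eq_single (tgt s)]
    · rw [if_pos rfl]
    · intro c _ hc
      rw [if_neg hc.symm, mul_zero, mul_zero, TensorProduct.tmul_zero]
    · simp

theorem quotientFixed_mem_invariantCoideals (hπ : IsQuantumSubgroupoid π) :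
    quotientFixed π ∈ invariantCoideals (TYAlg D) := by
  refine ⟨⟨one_mem_quotientFixed π, fun b hb c hc => mul_mem_quotientFixed hb hc,
    fun b hb => star_mem_quotientFixed hπ hb,
    (comul_mem_iff _).2 fun b hb q r h => slice_mem_quotientFixed hb q r h⟩, ?_⟩
  apply le_antisymm
  · rw [Submodule.span_le]
    rintro _ ⟨b, hb, x, rfl⟩
    exact adj_mem_quotientFixed hb x
  -- The reverse inclusion needs only x = 1: by the support condition the compression b ◁ 1 does
  -- nothing to b.
  · intro b hb
    exact Submodule.subset_span
      ⟨b, hb, 1, (adj_one_of_coeff (coeff_of_mem_quotientFixed hπ hb)).symm⟩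

end

theorem quotientTypeCoideals_subset :
    quotientTypeCoideals (TYAlg D) ⊆ invariantCoideals (TYAlg D) := by
  rintro _ ⟨C, _, π, hπ, rfl⟩
  exact quotientFixed_mem_invariantCoideals hπ

end TYAlg
end

/-! ### Functions on Ω and the adjoint action on them. -/

noncomputable section
universe u v

open Classical in
/-- A unital algebra of functions on a finite set contains the indicator functions of the classes
of points that it does not separate. -/
theorem indicator_mem_of_mul_mem {ι : Type u} [Fintype ι] {A : Submodule ℂ (ι → ℂ)}
    (h1 : (1 : ι → ℂ) ∈ A) (hmul : ∀ φ ∈ A, ∀ ψ ∈ A, φ * ψ ∈ A) (a : ι) :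
    (fun b => if ∀ φ ∈ A, φ b = φ a then (1 : ℂ) else 0) ∈ A := by
  -- Each point b separated from a gets a normalised linear factor that is 1 at a and 0 at b; other
  -- points get the constant 1. The product of all factors is the indicator.
  have key : ∀ b, ∃ ψ ∈ A, ψ a = 1 ∧ ((∃ φ ∈ A, φ b ≠ φ a) → ψ b = 0) := by
    intro b
    by_cases hb : ∃ φ ∈ A, φ b ≠ φ a
    · obtain ⟨φ, hφ, hne⟩ := hb
      have hne' : φ a - φ b ≠ 0 := sub_ne_zero.2 hne.symm
      refine ⟨(φ a - φ b)⁻¹ • (φ - φ b • 1), A.smul_mem _ (A.sub_mem hφ (A.smul_mem _ h1)), ?_, ?_⟩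
      · simp [hne']
      · simp
    · exact ⟨1, h1, rfl, fun h => absurd h hb⟩
  choose ψ hψ hψa hψb using key
  let S : Submonoid (ι → ℂ) :=
    { carrier := A, one_mem' := h1, mul_mem' := fun {x y} hx hy => hmul x hx y hy }
  have hprod : ∏ b, ψ b ∈ A := S.prod_mem fun b _ => hψ b
  convert hprod using 1
  funext c
  rw [Finset.prod_apply]
  split_ifs with hc
  -- At a point not separated from a, every factor takes its value at a, namely 1.
  · rw [Finset.prod_congr rfl fun b _ => (hc (ψ b) (hψ b)).trans (hψa b), Finset.prod_const_one]
  · push Not at hc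
    exact (Finset.prod_eq_zero (f := fun b => ψ b c) (Finset.mem_univ c) (hψb c hc)).symm

namespace TYAlg
open TYVec

variable {G : Type u} [AddCommGroup G] [Fintype G] [DecidableEq G] {D : TYDatum G}

variable (D) in
/-- The element `(∑ φ(a) v^0_a) ⊗ conj(v^0_c)` attached to a function `φ` on `Ω`. -/
def funElt (c : Option G) : (Option G → ℂ) →ₗ[ℂ] TYAlg D :=
  Fintype.linearCombination ℂ fun a => f D (unitVec a) (unitVec c)

theorem funElt_apply (φ : Option G → ℂ) (c : Option G) :
    funElt D c φ = ∑ a, φ a • f D (unitVec a) (unitVec c) := rfl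

theorem slice_funElt (φ : Option G → ℂ) (c d : Option G) :
    slice (unitVec c) (unitVec d) (funElt D c φ) = funElt D d φ := by
  simp only [funElt_apply, map_sum, map_smul,
    slice_f ((grade_unitVec _).trans (grade_unitVec _).symm), if_true]

theorem slice_unitVec (b : TYAlg D) (c : Option G) :
    slice (unitVec c) (unitVec c) b = funElt D c (fun a => coeff (unitVec a) (unitVec c) b) := by
  rw [slice_eq, funElt_apply, sum_unitVec]
  intro p hp
  rw [f_of_ne (by rw [grade_unitVec]; exact hp), smul_zero]

theorem funElt_mul_f (φ : Option G → ℂ) (c : Option G) (p q : TYVec G) :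
    funElt D c φ * f D p q = if src q = c then φ (src p) • f D p q else 0 := by
  simp only [funElt_apply, Finset.sum_mul, smul_mul_assoc, unit_mul_f]
  by_cases h : src q = c <;> simp [h, -Fintype.sum_option]

theorem funElt_mul_funElt (φ ψ : Option G → ℂ) (c : Option G) :
    funElt D c φ * funElt D c ψ = funElt D c (φ * ψ) := by
  rw [funElt_apply ψ, funElt_apply (φ * ψ), Finset.mul_sum]
  refine Finset.sum_congr rfl fun a _ => ?_
  rw [mul_smul_comm, funElt_mul_f, src_unitVec, if_pos rfl, src_unitVec, smul_smul, mul_comm,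
    Pi.mul_apply]

theorem adj_funElt (φ : Option G → ℂ) (p q : TYVec G) :
    adj (funElt D (src q) φ) (f D p q) =
      ∑ r, φ (src r) • (antipode D (f D p r) * f D r q) := by
  rw [adj_f]
  refine Finset.sum_congr rfl fun r _ => ?_
  rw [funElt_mul_f, if_pos rfl, mul_smul_comm]

omit [AddCommGroup G] in
theorem sum_of_grade {M : Type v} [AddCommMonoid M] (x : Option G) (F : TYVec G → M)
    (hF : ∀ r, x ≠ r.grade → F r = 0) :
    ∑ r, F r = ∑ r, if x = r.grade then F r else 0 := by
  refine Finset.sum_congr rfl fun r _ => ?_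
  split_ifs with h
  · rfl
  · exact hF r h

/-- Tensoring with an invertible object permutes Ω: it translates G and fixes m. Hence the algebra
attached to an invariant coideal is translation invariant. -/
theorem adj_funElt_translate (φ : Option G → ℂ) (h : G) :
    adj (funElt D (some 0) φ) (f D (gh h h) (gh h h)) =
      funElt D (some h) (fun a => φ (a.map (· - h))) := by
  have h0 : (some 0 : Option G) = src (gh h h) := by simp [src]
  rw [h0, adj_funElt, sum_of_grade (some h), sum_grade_some]
  · rw [funElt_apply, Fintype.sum_option, add_comm]
    congr 1
    · rw [antipode_f (by rfl), smul_mul_assoc, f_mul_f _ _ _ _ (by rfl) (by rfl)]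
      simp [sigma, hat, src, TYDatum.comp, outer_single, unitVec]
    · refine Finset.sum_congr rfl fun x _ => ?_
      rw [antipode_f (by rfl), smul_mul_assoc, f_mul_f _ _ _ _ (by rfl) (by rfl)]
      simp [sigma, hat, src, TYDatum.comp, outer_single, unitVec]
  · intro r hr
    rw [f_of_ne (p := gh h h) (q := r) hr, map_zero, zero_mul, smul_zero]

theorem sum_smul_f_gm_gm (c : G → G → ℂ) :
    ∑ g, ∑ h, c g h • f D (gm g) (gm h) = ∑ g, c g g • f D (gm g) (gm g) := by
  refine Finset.sum_congr rfl fun g _ => Finset.sum_eq_single g (fun h _ hg => ?_) (by simp)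
  rw [f_of_ne (by simpa [TYVec.grade] using hg.symm), smul_zero]

/-- Acting in degree m performs the Fourier transform: on v^g_m ⊗ conj(v^g_m) the coefficient is τ²
∑_k φ(k) χ(g,k)⁻¹. The value at m only contributes in degree 0. -/
theorem adj_funElt_dual (φ : Option G → ℂ) :
    adj (funElt D (some 0) φ) (f D (mg 0) (mg 0)) =
      (∑ k, φ (some k) • ∑ g, ((D.tau : ℂ) * D.tau * (D.chi g k : ℂ)⁻¹) • f D (gm g) (gm g)) +
        φ none • ∑ k, f D (gh 0 k) (gm 0) := by
  have ht := tau_ne D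
  have h0 : (some 0 : Option G) = src (mg 0) := by simp [src]
  rw [h0, adj_funElt, sum_of_grade none, sum_grade_none]
  · congr 1
    · refine Finset.sum_congr rfl fun x _ => ?_
      rw [antipode_f (by rfl), smul_mul_assoc, f_mul_f _ _ _ _ (by rfl) (by rfl)]
      simp only [sigma, hat, src, TYDatum.comp, if_true, map_sum, LinearMap.sum_apply,
        outer_single, div_one, one_smul]
      rw [Finset.sum_comm, sum_smul_f_gm_gm]
      simp [chi_zero_right, mul_right_comm]
    · rw [Finset.smul_sum]
      refine Finset.sum_congr rfl fun x _ => ?_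
      rw [antipode_f (by rfl), smul_mul_assoc, f_mul_f _ _ _ _ (by rfl) (by rfl)]
      -- The second factor is a sum over all g, but the first lies in H^0, so only g = 0 survives.
      have hne : ∀ g : G, g ≠ 0 → f D (gh 0 x) (gm g) = 0 := fun g hg =>
        f_of_ne (by simpa [TYVec.grade, eq_comm] using hg)
      simp only [sigma, hat, src, TYDatum.comp, if_true, map_sum,
        outer_single, sub_self]
      rw [Finset.sum_eq_single 0]
      · simp only [chi_zero_right, Circle.coe_one, inv_one, mul_one, one_mul, Complex.conj_ofReal,
          smul_smul, one_div, inv_mul_cancel₀ ht]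
      · intro g _ hg
        rw [hne g hg, smul_zero]
      · simp
  · intro r hr
    rw [f_of_ne (p := mg 0) (q := r) hr, map_zero, zero_mul, smul_zero]

/-- The passage opposite to the Fourier transform: v^g_m becomes its character on G. Its value 0 at
m later excludes g ≠ 0 from I^Ω. -/
theorem adj_gm (g : G) :
    adj (f D (gm g) (gm g)) (f D (mbar 0) (mbar 0)) =
      funElt D (some 0) (fun a => a.elim 0 fun k => (D.chi g k : ℂ)) := by
  have ht := tau_ne D
  rw [adj_f, sum_of_grade none, sum_grade_none, funElt_apply, Fintype.sum_option]
  · congr 1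
    · rw [Finset.sum_eq_zero]
      · simp
      · intro x _
        rw [← mul_assoc, antipode_f (by rfl), smul_mul_assoc, f_mul_f _ _ _ _ (by rfl) (by rfl)]
        simp [hat, TYDatum.comp]
    · refine Finset.sum_congr rfl fun x _ => ?_
      rw [← mul_assoc, antipode_f (by rfl), smul_mul_assoc, f_mul_f _ _ _ _ (by rfl) (by rfl)]
      simp only [hat, TYDatum.comp, outer_single, smul_mul_assoc]
      rw [f_mul_f _ _ _ _ (by rfl) (by rfl)]
      simp [sigma, TYDatum.comp, outer_single, unitVec, ht, chi_zero_right]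
  · intro r hr
    rw [f_of_ne (p := mbar 0) (q := r) hr, map_zero, zero_mul]

/-! ### The support of an invariant coideal. -/

section
variable {I : Submodule ℂ (TYAlg D)} (hI : I ∈ invariantCoideals (TYAlg D))
include hI

theorem adj_mem_of_invariant {b : TYAlg D} (hb : b ∈ I) (x : TYAlg D) : adj b x ∈ I := by
  have := Submodule.subset_span (R := ℂ) (s := {c | ∃ a ∈ I, ∃ x : TYAlg D, c = adj a x})
    ⟨b, hb, x, rfl⟩
  rwa [hI.2] at this

theorem slice_mem_of_invariant {b : TYAlg D} (hb : b ∈ I) {q r : TYVec G}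
    (h : q.grade = r.grade) : slice q r b ∈ I :=
  (comul_mem_iff I).1 hI.1.comul_mem b hb q r h

theorem coeff_of_mem_invariant {b : TYAlg D} (hb : b ∈ I) (p q : TYVec G) (h : src p ≠ tgt p) :
    coeff p q b = 0 := by
  have hle : I ≤ LinearMap.ker (coeff p q : TYAlg D →ₗ[ℂ] ℂ) := by
    conv_lhs => rw [← hI.2]
    rw [Submodule.span_le]
    rintro _ ⟨a, _, x, rfl⟩
    -- As a ◁ x = (a ◁ x) ◁ 1, every generator of I is a compression by the target projections.
    rw [← mul_one x, ← adj_adj]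
    exact coeff_adj_one h _
  exact hle hb

/-- The second index is moved freely by slices, so one space of functions on Ω serves for all c. -/
theorem funElt_mem_iff (φ : Option G → ℂ) (c d : Option G) :
    funElt D c φ ∈ I ↔ funElt D d φ ∈ I := by
  constructor <;> intro h
  · rw [← slice_funElt φ c d]
    exact slice_mem_of_invariant hI h ((grade_unitVec _).trans (grade_unitVec _).symm)
  · rw [← slice_funElt φ d c]
    exact slice_mem_of_invariant hI h ((grade_unitVec _).trans (grade_unitVec _).symm)

/-- For g ≠ 0 the vector v^g_h runs from h - g to h, two different ends; only v^g_m has equal ends.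
-/
theorem slice_some_of_mem {b : TYAlg D} (hb : b ∈ I) {g : G} (hg : g ≠ 0) {q : TYVec G}
    (hq : q.grade = some g) : slice q q b = coeff (gm g) q b • f D (gm g) q := by
  rw [slice_eq q q, Finset.sum_eq_single (gm g)]
  · intro p _ hp
    by_cases hpq : p.grade = q.grade
    · rw [coeff_of_mem_invariant hI hb, zero_smul]
      rw [hq] at hpq
      cases p <;> simp_all [TYVec.grade, src, tgt]
    · rw [f_of_ne hpq, smul_zero]
  · simp

/-- Every vector of H^m has one end in G and the other at m. -/
theorem slice_none_of_mem {b : TYAlg D} (hb : b ∈ I) {q : TYVec G}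
    (hq : q.grade = none) : slice q q b = 0 := by
  rw [slice_eq q q]
  refine Finset.sum_eq_zero fun p _ => ?_
  by_cases hpq : p.grade = q.grade
  · rw [coeff_of_mem_invariant hI hb, zero_smul]
    rw [hq] at hpq
    cases p <;> simp_all [TYVec.grade, src, tgt]
  · rw [f_of_ne hpq, smul_zero]

/-- An invariant coideal is contained in any subspace that contains its elements of the form
`v ⊗ conj(v^0_c)` and `v^g_m ⊗ conj(q)` with `g ≠ 0`. -/
theorem le_of_invariant {J : Submodule ℂ (TYAlg D)}
    (h0 : ∀ c φ, funElt D c φ ∈ I → funElt D c φ ∈ J)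
    (hg : ∀ (g : G) (q : TYVec G), g ≠ 0 → q.grade = some g → f D (gm g) q ∈ I →
      f D (gm g) q ∈ J) : I ≤ J := by
  intro b hb
  rw [eq_sum_slice b]
  refine Submodule.sum_mem _ fun q _ => ?_
  have hmem := slice_mem_of_invariant hI hb (q := q) rfl
  rcases hq : q.grade with _ | g
  · rw [slice_none_of_mem hI hb hq]
    exact J.zero_mem
  · by_cases h : g = 0
    · subst h
      obtain ⟨c, rfl⟩ := exists_unitVec hq
      rw [slice_unitVec] at hmem ⊢
      exact h0 _ _ hmem
    · rw [slice_some_of_mem hI hb h hq] at hmem ⊢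
      by_cases hz : coeff (gm g) q b = 0
      · rw [hz, zero_smul]
        exact J.zero_mem
      · exact J.smul_mem _ (hg g q h hq ((I.smul_mem_iff hz).1 hmem))

end

end TYAlg
end

/-! ### The coideals I^x: separation and classification. -/

noncomputable section
universe u v

namespace TYAlg
open TYVec

variable {G : Type u} [AddCommGroup G] [Fintype G] [DecidableEq G] {D : TYDatum G}

open Classical in
/-- The indicator function of the coset `g + L` in `Ω`. -/
def cosetInd (L : AddSubgroup G) (g : G) : Option G → ℂ :=
  fun a => a.elim 0 fun k => if k - g ∈ L then 1 else 0

theorem funElt_cosetInd (L : AddSubgroup G) [DecidablePred (· ∈ L)] (g : G) (b : Option G) :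
    funElt D b (cosetInd L g) =
      ∑ h ∈ Finset.univ.filter (fun h : G => h ∈ L), f D (gh 0 (g + h)) (unitVec b) := by
  rw [funElt_apply, Fintype.sum_option, Finset.sum_filter, ← Equiv.sum_comp (Equiv.addLeft g)]
  simp [cosetInd, unitVec]

theorem coideal_some (L : AddSubgroup G) : coideal D (some L) = Submodule.span ℂ
    ({c | ∃ (g : G) (b : Option G), c = funElt D b (cosetInd L g)} ∪
      {c | ∃ l ∈ orthogonal D L, ∃ q : TYVec G, q.grade = some l ∧ c = f D (gm l) q}) := by
  classical
  rw [coideal]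
  congr! 8 with c g b
  rw [funElt_cosetInd]

theorem coideal_none : coideal D none =
    Submodule.span ℂ (Set.range fun b : Option G => funElt D b 1) := by
  rw [coideal]
  congr! 3 with b
  simp [funElt_apply]

theorem funElt_cosetInd_mem (L : AddSubgroup G) (g : G) (b : Option G) :
    funElt D b (cosetInd L g) ∈ coideal D (some L) := by
  rw [coideal_some]
  exact Submodule.subset_span (Or.inl ⟨g, b, rfl⟩)

theorem gm_mem_coideal {L : AddSubgroup G} {l : G} (hl : l ∈ orthogonal D L) {q : TYVec G}
    (hq : q.grade = some l) : f D (gm l) q ∈ coideal D (some L) := by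
  rw [coideal_some]
  exact Submodule.subset_span (Or.inr ⟨l, hl, q, hq, rfl⟩)

theorem zero_mem_orthogonal (L : AddSubgroup G) : 0 ∈ orthogonal D L :=
  fun h _ => chi_zero_left D h

theorem coeff_funElt (φ : Option G → ℂ) (a b c : Option G) :
    coeff (unitVec a) (unitVec c) (funElt D b φ) = if c = b then φ a else 0 := by
  rw [funElt_apply]
  simp only [map_sum, map_smul, coeff_f ((grade_unitVec _).trans (grade_unitVec _).symm),
    unitVec_injective.eq_iff, ite_and, smul_eq_mul, mul_ite, mul_one, mul_zero,
    Finset.sum_ite_eq', Finset.mem_univ, if_true, eq_comm (a := b)]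

/-- A linear functional detecting L: the degree 0 part of I^L consists of L-periodic functions on G,
which agree at h and 0. -/
theorem coideal_some_le_ker {L : AddSubgroup G} {h : G} (hh : h ∈ L) : coideal D (some L) ≤
    LinearMap.ker (coeff (gh 0 h) (gh 0 0) - coeff (gh 0 0) (gh 0 0) : TYAlg D →ₗ[ℂ] ℂ) := by
  rw [coideal_some, Submodule.span_le]
  rintro _ (⟨g, b, rfl⟩ | ⟨l, _, q, hq, rfl⟩)
  · have h1 := fun k => coeff_funElt (D := D) (cosetInd L g) (some k) b (some 0)
    simp only [unitVec, Option.elim] at h1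
    have h2 : h - g ∈ L ↔ 0 - g ∈ L := by
      rw [show h - g = h + (0 - g) by abel, L.add_mem_cancel_left hh]
    have h3 : cosetInd L g (some h) = cosetInd L g (some 0) := by
      classical exact if_congr h2 rfl rfl
    simp only [SetLike.mem_coe, LinearMap.mem_ker, LinearMap.sub_apply, h1, h3, sub_self]
  · simp [coeff_f (D := D) (p := gm l) (q := q) hq.symm]

/-- Functions belonging to I^Ω are constant on Ω, hence agree at m and 0; the element v^0_m ⊗
conj(v^0_m) of every I^L violates this. -/
theorem coideal_none_le_ker : coideal D none ≤
    LinearMap.ker (coeff (gm 0) (gm 0) - coeff (gh 0 0) (gm 0) : TYAlg D →ₗ[ℂ] ℂ) := by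
  rw [coideal_none, Submodule.span_le]
  rintro _ ⟨b, rfl⟩
  have h1 := fun a => coeff_funElt (D := D) 1 a b none
  have h2 := h1 none
  have h3 := h1 (some 0)
  simp only [unitVec, Option.elim] at h2 h3
  simp only [SetLike.mem_coe, LinearMap.mem_ker, LinearMap.sub_apply, h2, h3, Pi.one_apply,
    sub_self]

/-- The indicator of L would be L'-periodic; being 1 at 0, it is 1 on all of L'. -/
theorem le_of_coideal_le {L L' : AddSubgroup G}
    (h : coideal D (some L) ≤ coideal D (some L')) : L' ≤ L := by
  intro k hk
  have h1 := coideal_some_le_ker hk (h (funElt_cosetInd_mem L 0 (some 0)))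
  have h2 := fun k => coeff_funElt (D := D) (cosetInd L 0) (some k) (some 0) (some 0)
  simp only [unitVec, Option.elim] at h2
  by_contra hkL
  simp [h2, cosetInd, hkL, L.zero_mem] at h1

theorem not_coideal_some_le_none (L : AddSubgroup G) :
    ¬ coideal D (some L) ≤ coideal D none := by
  intro h
  have h1 := coideal_none_le_ker
    (h (gm_mem_coideal (zero_mem_orthogonal (D := D) L) (q := gm 0) rfl))
  have h2 := fun p : TYVec G => coeff_f (D := D) (p := gm 0) (q := gm 0) rfl p (gm 0)
  simp [h2] at h1

theorem coideal_injective : Function.Injective (coideal D) := by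
  rintro (_ | L) (_ | L') h
  · rfl
  · exact absurd h.ge (not_coideal_some_le_none L')
  · exact absurd h.le (not_coideal_some_le_none L)
  · rw [le_antisymm (le_of_coideal_le h.ge) (le_of_coideal_le h.le)]

/-- Summing over all k ∈ G instead of over coset representatives counts each coset |L| times, whence
the factor 1/|L|. -/
theorem eq_sum_cosetInd {L : AddSubgroup G} {φ : Option G → ℂ}
    (hφ : ∀ k, ∀ h ∈ L, φ (some (k + h)) = φ (some k)) :
    φ = Pi.single none (φ none) + (Nat.card L : ℂ)⁻¹ • ∑ k, φ (some k) • cosetInd L k := by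
  classical
  have hc : (Nat.card L : ℂ) ≠ 0 := by exact_mod_cast Nat.card_pos.ne'
  funext a
  cases a with
  | none => simp [cosetInd]
  | some j =>
    have h1 : ∀ k, φ (some k) * cosetInd L k (some j) = if j - k ∈ L then φ (some j) else 0 := by
      intro k
      by_cases h : j - k ∈ L
      · have := hφ k _ h
        rw [add_sub_cancel] at this
        simp [cosetInd, h, this]
      · simp [cosetInd, h]
    simp only [Pi.add_apply, Pi.smul_apply, Finset.sum_apply, smul_eq_mul, h1]
    rw [← (Equiv.subLeft j).sum_comp]
    simp only [Equiv.subLeft_apply, sub_sub_cancel]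
    rw [← Finset.sum_filter, Finset.sum_const, nsmul_eq_mul]
    have h2 : (Finset.univ.filter (fun x => x ∈ L)).card = Nat.card L := by
      rw [Nat.card_eq_fintype_card, Fintype.card_subtype]
    rw [h2, inv_mul_cancel_left₀ hc]
    simp

/-- Every invariant coideal is one of the coideals `I^x`. -/
theorem exists_eq_coideal {I : Submodule ℂ (TYAlg D)} (hI : I ∈ invariantCoideals (TYAlg D)) :
    ∃ x, I = coideal D x := by
  classical
  -- The degree 0 part of I as a space of functions on Ω; the choice of second index v^0_0 does not
  -- matter by `hA`.
  let A : Submodule ℂ (Option G → ℂ) := I.comap (funElt D (some 0))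
  have hA : ∀ {φ} (c : Option G), funElt D c φ ∈ I ↔ φ ∈ A := fun c => funElt_mem_iff hI _ _ _
  have h1 : (1 : Option G → ℂ) ∈ A := by
    have := slice_mem_of_invariant hI hI.1.one_mem (q := unitVec (some 0)) (r := unitVec (some 0)) rfl
    rw [slice_one] at this
    rw [← hA (some 0), funElt_apply]
    simp only [Pi.one_apply, one_smul]
    exact this
  have hmul : ∀ φ ∈ A, ∀ ψ ∈ A, φ * ψ ∈ A := by
    intro φ hφ ψ hψ
    rw [← hA (some 0)] at *
    rw [← funElt_mul_funElt]
    exact hI.1.mul_mem _ hφ _ hψ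
  have htr : ∀ φ ∈ A, ∀ h : G, (fun a => φ (a.map (· - h))) ∈ A := by
    intro φ hφ h
    rw [← hA (some h), ← adj_funElt_translate]
    exact adj_mem_of_invariant hI hφ _
  have hgm : ∀ (g : G) (q : TYVec G), q.grade = some g → f D (gm g) q ∈ I →
      (fun a => a.elim 0 fun k => (D.chi g k : ℂ)) ∈ A := by
    intro g q hq h
    have h2 := slice_mem_of_invariant hI h (q := q) (r := gm g) hq
    rw [slice_f (p := gm g) hq.symm, if_pos rfl] at h2
    rw [← hA (some 0), ← adj_gm]
    exact adj_mem_of_invariant hI h2 _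
  -- The dichotomy between I^L and I^Ω: whether A separates m from G.
  by_cases hm : (Pi.single none 1 : Option G → ℂ) ∈ A
  -- The elements that A does not separate from 0. Translation invariance makes them a subgroup and
  -- makes A periodic under it.
  · let L : AddSubgroup G :=
      { carrier := {h | ∀ φ ∈ A, φ (some h) = φ (some 0)}
        zero_mem' := fun φ _ => rfl
        add_mem' := by
          intro h k hh hk φ hφ
          have := hh _ (htr φ hφ (-k))
          simp only [Option.map_some, sub_neg_eq_add, zero_add] at this
          rw [this, hk φ hφ]
        neg_mem' := by
          intro h hh φ hφ
          have := hh _ (htr φ hφ h)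
          simp only [Option.map_some, sub_self, zero_sub] at this
          exact this.symm }
    have hper : ∀ φ ∈ A, ∀ k, ∀ h ∈ L, φ (some (k + h)) = φ (some k) := by
      intro φ hφ k h hh
      have := hh _ (htr φ hφ (-k))
      simp only [Option.map_some, sub_neg_eq_add, zero_add] at this
      rw [add_comm k h, this]
    -- The class of g is exactly g + L: the indicator of m keeps m out of it, and translating g to 0
    -- identifies the rest.
    have hcoset : ∀ g, cosetInd L g ∈ A := by
      intro g
      convert indicator_mem_of_mul_mem h1 hmul (some g) using 1
      funext a
      cases a with
      | none =>
        rw [if_neg]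
        · rfl
        · intro h
          have := h _ hm
          simp at this
      | some k =>
        have : k - g ∈ L ↔ ∀ φ ∈ A, φ (some k) = φ (some g) := by
          constructor
          · intro h φ hφ
            rw [← hper φ hφ g _ h, add_sub_cancel]
          · intro h φ hφ
            have := h _ (htr φ hφ g)
            simpa using this
        simp only [cosetInd, Option.elim, this]
    have hgm0 : f D (gm 0) (gm 0) ∈ I := by
      have := (hA none).2 hm
      rw [funElt_apply, Fintype.sum_option] at this
      simpa [unitVec] using this
    refine ⟨some L, le_antisymm (le_of_invariant hI ?_ ?_) ?_⟩
    · intro c φ hφ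
      rw [hA] at hφ
      rw [eq_sum_cosetInd (hper φ hφ)]
      simp only [map_add, map_smul, map_sum]
      refine Submodule.add_mem _ ?_ (Submodule.smul_mem _ _ (Submodule.sum_mem _ fun k _ =>
        Submodule.smul_mem _ _ (funElt_cosetInd_mem L k c)))
      have : funElt D c (Pi.single none (φ none)) = φ none • f D (gm 0) (unitVec c) := by
        rw [funElt_apply, Fintype.sum_option]
        simp [unitVec]
      rw [this]
      exact Submodule.smul_mem _ _ (gm_mem_coideal (zero_mem_orthogonal L) (grade_unitVec c))
    · intro g q _ hq h
      refine gm_mem_coideal ?_ hq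
      intro k hk
      -- The character χ(g,·) lies in A, so it agrees at k ∈ L and at 0, where it is 1.
      have := hk _ (hgm g q hq h)
      simp only [Option.elim, chi_zero_right] at this
      exact Circle.ext this
    · rw [coideal_some, Submodule.span_le]
      rintro _ (⟨g, b, rfl⟩ | ⟨l, hl, q, hq, rfl⟩)
      · exact (hA b).2 (hcoset g)
      · suffices f D (gm l) (gm l) ∈ I by
          have h2 := slice_mem_of_invariant hI this (q := gm l) (r := q) hq.symm
          rwa [slice_f rfl, if_pos rfl] at h2
        by_cases hl0 : l = 0
        · rw [hl0]
          exact hgm0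
        -- Fourier transform of the indicator of L, followed by the slice that isolates degree l. As
        -- χ(l,·) is 1 on L, the coefficient is |L|τ², which is nonzero.
        · have h2 := slice_mem_of_invariant hI (adj_mem_of_invariant hI
            ((hA (some 0)).2 (hcoset 0)) (f D (mg 0) (mg 0))) (q := gm l) (r := gm l) rfl
          rw [adj_funElt_dual] at h2
          have h3 : ∀ g, slice (gm l) (gm l) (f D (gm g) (gm g)) =
              if g = l then f D (gm l) (gm l) else 0 := by
            intro g
            rw [slice_f rfl]
            by_cases h : g = l <;> simp [h]
          have h4 : ∀ k, cosetInd L 0 (some k) • ((D.tau : ℂ) * D.tau * (D.chi l k : ℂ)⁻¹) •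
              f D (gm l) (gm l) =
              if k ∈ L then ((D.tau : ℂ) * D.tau) • f D (gm l) (gm l) else 0 := by
            intro k
            by_cases hk : k ∈ L
            · simp [cosetInd, hk, hl k hk]
            · simp [cosetInd, hk]
          have h5 : cosetInd L 0 none = 0 := rfl
          simp only [map_sum, map_smul, h3, smul_ite, smul_zero, Finset.sum_ite_eq',
            Finset.mem_univ, if_true, h4, h5, zero_smul, add_zero] at h2
          rw [← Finset.sum_filter, Finset.sum_const, ← Nat.cast_smul_eq_nsmul ℂ, smul_smul] at h2
          refine (I.smul_mem_iff ?_).1 h2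
          refine mul_ne_zero ?_ (mul_ne_zero (tau_ne D) (tau_ne D))
          rw [Nat.cast_ne_zero]
          exact Finset.card_ne_zero_of_mem (Finset.mem_filter.2 ⟨Finset.mem_univ 0, L.zero_mem⟩)
  -- If m were separated from each point of G, its indicator would lie in A.
  · have hex : ∃ k : G, ∀ φ ∈ A, φ (some k) = φ none := by
      by_contra! hne
      apply hm
      convert indicator_mem_of_mul_mem h1 hmul none using 1
      funext a
      cases a with
      | none => simp
      | some k =>
        obtain ⟨φ, hφ, h⟩ := hne k
        rw [if_neg fun h' => h (h' φ hφ)]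
        simp
    obtain ⟨k, hk⟩ := hex
    have hconst : ∀ φ ∈ A, ∀ j, φ (some j) = φ none := by
      intro φ hφ j
      -- Translation carries k to j and fixes m, so the gluing spreads to all of G.
      have := hk _ (htr φ hφ (k - j))
      simpa using this
    refine ⟨none, le_antisymm (le_of_invariant hI ?_ ?_) ?_⟩
    · intro c φ hφ
      rw [hA] at hφ
      have : φ = φ none • (1 : Option G → ℂ) := by
        funext a
        cases a with
        | none => simp
        | some j => simp [hconst φ hφ j]
      rw [this, map_smul, coideal_none]
      exact Submodule.smul_mem _ _ (Submodule.subset_span ⟨c, rfl⟩)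
    · intro g q _ hq h
      -- Impossible: the extended character is 1 at 0 and 0 at m.
      have := hconst _ (hgm g q hq h) 0
      simp at this
    · rw [coideal_none, Submodule.span_le]
      rintro _ ⟨b, rfl⟩
      exact (hA b).2 h1

end TYAlg
end

/-! ### Blocks of the matrix representation and their convolution. -/

noncomputable section
universe u v

namespace TYAlg
open TYVec

variable {G : Type u} [AddCommGroup G] [Fintype G] [DecidableEq G] {D : TYDatum G}

variable (D) in
/-- The matrix coefficients of the blocks `{d} × Ω` of the representation `repFun`. -/
def blockFun (d : G) : Option G → Option G → TYVec G → TYVec G → ℂ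
  | some a, some a', p, q => if p = gh (a' - a) a' ∧ q = gh (a' - a) (a' + d) then 1 else 0
  | some a, none, p, q => if p = mg a ∧ q = mg (a + d) then 1 else 0
  | none, some a, p, q => if p = mbar a ∧ q = mbar (a + d) then 1 else 0
  | none, none, p, q => ∑ s, if p = gm s ∧ q = gm s then (D.chi s d : ℂ)⁻¹ else 0

theorem blockFun_of_ne (d : G) (i j : Option G) (p q : TYVec G) (h : p.grade ≠ q.grade) :
    blockFun D d i j p q = 0 := by
  have hs : ∀ (x y : TYVec G) (c : ℂ), x.grade = y.grade → (if p = x ∧ q = y then c else 0) = 0 := by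
    intro x y c hxy
    rw [if_neg]
    rintro ⟨rfl, rfl⟩
    exact h hxy
  cases i <;> cases j <;> simp only [blockFun]
  · exact Finset.sum_eq_zero fun s _ => hs _ _ _ rfl
  all_goals exact hs _ _ _ rfl

variable (D) in
/-- The matrix coefficients of the blocks `{d} × Ω` of the representation `repL`. -/
def block (d : G) (i j : Option G) : TYAlg D →ₗ[ℂ] ℂ := lift (blockFun D d i j)

theorem block_f (d : G) (i j : Option G) (p q : TYVec G) :
    block D d i j (f D p q) = blockFun D d i j p q :=
  lift_f' _ (blockFun_of_ne d i j) p q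

theorem repFun_inl_inl {p q : TYVec G} (h : p.grade = q.grade) (d d' : G) (i j : Option G) :
    repFun D p q (.inl (d, i)) (.inl (d', j)) = if d = d' then blockFun D d i j p q else 0 := by
  cases i <;> cases j <;> cases p <;> cases q <;> simp [TYVec.grade] at h <;> (try subst h) <;>
    simp [blockFun, repFun, Matrix.single_apply, Matrix.sum_apply, ite_and]
  all_goals grind

theorem repFun_inl_inr {p q : TYVec G} (h : p.grade = q.grade) (x : G × Option G) (y : G ⊕ G) :
    repFun D p q (.inl x) (.inr y) = 0 := by
  cases p <;> cases q <;> simp [TYVec.grade] at h <;> simp [repFun, Matrix.sum_apply]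

theorem repL_inl_inl (b : TYAlg D) (d d' : G) (i j : Option G) :
    repL D b (.inl (d, i)) (.inl (d', j)) = if d = d' then block D d i j b else 0 := by
  induction b using TYAlg.induction with
  | h0 => simp
  | hadd x y hx hy => simp only [map_add, Matrix.add_apply, hx, hy]; split_ifs <;> simp
  | hsmul c x hx => simp only [map_smul, Matrix.smul_apply, hx]; split_ifs <;> simp
  | hf p q h => rw [repL_f h, repFun_inl_inl h, block_f]

/-- With `repL_inl_inl` this makes each {d} × Ω decouple, so that cutting out blocks is
multiplicative. -/
theorem repL_inl_inr (b : TYAlg D) (x : G × Option G) (y : G ⊕ G) :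
    repL D b (.inl x) (.inr y) = 0 := by
  induction b using TYAlg.induction with
  | h0 => simp
  | hadd x y hx hy => simp only [map_add, Matrix.add_apply, hx, hy, add_zero]
  | hsmul c x hx => simp only [map_smul, Matrix.smul_apply, hx, smul_zero]
  | hf p q h => rw [repL_f h, repFun_inl_inr h]

/-- The block d couples a vector with its translate by d, so convolving two blocks composes
translations. The middle vectors match only if the ends of the second block are those of the first
moved by d₁. On the v^s_m it is multiplicativity of χ(s,·). -/
theorem block_convolution (d₁ d₂ : G) (i₁ j₁ i₂ j₂ : Option G) (b : TYAlg D) :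
    LinearMap.mul' ℂ ℂ (TensorProduct.map (block D d₁ i₁ j₁) (block D d₂ i₂ j₂)
      (Coalgebra.comul (R := ℂ) b)) =
      if i₂ = i₁.map (· + d₁) ∧ j₂ = j₁.map (· + d₁) then block D (d₁ + d₂) i₁ j₁ b else 0 := by
  induction b using TYAlg.induction with
  | h0 => simp
  | hadd x y hx hy => simp only [map_add, hx, hy]; split_ifs <;> simp
  | hsmul c x hx => simp only [map_smul, hx]; split_ifs <;> simp
  | hf p q h =>
    rw [comul_f]
    simp only [map_sum, TensorProduct.map_tmul, LinearMap.mul'_apply, block_f]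
    have key : ∀ P Q P' Q' : TYVec G, ∑ r, (if p = P ∧ r = Q then (1 : ℂ) else 0) *
        (if r = P' ∧ q = Q' then 1 else 0) = if p = P ∧ q = Q' ∧ Q = P' then 1 else 0 := by
      intro P Q P' Q'
      rw [Finset.sum_eq_single Q]
      · by_cases h1 : p = P <;> by_cases h2 : q = Q' <;> by_cases h3 : Q = P' <;> simp [h1, h2, h3]
      · intro r _ hr
        simp [hr]
      · simp
    cases i₁ <;> cases j₁ <;> cases i₂ <;> cases j₂ <;> simp only [blockFun, key] <;>
      simp [Finset.mul_sum, chi_add_right, mul_comm, ite_and]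
    case none.none.none.none =>
      cases p <;> cases q <;> simp [TYVec.grade] at h <;> (try subst h) <;> simp
      exact mul_comm _ _
    case some.some.some.some a a' b b' =>
      by_cases h2 : b' = a' + d₁
      · by_cases h1 : b = a + d₁
        · subst h1 h2
          simp [add_assoc]
        · have : ¬ (a' - a = b' - b) := by
            intro e
            apply h1
            rw [← sub_sub_cancel b' b, ← e, h2]
            abel
          simp [h1, this]
      · simp [h2, Ne.symm h2]
    all_goals first
      | grind
      | exact Finset.sum_eq_zero fun x _ => Finset.sum_eq_zero fun y _ => by
          split_ifs <;> simp_all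

/-- For d = 0 the block pairs each basis vector with itself, and a vector p occurs in exactly one
entry, at (`src p`, `tgt p`). -/
theorem counit_eq_sum_block (b : TYAlg D) :
    Coalgebra.counit (R := ℂ) b = ∑ i, ∑ j, block D 0 i j b := by
  induction b using TYAlg.induction with
  | h0 => simp
  | hadd x y hx hy => simp only [map_add, hx, hy, Finset.sum_add_distrib]
  | hsmul c x hx => simp only [map_smul, hx, Finset.smul_sum]
  | hf p q h =>
    simp only [counit_f, block_f, Fintype.sum_option, blockFun]
    cases p <;> cases q <;> simp [TYVec.grade] at h <;> (try subst h) <;>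
      simp [ite_and, chi_zero_right]
    case gh.gh g h h' =>
      by_cases e : h = h'
      · subst e
        rw [if_pos rfl, Finset.sum_eq_single (h - g)]
        · rw [Finset.sum_eq_single h]
          · simp
          · intro y _ hy
            simp [hy.symm]
          · simp
        · intro x _ hx
          refine Finset.sum_eq_zero fun y _ => ?_
          grind
        · simp
      · rw [if_neg e]
        symm
        refine Finset.sum_eq_zero fun x _ => Finset.sum_eq_zero fun y _ => ?_
        grind
    all_goals exact if_congr eq_comm rfl rfl

/-- Swapping the two indices inverts the translation by d; the scalars σ cancel in these entries
because their two vectors are of the same kind. -/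
theorem block_antipode (d : G) (i j : Option G) (b : TYAlg D) :
    block D d i j (antipode D b) = block D (-d) (j.map (· + d)) (i.map (· + d)) b := by
  induction b using TYAlg.induction with
  | h0 => simp
  | hadd x y hx hy => simp only [map_add, hx, hy]
  | hsmul c x hx => simp only [map_smul, hx]
  | hf p q h =>
    rw [antipode_f h, map_smul, block_f, block_f]
    cases i <;> cases j <;> cases p <;> cases q <;> simp [TYVec.grade] at h <;> (try subst h) <;>
      simp [blockFun, hat, sigma, tau_ne', chi_neg_left, chi_neg_right]
    case some.some.gh.gh =>
      refine if_congr ?_ rfl rfl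
      constructor <;> rintro ⟨⟨h1, h2⟩, -, h3⟩ <;> refine ⟨⟨?_, ?_⟩, ?_, ?_⟩ <;> grind
    all_goals exact if_congr and_comm rfl rfl

/-! ### The quantum subgroupoid of a subgroup. -/

variable (D) in
/-- The set `L × Ω` as a subset of the index set of the representation `repL`. -/
def blockIndex (L : AddSubgroup G) (x : L × Option G) : RepIndex G := .inl (x.1, x.2)

omit [Fintype G] [DecidableEq G] in
theorem blockIndex_injective (L : AddSubgroup G) : Function.Injective (blockIndex L) := by
  rintro ⟨⟨d, hd⟩, i⟩ ⟨⟨d', hd'⟩, j⟩ h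
  simpa [blockIndex] using h

variable (D) in
open Classical in
/-- The representation of `B` given by the blocks `{d} × Ω` with `d ∈ L`. -/
def subRep (L : AddSubgroup G) : TYAlg D →⋆ₐ[ℂ] Matrix (L × Option G) (L × Option G) ℂ where
  toFun b := (repL D b).submatrix (blockIndex L) (blockIndex L)
  map_one' := by rw [repL_one, Matrix.submatrix_one _ (blockIndex_injective L)]
  map_mul' b c := by
    ext ⟨⟨d, hd⟩, i⟩ ⟨⟨d', hd'⟩, j⟩
    simp only [repL_mul, Matrix.submatrix_apply, Matrix.mul_apply, blockIndex,
      Fintype.sum_sum_type, repL_inl_inr, zero_mul, Finset.sum_const_zero, add_zero,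
      Fintype.sum_prod_type, repL_inl_inl, ite_mul, mul_ite, mul_zero]
    -- An intermediate index in a block other than d contributes nothing, so summing over G or over
    -- L gives the same product.
    rw [Finset.sum_eq_single d, Finset.sum_eq_single (⟨d, hd⟩ : L)]
    · intro x _ hx
      have : d ≠ x := fun h => hx (Subtype.ext h.symm)
      simp only [if_neg this, ite_self, Finset.sum_const_zero]
    · exact fun h => absurd (Finset.mem_univ _) h
    · intro x _ hx
      simp [Ne.symm hx]
    · exact fun h => absurd (Finset.mem_univ _) h
  map_zero' := by rw [map_zero, Matrix.submatrix_zero]; rfl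
  map_add' b c := by rw [map_add, Matrix.submatrix_add]; rfl
  commutes' r := by
    rw [Algebra.algebraMap_eq_smul_one, map_smul, repL_one, Algebra.algebraMap_eq_smul_one,
      ← Matrix.submatrix_one _ (blockIndex_injective L)]
    rfl
  map_star' b := by
    rw [repL_star]
    rfl

theorem subRep_apply (L : AddSubgroup G) (b : TYAlg D) (d d' : L) (i j : Option G) :
    subRep D L b (d, i) (d', j) = if d = d' then block D d i j b else 0 := by
  simp [subRep, blockIndex, repL_inl_inl]

theorem subRep_eq_iff (L : AddSubgroup G) (b c : TYAlg D) :
    subRep D L b = subRep D L c ↔ ∀ d ∈ L, ∀ i j, block D d i j b = block D d i j c := by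
  constructor
  · intro h d hd i j
    simpa [subRep_apply] using congrFun (congrFun h (⟨d, hd⟩, i)) (⟨d, hd⟩, j)
  · intro h
    ext ⟨⟨d, hd⟩, i⟩ ⟨⟨d', hd'⟩, j⟩
    simp only [subRep_apply, h d hd]

end TYAlg

/-- A tensor square of a matrix-valued map vanishes on `t` if all products of matrix coefficients
do. -/
theorem tensor_map_eq_zero_of_entries {V : Type u} [AddCommGroup V] [Module ℂ V] {n : Type v}
    [Fintype n] [DecidableEq n] (ρ : V →ₗ[ℂ] Matrix n n ℂ) (t : V ⊗[ℂ] V)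
    (h : ∀ i j k l, LinearMap.mul' ℂ ℂ (TensorProduct.map (Matrix.entryLinearMap ℂ ℂ i j ∘ₗ ρ)
      (Matrix.entryLinearMap ℂ ℂ k l ∘ₗ ρ) t) = 0) :
    TensorProduct.map ρ ρ t = 0 := by
  have key : TensorProduct.map ρ ρ t = ∑ i, ∑ j, ∑ k, ∑ l,
      LinearMap.mul' ℂ ℂ (TensorProduct.map (Matrix.entryLinearMap ℂ ℂ i j ∘ₗ ρ)
        (Matrix.entryLinearMap ℂ ℂ k l ∘ₗ ρ) t) •
          (Matrix.single i j (1 : ℂ) ⊗ₜ[ℂ] Matrix.single k l (1 : ℂ)) := by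
    clear h
    induction t with
    | zero => simp
    | add x y hx hy => simp only [map_add, add_smul, Finset.sum_add_distrib, hx, hy]
    | tmul x y =>
      rw [TensorProduct.map_tmul]
      conv_lhs => rw [Matrix.matrix_eq_sum_single (ρ x), Matrix.matrix_eq_sum_single (ρ y)]
      simp only [TensorProduct.sum_tmul]
      refine Finset.sum_congr rfl fun i _ => Finset.sum_congr rfl fun j _ => ?_
      simp only [TensorProduct.tmul_sum]
      refine Finset.sum_congr rfl fun k _ => Finset.sum_congr rfl fun l _ => ?_
      rw [TensorProduct.map_tmul, LinearMap.mul'_apply, ← TensorProduct.smul_tmul_smul,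
        Matrix.smul_single, Matrix.smul_single]
      simp
  rw [key]
  simp only [h, zero_smul, Finset.sum_const_zero]

namespace TYAlg
open TYVec

variable {G : Type u} [AddCommGroup G] [Fintype G] [DecidableEq G] {D : TYDatum G}

open Classical in
/-- The image of `subRep D L` is a quantum subgroupoid. -/
theorem exists_isQuantumSubgroupoid_block (D : TYDatum G) (L : AddSubgroup G) :
    ∃ (C : Type u) (_ : WeakHopfCStarAlgebra C) (π : TYAlg D →⋆ₐ[ℂ] C), IsQuantumSubgroupoid π ∧
      ∀ b c, π b = π c ↔ ∀ d ∈ L, ∀ i j, block D d i j b = block D d i j c := by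
  have h0 : ∀ b, subRep D L b = 0 → ∀ d ∈ L, ∀ i j, block D d i j b = 0 := by
    intro b hb d hd i j
    rw [← map_zero (subRep D L), subRep_eq_iff] at hb
    rw [hb d hd, map_zero]
  -- The subgroup axioms of L match the requirements on the kernel: closure under addition for Δ, 0
  -- ∈ L for ε, closure under negation for S.
  obtain ⟨C, hC, π, ι, hπ, hι, h⟩ := exists_isQuantumSubgroupoid (subRep D L) (by
    intro b hb
    apply tensor_map_eq_zero_of_entries
    rintro ⟨d₁, i₁⟩ ⟨d₁', j₁⟩ ⟨d₂, i₂⟩ ⟨d₂', j₂⟩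
    have he : ∀ (d d' : L) (i j : Option G), Matrix.entryLinearMap ℂ ℂ (d, i) (d', j) ∘ₗ
        (subRep D L).toAlgHom.toLinearMap = if d = d' then block D d i j else 0 := by
      intro d d' i j
      ext b
      refine (subRep_apply L b d d' i j).trans ?_
      split_ifs <;> rfl
    rw [he, he]
    by_cases h1 : d₁ = d₁'
    · by_cases h2 : d₂ = d₂'
      · rw [if_pos h1, if_pos h2, block_convolution]
        rw [h0 b hb _ (L.add_mem d₁.2 d₂.2), ite_self]
      · rw [if_neg h2, TensorProduct.map_zero_right]
        simp
    · rw [if_neg h1, TensorProduct.map_zero_left]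
      simp) (by
    intro b hb
    rw [counit_eq_sum_block]
    exact Finset.sum_eq_zero fun i _ => Finset.sum_eq_zero fun j _ => h0 b hb 0 L.zero_mem i j) (by
    intro b hb
    rw [← map_zero (subRep D L), subRep_eq_iff]
    intro d hd i j
    rw [map_zero]
    exact (block_antipode d i j b).trans (h0 b hb _ (L.neg_mem hd) _ _))
  refine ⟨C, hC, π, hπ, fun b c => ?_⟩
  rw [← subRep_eq_iff, ← h, ← h, hι.eq_iff]

end TYAlg
end

/-! ### Every I^x is of quotient type. -/

noncomputable section
universe u v

theorem isQuantumSubgroupoid_id (B : Type u) [WeakHopfCStarAlgebra B] :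
    IsQuantumSubgroupoid (StarAlgHom.id ℂ B) where
  surjective := Function.surjective_id
  comul_comp b := by
    have : (StarAlgHom.id ℂ B).toAlgHom.toLinearMap = LinearMap.id := rfl
    rw [this, TensorProduct.map_id]
    rfl
  antipode_comp _ := rfl
  counit_comp _ := rfl

namespace TYAlg
open TYVec

variable {G : Type u} [AddCommGroup G] [Fintype G] [DecidableEq G] {D : TYDatum G}

theorem f_ne_zero {p q : TYVec G} (h : p.grade = q.grade) : f D p q ≠ 0 := by
  intro h0
  have := coeff_f (D := D) h p q
  rw [h0, map_zero] at this
  simp at this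

/-- The identity quotient has the smallest fixed point set. By the classification it is enough to
see that v^0_m ⊗ conj(v^0_m), which lies in every I^L, is not fixed. -/
theorem coideal_none_mem : coideal D none ∈ quotientTypeCoideals (TYAlg D) := by
  have hid := isQuantumSubgroupoid_id (TYAlg D)
  obtain ⟨_ | L, h⟩ := exists_eq_coideal (quotientFixed_mem_invariantCoideals hid)
  · exact ⟨_, _, _, hid, h.symm⟩
  · exfalso
    have h1 := gm_mem_coideal (zero_mem_orthogonal (D := D) L) (q := gm 0) rfl
    rw [← h] at h1
    have h2 := mem_quotientFixed_iff.1 h1 (gh 0 0) (gm 0) rfl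
    rw [slice_f rfl, if_pos rfl, coeff_f rfl, if_neg (by simp), zero_smul] at h2
    exact f_ne_zero (D := D) (p := gm 0) (q := gh 0 0) rfl h2

theorem sourceUnit_eq_funElt (a : Option G) : sourceUnit D a = funElt D a 1 := by
  simp [sourceUnit, funElt_apply]

/-- The blocks `{d} × Ω`, `d ∈ L`, see an element `v ⊗ conj(v^0_a)` with `v` an `L`-periodic
function on `Ω` only through its value at `a`. -/
theorem block_funElt {L : AddSubgroup G} {φ : Option G → ℂ}
    (hφ : ∀ k, ∀ h ∈ L, φ (some (k + h)) = φ (some k)) {d : G} (hd : d ∈ L) (i j a : Option G) :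
    block D d i j (funElt D a φ) = φ a * block D d i j (sourceUnit D a) := by
  rw [sourceUnit_eq_funElt, funElt_apply, funElt_apply]
  simp only [map_sum, map_smul, smul_eq_mul, Finset.mul_sum, Pi.one_apply, one_mul, block_f]
  refine Finset.sum_congr rfl fun x _ => ?_
  by_cases hx : φ x = φ a
  · rw [hx]
  -- In degree 0 the block d couples x and a only if a = x + d or both are m; periodicity under d ∈
  -- L then makes φ agree at them.
  · have : blockFun D d i j (unitVec x) (unitVec a) = 0 := by
      cases i <;> cases j <;> cases x <;> cases a <;> simp [blockFun, unitVec]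
      case none.none.none.none => exact absurd rfl hx
      case some.some.some.some y z k l =>
        rintro - rfl - rfl
        exact hx (hφ _ _ hd).symm
    rw [this, mul_zero, mul_zero]

theorem coideal_some_mem (L : AddSubgroup G) :
    coideal D (some L) ∈ quotientTypeCoideals (TYAlg D) := by
  obtain ⟨C, hC, π, hπ, hb⟩ := exists_isQuantumSubgroupoid_block D L
  have hmem : ∀ b, b ∈ quotientFixed π ↔ ∀ p q : TYVec G, p.grade = q.grade → ∀ d ∈ L, ∀ i j,
      block D d i j (slice q p b) = coeff p q b * block D d i j (sourceUnit D (tgt p)) := by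
    intro b
    rw [mem_quotientFixed_iff]
    refine forall₃_congr fun p q _ => ?_
    rw [← map_smul, hb]
    simp only [map_smul, smul_eq_mul]
  have hper : ∀ (L' : AddSubgroup G) (g k : G), ∀ h ∈ L',
      cosetInd L' g (some (k + h)) = cosetInd L' g (some k) := by
    classical
    intro L' g k h hh
    refine if_congr ?_ rfl rfl
    rw [show k + h - g = h + (k - g) by abel, L'.add_mem_cancel_left hh]
  have hslice : ∀ (φ : Option G → ℂ) (c : Option G) (p q : TYVec G), p.grade = q.grade →
      (q = unitVec c ∧ ∃ a, p = unitVec a) ∨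
        (slice q p (funElt D c φ) = 0 ∧ coeff p q (funElt D c φ) = 0) := by
    intro φ c p q hpq
    by_cases hq : q = unitVec c
    · left
      refine ⟨hq, exists_unitVec ?_⟩
      rw [hpq, hq, grade_unitVec]
    · right
      constructor
      · rw [funElt_apply]
        simp only [map_sum, map_smul, slice_f ((grade_unitVec _).trans (grade_unitVec _).symm),
          if_neg (Ne.symm hq), smul_zero, Finset.sum_const_zero]
      · rw [funElt_apply]
        simp only [map_sum, map_smul, coeff_f ((grade_unitVec _).trans (grade_unitVec _).symm),
          Ne.symm hq, and_false, if_false, smul_zero, Finset.sum_const_zero]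
  -- Generators in degree 0 are fixed by periodicity. For l ∈ L^⊥ the factor χ(l,d)⁻¹ is 1 for all d
  -- ∈ L, so the blocks cannot distinguish v^l_m ⊗ conj(v^l_m) from the source projection at m.
  have hle : coideal D (some L) ≤ quotientFixed π := by
    rw [coideal_some, Submodule.span_le]
    rintro _ (⟨g, c, rfl⟩ | ⟨l, hl, q', hq', rfl⟩)
    · rw [SetLike.mem_coe, hmem]
      intro p q hpq d hd i j
      rcases hslice (cosetInd L g) c p q hpq with ⟨rfl, a, rfl⟩ | ⟨h1, h2⟩
      · rw [slice_funElt, coeff_funElt, if_pos rfl, tgt_unitVec, block_funElt (hper L g) hd]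
      · rw [h1, h2, map_zero, zero_mul]
    · rw [SetLike.mem_coe, hmem]
      intro p q hpq d hd i j
      rw [slice_f (p := gm l) hq'.symm, coeff_f (p := gm l) hq'.symm]
      by_cases hq : q' = q
      · subst hq
        rw [if_pos rfl, block_f]
        rw [hq'] at hpq
        cases p with
        | gh g k =>
          simp only [reduceCtorEq, false_and, if_false, zero_mul]
          cases i <;> cases j <;> simp [blockFun]
        | gm g =>
          simp only [TYVec.grade, Option.some.injEq] at hpq
          subst hpq
          have h1 : sourceUnit D (tgt (gm g)) =
              f D (gm 0) (gm 0) + ∑ k, f D (gh 0 k) (gm 0) := by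
            rw [sourceUnit, Fintype.sum_option]
            rfl
          rw [if_pos ⟨rfl, rfl⟩, one_mul, h1]
          simp only [map_add, map_sum, block_f]
          cases i <;> cases j <;> simp [blockFun, hl d hd, chi_zero_left]
        | mg k => simp [TYVec.grade] at hpq
        | mbar k => simp [TYVec.grade] at hpq
      · rw [if_neg hq, if_neg (fun h => hq h.2), map_zero, zero_mul]
  -- The reverse inclusion is not computed: the fixed point set is some I^x, and comparison with I^L
  -- leaves only x = some L' with L' ≤ L.
  obtain ⟨_ | L', hL'⟩ := exists_eq_coideal (quotientFixed_mem_invariantCoideals hπ)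
  · exact absurd (hL' ▸ hle) (not_coideal_some_le_none L)
  · have h1 : L' ≤ L := le_of_coideal_le (hL' ▸ hle)
    have h2 : L ≤ L' := by
      intro k hk
      have hF := funElt_cosetInd_mem (D := D) L' 0 (some 0)
      rw [← hL', hmem] at hF
      -- Test the indicator of L' on the block d = k at the entry (0, 0): the left side is its value
      -- at 0, which is 1, while the right side carries its value at k, which is 0 if k ∉ L'.
      have h3 := hF (unitVec (some k)) (unitVec (some 0))
        ((grade_unitVec _).trans (grade_unitVec _).symm) k hk (some 0) (some 0)
      rw [slice_funElt, coeff_funElt, if_pos rfl, funElt_apply] at h3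
      by_contra hkL
      have h4 : cosetInd L' 0 (some k) = 0 := by simp [cosetInd, hkL]
      have h5 : cosetInd L' 0 (some 0) = 1 := by simp [cosetInd, L'.zero_mem]
      rw [h4, zero_mul, Fintype.sum_option] at h3
      simp [block_f, blockFun, unitVec, h5] at h3
    rw [le_antisymm h2 h1, ← hL']
    exact ⟨C, hC, π, hπ, rfl⟩

end TYAlg
end

theorem corollary5p8 {G : Type*} [AddCommGroup G] [Fintype G] [DecidableEq G] (D : TYDatum G) :
    quotientTypeCoideals (TYAlg D) = invariantCoideals (TYAlg D) ∧
    Set.BijOn (fun x : Option (AddSubgroup G) => TYAlg.coideal D x) Set.univ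
      (invariantCoideals (TYAlg D)) := by
  have h : ∀ x, TYAlg.coideal D x ∈ quotientTypeCoideals (TYAlg D) := by
    rintro (_ | L)
    · exact TYAlg.coideal_none_mem
    · exact TYAlg.coideal_some_mem L
  refine ⟨Set.Subset.antisymm TYAlg.quotientTypeCoideals_subset fun I hI => ?_,
    fun x _ => TYAlg.quotientTypeCoideals_subset (h x), TYAlg.coideal_injective.injOn,
    fun I hI => ?_⟩
  · obtain ⟨x, rfl⟩ := TYAlg.exists_eq_coideal hI
    exact h x
  · obtain ⟨x, rfl⟩ := TYAlg.exists_eq_coideal hI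
    exact ⟨x, trivial, rfl⟩
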